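/- Let $N\ge 1$, $s\in(0,1)$, $0<\gamma\le\Gamma<\infty$. For nonempty index sets $I,J$ let $\{K_{ij}\}_{i\in I,j\in J}$ be even kernels on $\mathbb R^N\setminus\{0\}$ of the form $K_{ij}(z)=a_{ij}(z/|z|)\,|z|^{-(N+2s)}$, where $a_{ij}:S^{N-1}\to\mathbb R$ is measurable and $\gamma\le a_{ij}\le\Gamma$. For measurable $A\subseteq\mathbb R^N$ put $$L_{ij}[A]v(x)=\mathrm{P.V.}\int_A [v(y)-v(x)]\,K_{ij}(x-y)\,dy ,$$ and let $\mathcal I v=\inf_{i\in I}\sup_{j\in J}L_{ij}[\mathbb R^N]v$. Let $\Omega\subset\mathbb R^N$ be a bounded domain with $C^2$ boundary, and let $d(x)=\mathrm{dist}(x,\partial\Omega)$. Let $u:\mathbb R^N\to\mathbb R$ be a viscosity subsolution of the Dirichlet problem $\mathcal I u=0$ in $\Omega$, $u=0$ in $\mathbb R^N\setminus\overline\Omega$, $\lim_{z\to x,\,z\in\Omega}d(z)^{1-s}u(z)=0$ for $x\in\partial\Omega$. That is: (i) $u\in L^1_{loc}(\mathbb R^N)$, $\int_{\mathbb R^N}|u(y)|(1+|y|)^{-(N+2s)}\,dy<\infty$,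 $u\in L^\infty_{loc}(\Omega)$, and $u$ is upper semicontinuous in $\Omega$; (ii) whenever $x_0\in\Omega$, $\delta>0$, $B_\delta(x_0)\subset\Omega$, and $\varphi\in C^2(B_\delta(x_0))\cap L^1(B_\delta(x_0))$ is such that $x_0$ is a maximum point of $u-\varphi$ in $B_\delta(x_0)$, we have $$\inf_{i\in I}\sup_{j\in J}\big\{L_{ij}[B_\delta(x_0)]\varphi(x_0)+L_{ij}[\mathbb R^N\setminus B_\delta(x_0)]u(x_0)\big\}\ \ge\ 0;$$ (iii) $u\le 0$ in $\mathbb R^N\setminus\overline\Omega$; (iv) $\limsup_{z\to x,\,z\in\Omega}d(z)^{1-s}u(z)\le 0$ for every $x\in\partial\Omega$. Then $u\le 0$ in $\Omega$. -/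

import Mathlib

open Set Filter Topology MeasureTheory

noncomputable section

namespace FracHarm

/-- `Ω ⊆ ℝ^N` has `C²` boundary: near each boundary point, `Ω` is the positivity set of a `C²`
function whose gradient does not vanish. -/
def HasC2Boundary {N : ℕ} (Ω : Set (EuclideanSpace ℝ (Fin N))) : Prop :=
  ∀ x ∈ frontier Ω, ∃ (U : Set (EuclideanSpace ℝ (Fin N))) (ψ : EuclideanSpace ℝ (Fin N) → ℝ),
    IsOpen U ∧ x ∈ U ∧ ContDiffOn ℝ 2 ψ U ∧ (∀ y ∈ U, fderiv ℝ ψ y ≠ 0) ∧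
      ∀ y ∈ U, (y ∈ Ω ↔ 0 < ψ y)

/-- A bounded domain (open, connected, nonempty set) of `ℝ^N` with `C²` boundary. -/
structure IsBoundedC2Domain {N : ℕ} (Ω : Set (EuclideanSpace ℝ (Fin N))) : Prop where
  isOpen : IsOpen Ω
  isConnected : IsConnected Ω
  isBounded : Bornology.IsBounded Ω
  boundary : HasC2Boundary Ω

/-- The class `𝒦` of even kernels `K(z) = a(z/|z|) |z|^{-(N+2s)}`, `z ≠ 0`, with `a` a measurable
function on the unit sphere such that `γ ≤ a ≤ Γ`. The value of `K` at `0` plays no role. -/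
structure IsStableKernel {N : ℕ} (s γ Γ : ℝ) (K : EuclideanSpace ℝ (Fin N) → ℝ) : Prop where
  even : ∀ z, z ≠ 0 → K (-z) = K z
  stable : ∃ a : Metric.sphere (0 : EuclideanSpace ℝ (Fin N)) 1 → ℝ,
    Measurable a ∧ (∀ θ, γ ≤ a θ ∧ a θ ≤ Γ) ∧
      ∀ (θ : Metric.sphere (0 : EuclideanSpace ℝ (Fin N)) 1) (r : ℝ), 0 < r →
        K (r • (θ : EuclideanSpace ℝ (Fin N))) = a θ / r ^ ((N : ℝ) + 2 * s)

/-- The distance `d(x)` to the boundary of `Ω`. -/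
def bdist {N : ℕ} (Ω : Set (EuclideanSpace ℝ (Fin N))) (x : EuclideanSpace ℝ (Fin N)) : ℝ :=
  Metric.infDist x (frontier Ω)

/-- `u ∈ L¹_ω(ℝ^N)`, with the weight `ω(y) = (1 + |y|)^{-(N+2s)}`. -/
def MemL1Weight {N : ℕ} (s : ℝ) (u : EuclideanSpace ℝ (Fin N) → ℝ) : Prop :=
  LocallyIntegrable u volume ∧
    Integrable (fun y => |u y| * (1 / (1 + ‖y‖) ^ ((N : ℝ) + 2 * s))) volume

/-- `u ∈ L^∞_loc(Ω)`: `u` is essentially bounded on each compact subset of `Ω`. -/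
def MemLinftyLoc {N : ℕ} (Ω : Set (EuclideanSpace ℝ (Fin N)))
    (u : EuclideanSpace ℝ (Fin N) → ℝ) : Prop :=
  ∀ C : Set (EuclideanSpace ℝ (Fin N)), IsCompact C → C ⊆ Ω → MemLp u ⊤ (volume.restrict C)

/-- `L_K[A]v(x) = P.V. ∫_A (v(y) - v(x)) K(x - y) dy`, that is, the limit as `ε → 0⁺` of the
integrals over `A \ B_ε(x)`. The limit exists for `K` in the class `𝒦` if `A` is a ball centred
at `x` and `v` is `C²` and integrable on it, and if `A` is the complement of such a ball and
`v ∈ L¹_ω(ℝ^N)`; it is used in these two cases only. -/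
def pvOp {N : ℕ} (K : EuclideanSpace ℝ (Fin N) → ℝ) (A : Set (EuclideanSpace ℝ (Fin N)))
    (v : EuclideanSpace ℝ (Fin N) → ℝ) (x : EuclideanSpace ℝ (Fin N)) : ℝ :=
  limUnder (𝓝[>] (0 : ℝ)) fun ε => ∫ y in A \ Metric.ball x ε, (v y - v x) * K (x - y)

/-- `𝓘_δ(u, φ, x) = inf_i sup_j { L_ij[B_δ(x)] φ(x) + L_ij[B_δ(x)ᶜ] u(x) }`, with the infimum and
the supremum taken in the extended reals. -/
def isaacsDelta {N : ℕ} {I J : Type*} (K : I → J → EuclideanSpace ℝ (Fin N) → ℝ) (δ : ℝ)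
    (u φ : EuclideanSpace ℝ (Fin N) → ℝ) (x : EuclideanSpace ℝ (Fin N)) : EReal :=
  ⨅ i, ⨆ j, ((pvOp (K i j) (Metric.ball x δ) φ x +
    pvOp (K i j) (Metric.ball x δ)ᶜ u x : ℝ) : EReal)

/-- Viscosity subsolutions of `𝓘u = f` in `Ω`, where `𝓘 = inf_i sup_j L_{K_ij}`. The test
functions `φ` are integrable on the ball on which they are `C²`, so that `L_ij[B_δ(x₀)]φ(x₀)` is
well defined. -/
structure IsViscositySubsolution {N : ℕ} {I J : Type*} (s : ℝ)
    (K : I → J → EuclideanSpace ℝ (Fin N) → ℝ) (Ω : Set (EuclideanSpace ℝ (Fin N)))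
    (f u : EuclideanSpace ℝ (Fin N) → ℝ) : Prop where
  memL1Weight : MemL1Weight s u
  memLinftyLoc : MemLinftyLoc Ω u
  usc : UpperSemicontinuousOn u Ω
  viscosity : ∀ x₀ ∈ Ω, ∀ δ : ℝ, 0 < δ → Metric.ball x₀ δ ⊆ Ω →
    ∀ φ : EuclideanSpace ℝ (Fin N) → ℝ, ContDiffOn ℝ 2 φ (Metric.ball x₀ δ) →
      IntegrableOn φ (Metric.ball x₀ δ) volume →
      IsMaxOn (fun y => u y - φ y) (Metric.ball x₀ δ) x₀ →
      ((f x₀ : ℝ) : EReal) ≤ isaacsDelta K δ u φ x₀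

/-- Viscosity subsolutions of the Dirichlet problem `𝓘u = f` in `Ω`, `u = g` outside the closure
of `Ω`, `lim_{z → x, z ∈ Ω} d(z)^{1-s} u(z) = h(x)` for `x ∈ ∂Ω`. The upper limit is taken in the
extended reals. -/
structure IsDirichletSubsolution {N : ℕ} {I J : Type*} (s : ℝ)
    (K : I → J → EuclideanSpace ℝ (Fin N) → ℝ) (Ω : Set (EuclideanSpace ℝ (Fin N)))
    (f g h u : EuclideanSpace ℝ (Fin N) → ℝ) : Prop where
  subsolution : IsViscositySubsolution s K Ω f u
  exterior : ∀ x ∉ closure Ω, u x ≤ g x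
  boundary : ∀ x ∈ frontier Ω,
    limsup (fun z => ((bdist Ω z ^ (1 - s) * u z : ℝ) : EReal)) (𝓝[Ω] x) ≤ ((h x : ℝ) : EReal)

end FracHarm

end

/-!
Let `ρ` be a `C²` defining function of `Ω`. Near the boundary `ρ` is close to its affine part, so a
kernel `K` acts on powers of `ρ` essentially as the one-dimensional operator with kernel
`|r| ^ (-1 - 2 s)` acts on powers of `t`, once in each direction of the sphere. That operator
annihilates `t ^ (s - 1)` and is negative on `t ^ (s - 1 + η)` for small `η > 0`, with an error of
lower order coming from the curvature of `ρ`. Hence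
`w = ρ ^ (s - 1) + ρ ^ (s - 1 + η) + M 1_Ω` is a strict supersolution for all kernels at once, and
it blows up like `d ^ (s - 1)` at the boundary. The boundary condition makes `u - ε w` negative near
the boundary, so a positive value of `u - ε w` forces an interior maximum, at which `ε w` is a test
function that contradicts the viscosity inequality.
-/

noncomputable section

namespace FracHarm

open scoped ENNReal

local notation "𝔼" N:max => EuclideanSpace ℝ (Fin N)

/-- The symmetric second difference of `v` at `x` with increment `z`. For an even kernel `K`, the
principal value of `∫ (v y - v x) K (x - y) dy` is half the integral of
`secondDiff v x z * K z` in `z`. -/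
def secondDiff {E : Type*} [AddCommGroup E] (v : E → ℝ) (x z : E) : ℝ :=
  v (x + z) + v (x - z) - 2 * v x

lemma secondDiff_add {E : Type*} [AddCommGroup E] (v w : E → ℝ) (x z : E) :
    secondDiff (fun y => v y + w y) x z = secondDiff v x z + secondDiff w x z := by
  unfold secondDiff; ring

lemma secondDiff_const_mul {E : Type*} [AddCommGroup E] (c : ℝ) (v : E → ℝ) (x z : E) :
    secondDiff (fun y => c * v y) x z = c * secondDiff v x z := by
  unfold secondDiff; ring

section Taylor

variable {E F : Type*} [NormedAddCommGroup E] [NormedSpace ℝ E] [NormedAddCommGroup F]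
  [NormedSpace ℝ F]

lemma norm_sub_sub_fderiv_le {f : E → F} {B : Set E} (hB : Convex ℝ B) {C : ℝ} (hC : 0 ≤ C)
    (hd : ∀ y ∈ B, DifferentiableAt ℝ f y) {x y : E} (hx : x ∈ B) (hy : y ∈ B)
    (hL : ∀ z ∈ B, ‖fderiv ℝ f z - fderiv ℝ f x‖ ≤ C * ‖z - x‖) :
    ‖f y - f x - fderiv ℝ f x (y - x)‖ ≤ C * ‖y - x‖ ^ 2 := by
  have h := (hB.inter (convex_closedBall x ‖y - x‖)).norm_image_sub_le_of_norm_hasFDerivWithin_le'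
    (C := C * ‖y - x‖) (fun z hz => (hd z hz.1).hasFDerivAt.hasFDerivWithinAt)
    (fun z hz => (hL z hz.1).trans (by gcongr; exact mem_closedBall_iff_norm.1 hz.2))
    (x := x) (y := y) ⟨hx, by simp⟩ ⟨hy, by simp [dist_eq_norm]⟩
  rwa [mul_assoc, ← sq] at h

lemma exists_abs_secondDiff_le {f : E → ℝ} {x : E} (h : ContDiffAt ℝ 2 f x) :
    ∃ C : ℝ, 0 ≤ C ∧ ∃ r : ℝ, 0 < r ∧ ∀ z, ‖z‖ < r → |secondDiff f x z| ≤ C * ‖z‖ ^ 2 := by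
  have h1 : ContDiffAt ℝ 1 (fderiv ℝ f) x := h.fderiv_right (by norm_num)
  obtain ⟨K, t, ht, hK⟩ := h1.exists_lipschitzOnWith
  have h2 : ∀ᶠ y in 𝓝 x, ContDiffAt ℝ 2 f y := h.eventually (by simp)
  obtain ⟨r, hr, hrt⟩ := Metric.mem_nhds_iff.1 (inter_mem ht h2)
  refine ⟨2 * K, by positivity, r, hr, fun z hz => ?_⟩
  have hxr : x ∈ Metric.ball x r := Metric.mem_ball_self hr
  have taylor (w : E) (hw : ‖w‖ < r) : |f (x + w) - f x - fderiv ℝ f x w| ≤ K * ‖w‖ ^ 2 := by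
    simpa using norm_sub_sub_fderiv_le (convex_ball x r) K.coe_nonneg
      (fun y hy => ContDiffAt.differentiableAt (n := 2) (hrt hy).2 two_ne_zero) hxr (y := x + w)
      (by simpa using hw)
      (fun y hy => by
        simpa only [dist_eq_norm] using hK.dist_le_mul y (hrt hy).1 x (hrt hxr).1)
  have a := taylor z hz
  have b := taylor (-z) (by simpa using hz)
  rw [norm_neg, map_neg, ← sub_eq_add_neg] at b
  rw [secondDiff, abs_le] at *
  constructor <;> linarith [a.1, a.2, b.1, b.2]

end Taylor

/-- The power `t ↦ t_+^σ`, with value `0` for `t ≤ 0` whatever the exponent. -/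
def posRpow (σ t : ℝ) : ℝ := if 0 < t then t ^ σ else 0

lemma posRpow_of_pos {σ t : ℝ} (ht : 0 < t) : posRpow σ t = t ^ σ := if_pos ht

lemma posRpow_of_nonpos {σ t : ℝ} (ht : t ≤ 0) : posRpow σ t = 0 := if_neg ht.not_gt

lemma posRpow_nonneg (σ t : ℝ) : 0 ≤ posRpow σ t := by
  unfold posRpow; split_ifs with h <;> positivity

@[fun_prop]
lemma measurable_posRpow (σ : ℝ) : Measurable (posRpow σ) :=
  Measurable.ite measurableSet_Ioi (by fun_prop) measurable_const

lemma contDiffAt_posRpow (σ : ℝ) {t : ℝ} (ht : 0 < t) : ContDiffAt ℝ 2 (posRpow σ) t :=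
  (Real.contDiffAt_rpow_const_of_ne ht.ne').congr_of_eventuallyEq <| by
    filter_upwards [lt_mem_nhds ht] with r hr using posRpow_of_pos hr

lemma secondDiff_posRpow_one {σ r : ℝ} (hr : 0 ≤ r) :
    secondDiff (posRpow σ) 1 r = (1 + r) ^ σ + posRpow σ (1 - r) - 2 := by
  rw [secondDiff, posRpow_of_pos (by linarith), posRpow_of_pos one_pos, Real.one_rpow, mul_one]

@[fun_prop]
lemma measurable_secondDiff_posRpow (σ t : ℝ) : Measurable (secondDiff (posRpow σ) t) := by
  unfold secondDiff; fun_prop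

/-- The incomplete Beta integral `∫_ε^1 (1 - r)^σ r^{-1-2s} dr`. -/
def incBeta (s σ ε : ℝ) : ℝ := ∫ r in Ioi ε, posRpow σ (1 - r) * r ^ (-1 - 2 * s)

section IncBeta

variable {s σ η ε : ℝ}

lemma integrableOn_Ioi_rpow_neg_one_sub (hs : 0 < s) (hε : 0 < ε) :
    IntegrableOn (fun r : ℝ => r ^ (-1 - 2 * s)) (Ioi ε) :=
  integrableOn_Ioi_rpow_of_lt (by linarith) hε

lemma integrableOn_one_add_rpow_mul (hs : 0 < s) (hσ : σ ≤ 0) (hε : 0 < ε) :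
    IntegrableOn (fun r => (1 + r) ^ σ * r ^ (-1 - 2 * s)) (Ioi ε) := by
  refine (integrableOn_Ioi_rpow_neg_one_sub hs hε).mono' (by fun_prop) ?_
  filter_upwards [ae_restrict_mem measurableSet_Ioi] with r hr
  have hr : 0 < r := hε.trans hr
  rw [Real.norm_of_nonneg (by positivity)]
  exact mul_le_of_le_one_left (by positivity)
    (Real.rpow_le_one_of_one_le_of_nonpos (by linarith) hσ)

lemma integrableOn_posRpow_one_sub_mul (hσ : -1 < σ) (hε : 0 < ε) :
    IntegrableOn (fun r => posRpow σ (1 - r) * r ^ (-1 - 2 * s)) (Ioi ε) := by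
  have h1 : IntegrableOn (fun r : ℝ => (1 - r) ^ σ) (Icc ε (max 1 ε)) := by
    have := (intervalIntegral.intervalIntegrable_rpow' (a := 1 - ε) (b := 1 - max 1 ε)
      hσ).comp_sub_left 1
    simp only [sub_sub_cancel] at this
    rwa [intervalIntegrable_iff_integrableOn_Icc_of_le (le_max_right _ _)] at this
  have h2 : IntegrableOn (fun r : ℝ => (1 - r) ^ σ * r ^ (-1 - 2 * s)) (Icc ε (max 1 ε)) :=
    h1.mul_continuousOn (fun r hr => (Real.continuousAt_rpow_const _ _
      (Or.inl (hε.trans_le hr.1).ne')).continuousWithinAt) isCompact_Icc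
  have h3 : IntegrableOn (fun r => posRpow σ (1 - r) * r ^ (-1 - 2 * s)) (Icc ε (max 1 ε)) := by
    refine Integrable.mono h2 (by fun_prop) (Eventually.of_forall fun r => ?_)
    rw [norm_mul, norm_mul]
    gcongr
    unfold posRpow
    split_ifs <;> simp
  refine h3.of_forall_sdiff_eq_zero measurableSet_Ioi fun r hr => ?_
  have : 1 < r := by
    by_contra! hr1
    exact hr.2 ⟨(mem_Ioi.1 hr.1).le, hr1.trans (le_max_left _ _)⟩
  rw [posRpow_of_nonpos (by linarith), zero_mul]

lemma image_div_one_sub_Ioo (hε : 0 < ε) :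
    (fun q : ℝ => q / (1 - q)) '' Ioo (ε / (1 + ε)) 1 = Ioi ε := by
  ext r
  constructor
  · rintro ⟨q, ⟨h1, h2⟩, rfl⟩
    have : 0 < 1 - q := by linarith
    rw [div_lt_iff₀ (by positivity)] at h1
    rw [mem_Ioi, lt_div_iff₀ this]
    nlinarith
  · intro hr
    have hr0 : ε < r := hr
    have : 0 < 1 + r := by linarith
    refine ⟨r / (1 + r), ⟨?_, ?_⟩, ?_⟩
    · rw [div_lt_div_iff₀ (by positivity) this]; nlinarith
    · rw [div_lt_one this]; linarith
    · simp only; field_simp; ring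

lemma setIntegral_Ioo_one_sub_rpow_mul (a : ℝ) :
    ∫ q in Ioo a 1, (1 - q) ^ σ * q ^ (-1 - 2 * s) = incBeta s σ a := by
  rw [incBeta, setIntegral_eq_of_subset_of_forall_sdiff_eq_zero measurableSet_Ioi
    Ioo_subset_Ioi_self]
  · refine setIntegral_congr_fun measurableSet_Ioo fun q hq => ?_
    rw [posRpow_of_pos (by linarith [hq.2])]
  · intro q hq
    have : 1 ≤ q := by
      by_contra! hq1
      exact hq.2 ⟨hq.1, hq1⟩
    rw [posRpow_of_nonpos (by linarith), zero_mul]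

/- The substitution `r = q / (1 - q)`, under which `1 + r = (1 - q)⁻¹`, exchanges the exponents
`σ` and `2 s - 1 - σ`. -/
lemma integral_one_add_rpow_mul (hε : 0 < ε) :
    ∫ r in Ioi ε, (1 + r) ^ σ * r ^ (-1 - 2 * s) = incBeta s (2 * s - 1 - σ) (ε / (1 + ε)) := by
  rw [← image_div_one_sub_Ioo hε, integral_image_eq_integral_abs_deriv_smul measurableSet_Ioo
    (f' := fun q => 1 / (1 - q) ^ 2), ← setIntegral_Ioo_one_sub_rpow_mul]
  · refine setIntegral_congr_fun measurableSet_Ioo fun q hq => ?_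
    have hq0 : 0 < q := lt_trans (by positivity) hq.1
    have h1 : 0 < 1 - q := by linarith [hq.2]
    have h2 : (1 - q) ^ (2 * s - 1 - σ) = (1 - q) ^ (-2 : ℝ) * (1 - q) ^ (-σ) *
        (1 - q) ^ (1 + 2 * s) := by
      rw [← Real.rpow_add h1, ← Real.rpow_add h1]; congr 1; ring
    have h3 : (1 - q) ^ (-1 - 2 * s) = ((1 - q) ^ (1 + 2 * s))⁻¹ := by
      rw [← Real.rpow_neg h1.le]; congr 1; ring
    have h4 : 1 + q / (1 - q) = (1 - q)⁻¹ := by field_simp; ring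
    simp only [smul_eq_mul]
    rw [abs_of_nonneg (by positivity), h4, Real.div_rpow hq0.le h1.le, Real.inv_rpow h1.le, h2, h3,
      Real.rpow_neg h1.le, Real.rpow_neg h1.le, Real.rpow_two]
    field_simp
  · intro q hq
    have h1 : 1 - q ≠ 0 := by linarith [hq.2]
    have := (hasDerivAt_id q).div ((hasDerivAt_id q).const_sub 1) h1
    exact (this.congr_deriv (by simp)).hasDerivWithinAt
  · intro a ha b hb hab
    have h1 : 1 - a ≠ 0 := by linarith [ha.2]
    have h2 : 1 - b ≠ 0 := by linarith [hb.2]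
    have hab : a / (1 - a) = b / (1 - b) := hab
    rw [div_eq_div_iff h1 h2] at hab
    linarith

lemma hasDerivAt_one_sub_rpow_mul_rpow (hs : 0 < s) {r : ℝ} (hr0 : 0 < r) (hr1 : r < 1) :
    HasDerivAt (fun r => -(1 / s) * ((1 - r) ^ s * r ^ (-2 * s)))
      (((1 - r) ^ (s - 1) + (1 - r) ^ s) * r ^ (-1 - 2 * s)) r := by
  have h1 : 0 < 1 - r := by linarith
  have d1 : HasDerivAt (fun r : ℝ => (1 - r) ^ s) (-1 * s * (1 - r) ^ (s - 1)) r :=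
    ((hasDerivAt_id r).const_sub 1).rpow_const (Or.inl h1.ne')
  have d2 := Real.hasDerivAt_rpow_const (x := r) (p := -2 * s) (Or.inl hr0.ne')
  refine ((d1.mul d2).const_mul (-(1 / s))).congr_deriv ?_
  have e1 : (1 - r) ^ s = (1 - r) ^ (s - 1) * (1 - r) := by
    rw [← Real.rpow_add_one h1.ne', sub_add_cancel]
  have e2 : r ^ (-2 * s) = r ^ (-1 - 2 * s) * r := by
    rw [← Real.rpow_add_one hr0.ne']; congr 1; ring
  have e3 : r ^ (-2 * s - 1) = r ^ (-1 - 2 * s) := by congr 1; ring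
  rw [e1, e2, e3]
  field_simp
  ring

lemma incBeta_sub_one_add_incBeta_self (hs : 0 < s) (hε : 0 < ε) (hε1 : ε < 1) :
    incBeta s (s - 1) ε + incBeta s s ε = 1 / s * ((1 - ε) ^ s * ε ^ (-2 * s)) := by
  have hi (σ : ℝ) (hσ : -1 < σ) : IntegrableOn (fun r => (1 - r) ^ σ * r ^ (-1 - 2 * s))
      (Ioo ε 1) := by
    refine ((integrableOn_posRpow_one_sub_mul (s := s) hσ hε).mono_set
      Ioo_subset_Ioi_self).congr_fun (fun r hr => ?_) measurableSet_Ioo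
    simp only [posRpow_of_pos (by linarith [hr.2] : 0 < 1 - r)]
  have hi1 := hi (s - 1) (by linarith)
  have hi2 := hi s (by linarith)
  have hsum : IntegrableOn (fun r => ((1 - r) ^ (s - 1) + (1 - r) ^ s) * r ^ (-1 - 2 * s))
      (Ioo ε 1) := by
    simp only [add_mul]; exact hi1.add hi2
  rw [← setIntegral_Ioo_one_sub_rpow_mul, ← setIntegral_Ioo_one_sub_rpow_mul,
    ← integral_add hi1 hi2, ← integral_Ioc_eq_integral_Ioo,
    ← intervalIntegral.integral_of_le hε1.le]
  simp only [← add_mul]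
  rw [intervalIntegral.integral_eq_sub_of_hasDerivAt_of_le hε1.le
    (f := fun r => -(1 / s) * ((1 - r) ^ s * r ^ (-2 * s))) ?_
    (fun r hr => hasDerivAt_one_sub_rpow_mul_rpow hs (hε.trans hr.1) hr.2)
    ((intervalIntegrable_iff_integrableOn_Ioo_of_le hε1.le).2 hsum)]
  · simp [Real.zero_rpow hs.ne']
  · refine continuousOn_const.mul (ContinuousOn.mul ?_ fun r hr => (Real.continuousAt_rpow_const _ _
      (Or.inl (hε.trans_le hr.1).ne')).continuousWithinAt)
    exact (Continuous.rpow_const (by fun_prop) fun _ => Or.inr hs.le).continuousOn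

lemma incBeta_div_one_add_le (hs : 0 < s) (hσ : 0 ≤ σ) (hε : 0 < ε) (hε1 : ε < 1) :
    incBeta s σ (ε / (1 + ε)) ≤
      ((1 + ε) ^ (2 * s) - 1) * ε ^ (-2 * s) / (2 * s) + incBeta s σ ε := by
  set a := ε / (1 + ε) with ha
  have ha0 : 0 < a := by positivity
  have haε : a ≤ ε := div_le_self hε.le (by linarith)
  have hi := integrableOn_posRpow_one_sub_mul (s := s) (σ := σ) (by linarith) ha0
  have hle : ∀ q ∈ Ioc a ε, posRpow σ (1 - q) * q ^ (-1 - 2 * s) ≤ q ^ (-1 - 2 * s) := by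
    intro q hq
    have hq0 : 0 < q := ha0.trans hq.1
    refine mul_le_of_le_one_left (by positivity) ?_
    rw [posRpow_of_pos (by linarith [hq.2])]
    exact Real.rpow_le_one (by linarith [hq.2]) (by linarith) hσ
  have hIoc : ∫ q in Ioc a ε, q ^ (-1 - 2 * s) =
      ((1 + ε) ^ (2 * s) - 1) * ε ^ (-2 * s) / (2 * s) := by
    rw [← intervalIntegral.integral_of_le haε, integral_rpow (Or.inr ⟨by linarith, ?_⟩),
      show -1 - 2 * s + 1 = -(2 * s) by ring, ha, Real.div_rpow hε.le (by linarith),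
      Real.rpow_neg (by linarith : 0 ≤ 1 + ε), neg_mul]
    · field_simp
      ring
    · rw [uIcc_of_le haε]
      exact fun h => ha0.not_ge h.1
  rw [incBeta, incBeta, ← Ioc_union_Ioi_eq_Ioi haε, setIntegral_union (Ioc_disjoint_Ioi le_rfl)
    measurableSet_Ioi (hi.mono_set Ioc_subset_Ioi_self) (hi.mono_set (Ioi_subset_Ioi haε)), ← hIoc]
  gcongr ?_ + _
  exact setIntegral_mono_on (hi.mono_set Ioc_subset_Ioi_self)
    ((integrableOn_Ioi_rpow_neg_one_sub hs ha0).mono_set Ioc_subset_Ioi_self) measurableSet_Ioc hle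

end IncBeta

/-- The convexity defect `t^{s-1} + t^s - t^{s-1+η} - t^{s-η}` of the exponential `σ ↦ t^σ`. -/
def rpowGap (s η t : ℝ) : ℝ :=
  posRpow (s - 1) t + posRpow s t - posRpow (s - 1 + η) t - posRpow (s - η) t

section RpowGap

variable {s η ε : ℝ}

lemma rpowGap_eq {t : ℝ} (ht : 0 < t) :
    rpowGap s η t = (t ^ (s - 1) - t ^ (s - η)) * (1 - t ^ η) := by
  have e1 : t ^ (s - 1 + η) = t ^ (s - 1) * t ^ η := Real.rpow_add ht _ _
  have e2 : t ^ s = t ^ (s - η) * t ^ η := by rw [← Real.rpow_add ht, sub_add_cancel]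
  simp only [rpowGap, posRpow_of_pos ht]
  rw [e1, e2]; ring

lemma rpowGap_nonneg {t : ℝ} (h0 : 0 ≤ η) (h1 : η ≤ 1) (ht : t ≤ 1) : 0 ≤ rpowGap s η t := by
  rcases le_or_gt t 0 with h | h
  · simp [rpowGap, posRpow_of_nonpos h]
  · rw [rpowGap_eq h]
    refine mul_nonneg (sub_nonneg.2 ?_) (sub_nonneg.2 (Real.rpow_le_one h.le ht h0))
    exact Real.rpow_le_rpow_of_exponent_ge h ht (by linarith)

lemma rpowGap_pos {t : ℝ} (h0 : 0 < η) (h1 : η < 1) (h : 0 < t) (ht : t < 1) :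
    0 < rpowGap s η t := by
  rw [rpowGap_eq h]
  refine mul_pos (sub_pos.2 ?_) (sub_pos.2 (Real.rpow_lt_one h.le ht h0))
  exact Real.rpow_lt_rpow_of_exponent_gt h ht (by linarith)

lemma integrableOn_rpowGap (hs : 0 < s) (h0 : 0 ≤ η) (h1 : η < s) (hε : 0 < ε) :
    IntegrableOn (fun r => rpowGap s η (1 - r) * r ^ (-1 - 2 * s)) (Ioi ε) := by
  have h (σ : ℝ) (hσ : -1 < σ) := integrableOn_posRpow_one_sub_mul (s := s) hσ hε
  simp only [rpowGap, sub_mul, add_mul]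
  exact (((h _ (by linarith)).add (h _ (by linarith))).sub (h _ (by linarith))).sub
    (h _ (by linarith))

lemma integral_rpowGap (hs : 0 < s) (h0 : 0 ≤ η) (h1 : η < s) (hε : 0 < ε) :
    ∫ r in Ioi ε, rpowGap s η (1 - r) * r ^ (-1 - 2 * s) =
      incBeta s (s - 1) ε + incBeta s s ε - incBeta s (s - 1 + η) ε - incBeta s (s - η) ε := by
  have h (σ : ℝ) (hσ : -1 < σ) := integrableOn_posRpow_one_sub_mul (s := s) hσ hε
  have i1 := h (s - 1) (by linarith)
  have i2 := h s (by linarith)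
  have i3 := h (s - 1 + η) (by linarith)
  have i4 := h (s - η) (by linarith)
  simp only [incBeta, rpowGap, sub_mul, add_mul]
  rw [integral_sub ?_ i4, integral_sub ?_ i3, integral_add i1 i2]
  exacts [i1.add i2, (i1.add i2).sub i3]

end RpowGap

/-- The one-dimensional operator of order `2 s` applied to `t ↦ t_+^σ` at `t = 1`, up to a
normalizing factor. -/
def rpowConst (s σ : ℝ) : ℝ := ∫ r in Ioi (0 : ℝ), secondDiff (posRpow σ) 1 r * r ^ (-1 - 2 * s)

section RpowConst

variable {s σ η ε : ℝ}

lemma integrableOn_Ioi_secondDiff_posRpow_mul (hs : 0 < s) (hσ : -1 < σ) (hσ0 : σ ≤ 0)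
    (hε : 0 < ε) :
    IntegrableOn (fun r => secondDiff (posRpow σ) 1 r * r ^ (-1 - 2 * s)) (Ioi ε) := by
  have h := ((integrableOn_one_add_rpow_mul hs hσ0 hε).add
    (integrableOn_posRpow_one_sub_mul (s := s) hσ hε)).sub
    ((integrableOn_Ioi_rpow_neg_one_sub hs hε).const_mul 2)
  refine h.congr_fun (fun r hr => ?_) measurableSet_Ioi
  simp only [Pi.sub_apply, Pi.add_apply]
  rw [secondDiff_posRpow_one (hε.trans hr).le]
  ring

lemma integrableOn_secondDiff_posRpow_mul (hs : 0 < s) (hs1 : s < 1) (hσ : -1 < σ) (hσ0 : σ ≤ 0) :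
    IntegrableOn (fun r => secondDiff (posRpow σ) 1 r * r ^ (-1 - 2 * s)) (Ioi 0) := by
  obtain ⟨C, -, r₀, hr₀, h⟩ := exists_abs_secondDiff_le (contDiffAt_posRpow σ one_pos)
  set b := r₀ / 2
  have hb : 0 < b := by positivity
  rw [← Ioc_union_Ioi_eq_Ioi hb.le]
  refine IntegrableOn.union ?_ (integrableOn_Ioi_secondDiff_posRpow_mul hs hσ hσ0 hb)
  have hI : IntegrableOn (fun r : ℝ => C * r ^ (1 - 2 * s)) (Ioc 0 b) :=
    (intervalIntegrable_iff_integrableOn_Ioc_of_le hb.le).1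
      ((intervalIntegral.intervalIntegrable_rpow' (by linarith)).const_mul C)
  refine hI.mono' (by fun_prop) ?_
  filter_upwards [ae_restrict_mem measurableSet_Ioc] with r hr
  have hr0 : 0 ≤ r := hr.1.le
  have hr1 : ‖r‖ < r₀ := by
    rw [Real.norm_of_nonneg hr0]; exact hr.2.trans_lt (half_lt_self hr₀)
  calc ‖secondDiff (posRpow σ) 1 r * r ^ (-1 - 2 * s)‖
      = |secondDiff (posRpow σ) 1 r| * r ^ (-1 - 2 * s) := by
        rw [norm_mul, Real.norm_eq_abs, Real.norm_of_nonneg (Real.rpow_nonneg hr0 _)]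
    _ ≤ C * ‖r‖ ^ 2 * r ^ (-1 - 2 * s) := by
        gcongr
        exact h r hr1
    _ = C * r ^ (1 - 2 * s) := by
        rw [Real.norm_of_nonneg hr0, mul_assoc, ← Real.rpow_natCast, ← Real.rpow_add hr.1]
        congr 2; push_cast; ring

lemma integral_Ioi_secondDiff_posRpow_mul (hs : 0 < s) (hσ : -1 < σ) (hσ0 : σ ≤ 0) (hε : 0 < ε) :
    ∫ r in Ioi ε, secondDiff (posRpow σ) 1 r * r ^ (-1 - 2 * s) =
      incBeta s (2 * s - 1 - σ) (ε / (1 + ε)) + incBeta s σ ε - ε ^ (-2 * s) / s := by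
  have hA := integrableOn_one_add_rpow_mul hs hσ0 hε
  have hB := integrableOn_posRpow_one_sub_mul (s := s) hσ hε
  have hC := (integrableOn_Ioi_rpow_neg_one_sub hs hε).const_mul 2
  have hr : ε ^ (-2 * s) / s = ∫ r in Ioi ε, 2 * r ^ (-1 - 2 * s) := by
    rw [integral_const_mul, integral_Ioi_rpow_of_lt (by linarith) hε,
      show -1 - 2 * s + 1 = -2 * s by ring]
    field_simp
  have hAB : IntegrableOn (fun r => (1 + r) ^ σ * r ^ (-1 - 2 * s) +
      posRpow σ (1 - r) * r ^ (-1 - 2 * s)) (Ioi ε) := hA.add hB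
  rw [← integral_one_add_rpow_mul hε, hr, incBeta, ← integral_add hA hB, ← integral_sub hAB hC]
  refine setIntegral_congr_fun measurableSet_Ioi fun r hr => ?_
  simp only [secondDiff_posRpow_one (hε.trans hr).le, sub_mul, add_mul]

lemma one_sub_rpow_add_one_add_rpow_le (hs : 0 ≤ s) (hs1 : s ≤ 1) (hε : 0 ≤ ε) (hε1 : ε ≤ 1) :
    (1 - ε) ^ s + ((1 + ε) ^ (2 * s) - 1) / 2 - 1 ≤ s ^ 2 / 2 * ε ^ 2 := by
  have h1 : (1 - ε) ^ s ≤ 1 - s * ε := by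
    have := rpow_one_add_le_one_add_mul_self (s := -ε) (p := s) (by linarith) hs hs1
    rw [← sub_eq_add_neg] at this
    linarith
  have h2 : (1 + ε) ^ (2 * s) ≤ (1 + s * ε) ^ 2 := by
    have := rpow_one_add_le_one_add_mul_self (s := ε) (p := s) (by linarith) hs hs1
    rw [mul_comm, Real.rpow_mul (by linarith), Real.rpow_two]
    gcongr
  linarith

lemma integral_Ioi_secondDiff_posRpow_mul_le (hs : 0 < s) (hs1 : s < 1) (h0 : 0 ≤ η)
    (h1 : η < s) (h2 : η < 1 - s) (hε : 0 < ε) (hε1 : ε < 1) :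
    ∫ r in Ioi ε, secondDiff (posRpow (s - 1 + η)) 1 r * r ^ (-1 - 2 * s) ≤
      s / 2 * ε ^ (2 - 2 * s) - ∫ r in Ioi ε, rpowGap s η (1 - r) * r ^ (-1 - 2 * s) := by
  have hpow : ε ^ (2 - 2 * s) = ε ^ 2 * ε ^ (-2 * s) := by
    rw [← Real.rpow_natCast, ← Real.rpow_add hε]; congr 1; push_cast; ring
  have hβ := incBeta_div_one_add_le hs (sub_nonneg.2 h1.le) hε hε1
  have hlead : 1 / s * ((1 - ε) ^ s * ε ^ (-2 * s)) +
      ((1 + ε) ^ (2 * s) - 1) * ε ^ (-2 * s) / (2 * s) - ε ^ (-2 * s) / s ≤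
      s / 2 * (ε ^ 2 * ε ^ (-2 * s)) := by
    calc _ = ε ^ (-2 * s) / s * ((1 - ε) ^ s + ((1 + ε) ^ (2 * s) - 1) / 2 - 1) := by field_simp
      _ ≤ ε ^ (-2 * s) / s * (s ^ 2 / 2 * ε ^ 2) := by
          gcongr
          exact one_sub_rpow_add_one_add_rpow_le hs.le hs1.le hε.le hε1.le
      _ = _ := by field_simp
  rw [integral_Ioi_secondDiff_posRpow_mul hs (by linarith) (by linarith) hε,
    integral_rpowGap hs h0 h1 hε, incBeta_sub_one_add_incBeta_self hs hε hε1, hpow,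
    show 2 * s - 1 - (s - 1 + η) = s - η by ring]
  linarith

lemma rpowConst_le_neg_integral_rpowGap (hs : 0 < s) (hs1 : s < 1) (h0 : 0 ≤ η) (h1 : η < s)
    (h2 : η < 1 - s) {δ : ℝ} (hδ : 0 < δ) (hδ1 : δ < 1) :
    rpowConst s (s - 1 + η) ≤ -∫ r in Ioi δ, rpowGap s η (1 - r) * r ^ (-1 - 2 * s) := by
  set G := ∫ r in Ioi δ, rpowGap s η (1 - r) * r ^ (-1 - 2 * s)
  have hid : Tendsto (fun ε : ℝ => ε) (𝓝[>] 0) (𝓝 0) := tendsto_id.mono_left nhdsWithin_le_nhds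
  have hlim := (aecover_Ioi_of_Ioi (μ := volume) hid).integral_tendsto_of_countably_generated
    (integrableOn_secondDiff_posRpow_mul (s := s) (σ := s - 1 + η) hs hs1 (by linarith)
      (by linarith))
  have hbound : Tendsto (fun ε : ℝ => s / 2 * ε ^ (2 - 2 * s) - G) (𝓝[>] 0) (𝓝 (-G)) := by
    have := (((Real.continuousAt_rpow_const 0 (2 - 2 * s) (Or.inr (by linarith))).tendsto.comp
      hid).const_mul (s / 2)).sub_const G
    rwa [Real.zero_rpow (by linarith), mul_zero, zero_sub] at this
  refine le_of_tendsto_of_tendsto hlim hbound ?_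
  filter_upwards [Ioo_mem_nhdsGT hδ] with ε hε
  rw [Measure.restrict_restrict measurableSet_Ioi, Ioi_inter_Ioi, max_eq_left hε.1.le]
  refine (integral_Ioi_secondDiff_posRpow_mul_le hs hs1 h0 h1 h2 hε.1 (hε.2.trans hδ1)).trans ?_
  gcongr 1
  refine setIntegral_mono_set (integrableOn_rpowGap hs h0 h1 hε.1) ?_
    (Ioi_subset_Ioi hε.2.le).eventuallyLE
  filter_upwards [ae_restrict_mem measurableSet_Ioi] with r hr
  have : 0 < r := hε.1.trans hr
  exact mul_nonneg (rpowGap_nonneg h0 (by linarith) (by linarith)) (by positivity)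

lemma rpowConst_sub_one_nonpos (hs : 0 < s) (hs1 : s < 1) : rpowConst s (s - 1) ≤ 0 := by
  simpa [rpowGap] using rpowConst_le_neg_integral_rpowGap hs hs1 le_rfl hs (by linarith)
    (δ := 1 / 2) (by norm_num) (by norm_num)

lemma rpowConst_neg (hs : 0 < s) (hs1 : s < 1) (h0 : 0 < η) (h1 : η < s) (h2 : η < 1 - s) :
    rpowConst s (s - 1 + η) < 0 := by
  refine (rpowConst_le_neg_integral_rpowGap hs hs1 h0.le h1 h2 (δ := 1 / 2) (by norm_num)
    (by norm_num)).trans_lt ?_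
  rw [neg_lt_zero, setIntegral_pos_iff_support_of_nonneg_ae ?_
    (integrableOn_rpowGap hs h0.le h1 (by norm_num))]
  · have hsupp : Ioo (1 / 2 : ℝ) 1 ⊆
        Function.support (fun r => rpowGap s η (1 - r) * r ^ (-1 - 2 * s)) ∩ Ioi (1 / 2) := by
      intro r hr
      have hr0 : 0 < r := lt_trans (by norm_num) hr.1
      exact ⟨(mul_pos (rpowGap_pos h0 (by linarith) (by linarith [hr.2]) (by linarith))
        (by positivity)).ne', hr.1⟩
    refine lt_of_lt_of_le ?_ (measure_mono hsupp)
    rw [Real.volume_Ioo]; norm_num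
  · filter_upwards [ae_restrict_mem measurableSet_Ioi] with r hr
    have : 0 < r := lt_trans (by norm_num) (mem_Ioi.1 hr)
    exact mul_nonneg (rpowGap_nonneg h0.le (by linarith) (by linarith)) (by positivity)

end RpowConst

section Polar

variable {E F : Type*} [NormedAddCommGroup E] [NormedSpace ℝ E] [MeasurableSpace E] [BorelSpace E]
  [FiniteDimensional ℝ E] [Nontrivial E] [NormedAddCommGroup F] {μ : Measure E} [μ.IsAddHaarMeasure]

lemma integrable_iff_integrable_comp_polar {f : E → F} :
    Integrable f μ ↔
      Integrable (fun q : Metric.sphere (0 : E) 1 × Ioi (0 : ℝ) => f (q.2.1 • q.1.1))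
        (μ.toSphere.prod (.volumeIoiPow (Module.finrank ℝ E - 1))) := by
  have hcompl : Integrable f μ ↔ IntegrableOn f {0}ᶜ μ := by
    rw [IntegrableOn, restrict_compl_singleton]
  rw [← μ.measurePreserving_homeomorphUnitSphereProd.integrable_comp_emb
    (Homeomorph.measurableEmbedding _), hcompl,
    integrableOn_iff_comap_subtypeVal (measurableSet_singleton _).compl]
  refine integrable_congr (.of_forall fun x => ?_)
  have hx : ‖(x : E)‖ ≠ 0 := norm_ne_zero_iff.2 x.2
  simp [smul_smul, hx]

variable [NormedSpace ℝ F]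

lemma integral_eq_integral_comp_polar (f : E → F) :
    ∫ x, f x ∂μ = ∫ q : Metric.sphere (0 : E) 1 × Ioi (0 : ℝ), f (q.2.1 • q.1.1)
      ∂(μ.toSphere.prod (.volumeIoiPow (Module.finrank ℝ E - 1))) := by
  rw [← μ.measurePreserving_homeomorphUnitSphereProd.integral_comp
    (Homeomorph.measurableEmbedding _), ← restrict_compl_singleton (μ := μ) 0,
    ← integral_subtype_comap (measurableSet_singleton _).compl, restrict_compl_singleton]
  refine integral_congr_ae (.of_forall fun x => ?_)
  have hx : ‖(x : E)‖ ≠ 0 := norm_ne_zero_iff.2 x.2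
  simp [smul_smul, hx]

lemma integrable_volumeIoiPow_iff (n : ℕ) (h : ℝ → F) :
    Integrable (fun r : Ioi (0 : ℝ) => h r) (.volumeIoiPow n) ↔
      IntegrableOn (fun r => r ^ n • h r) (Ioi 0) := by
  rw [integrableOn_iff_comap_subtypeVal measurableSet_Ioi, Measure.volumeIoiPow,
    integrable_withDensity_iff_integrable_smul' (by fun_prop) (by simp)]
  refine integrable_congr (.of_forall ?_)
  rintro ⟨x, hx : 0 < x⟩
  simp (disch := positivity) [ENNReal.toReal_ofReal]

lemma integral_volumeIoiPow (n : ℕ) (h : ℝ → F) :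
    ∫ r : Ioi (0 : ℝ), h r ∂(.volumeIoiPow n) = ∫ r in Ioi (0 : ℝ), r ^ n • h r := by
  simp only [Measure.volumeIoiPow, ENNReal.ofReal]
  rw [integral_withDensity_eq_integral_smul (measurable_subtype_coe.pow_const _).real_toNNReal,
    integral_subtype_comap measurableSet_Ioi fun a => Real.toNNReal (a ^ n) • h a]
  refine setIntegral_congr_fun measurableSet_Ioi fun x hx => ?_
  simp only [NNReal.smul_def, Real.coe_toNNReal _ (pow_nonneg (le_of_lt hx) _)]

lemma integrable_iff_polar {f : E → F} (hf : StronglyMeasurable f) :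
    Integrable f μ ↔
      (∀ᵐ θ ∂μ.toSphere,
        IntegrableOn (fun r : ℝ => r ^ (Module.finrank ℝ E - 1) • f (r • θ.1)) (Ioi 0)) ∧
      Integrable (fun θ => ∫ r in Ioi (0 : ℝ), r ^ (Module.finrank ℝ E - 1) * ‖f (r • θ.1)‖)
        μ.toSphere := by
  have hm : StronglyMeasurable fun q : Metric.sphere (0 : E) 1 × Ioi (0 : ℝ) =>
      f (q.2.1 • q.1.1) := hf.comp_measurable (by fun_prop)
  rw [integrable_iff_integrable_comp_polar, integrable_prod_iff hm.aestronglyMeasurable]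
  simp only [← smul_eq_mul, ← integral_volumeIoiPow, ← integrable_volumeIoiPow_iff]

lemma integral_eq_polar {f : E → F} (hf : Integrable f μ) :
    ∫ x, f x ∂μ =
      ∫ θ, ∫ r in Ioi (0 : ℝ), r ^ (Module.finrank ℝ E - 1) • f (r • θ.1) ∂volume ∂μ.toSphere := by
  rw [integral_eq_integral_comp_polar,
    integral_prod _ (integrable_iff_integrable_comp_polar.1 hf)]
  simp only [← integral_volumeIoiPow]

end Polar

section RadialScaling

variable {s c : ℝ} {G : ℝ → ℝ}

lemma rpow_neg_one_sub_eq_mul_rpow {r : ℝ} (hc : 0 < c) (hr : 0 ≤ r) :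
    r ^ (-1 - 2 * s) = c ^ (1 + 2 * s) * (c * r) ^ (-1 - 2 * s) := by
  rw [Real.mul_rpow hc.le hr, ← mul_assoc, ← Real.rpow_add hc]
  norm_num

lemma integrableOn_comp_mul_mul_rpow (hG0 : G 0 = 0)
    (hG : IntegrableOn (fun r => G r * r ^ (-1 - 2 * s)) (Ioi 0)) (hc : 0 ≤ c) :
    IntegrableOn (fun r => G (c * r) * r ^ (-1 - 2 * s)) (Ioi 0) := by
  rcases hc.eq_or_lt with rfl | hc
  · simp [hG0]
  have h := (integrableOn_Ioi_comp_mul_left_iff (fun r => G r * r ^ (-1 - 2 * s)) 0 hc).2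
    (by simpa using hG)
  refine IntegrableOn.congr_fun (h.const_mul (c ^ (1 + 2 * s))) (fun r hr => ?_) measurableSet_Ioi
  simp only [rpow_neg_one_sub_eq_mul_rpow (r := r) hc (le_of_lt hr)]
  ring

lemma integral_comp_mul_mul_rpow (hs : 0 < s) (hG0 : G 0 = 0) (hc : 0 ≤ c) :
    ∫ r in Ioi (0 : ℝ), G (c * r) * r ^ (-1 - 2 * s) =
      c ^ (2 * s) * ∫ r in Ioi (0 : ℝ), G r * r ^ (-1 - 2 * s) := by
  rcases hc.eq_or_lt with rfl | hc
  · simp [hG0, Real.zero_rpow (by positivity : 2 * s ≠ 0)]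
  have h := integral_comp_mul_left_Ioi (fun r => G r * r ^ (-1 - 2 * s)) 0 hc
  rw [mul_zero, smul_eq_mul] at h
  calc ∫ r in Ioi (0 : ℝ), G (c * r) * r ^ (-1 - 2 * s)
      = c ^ (1 + 2 * s) * ∫ r in Ioi (0 : ℝ), G (c * r) * (c * r) ^ (-1 - 2 * s) := by
        rw [← integral_const_mul]
        refine setIntegral_congr_fun measurableSet_Ioi fun r hr => ?_
        simp only [rpow_neg_one_sub_eq_mul_rpow (r := r) hc (le_of_lt hr)]
        ring
    _ = _ := by
        rw [h, ← mul_assoc, ← Real.rpow_neg_one, ← Real.rpow_add hc]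
        congr 2; ring

end RadialScaling

section HomogeneousKernel

variable {E : Type*} [NormedAddCommGroup E] [InnerProductSpace ℝ E] {s Γ : ℝ} {K : E → ℝ}
  {G : ℝ → ℝ}

lemma abs_inner_sphere_le (p : E) (θ : Metric.sphere (0 : E) 1) : |inner ℝ p θ.1| ≤ ‖p‖ := by
  simpa using abs_real_inner_le_norm p θ.1

lemma half_norm_le_abs_inner {p θ : E} (hp : p ≠ 0) (hθ : ‖θ‖ = 1)
    (h : ‖θ - ‖p‖⁻¹ • p‖ ≤ 1) : 1 / 2 * ‖p‖ ≤ |inner ℝ p θ| := by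
  have hp0 : 0 < ‖p‖ := norm_pos_iff.2 hp
  have he : ‖‖p‖⁻¹ • p‖ = 1 := by simp [norm_smul, hp0.ne']
  have hexp := norm_sub_sq_real θ (‖p‖⁻¹ • p)
  rw [hθ, he, inner_smul_right, real_inner_comm] at hexp
  have hsq : ‖θ - ‖p‖⁻¹ • p‖ ^ 2 ≤ 1 := (sq_le_one_iff₀ (norm_nonneg _)).2 h
  have hhalf : 1 / 2 ≤ ‖p‖⁻¹ * inner ℝ p θ := by linarith
  rw [inv_mul_eq_div, le_div_iff₀ hp0] at hhalf
  exact hhalf.trans (le_abs_self _)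

lemma pow_mul_comp_inner_smul_mul [FiniteDimensional ℝ E] [Nontrivial E]
    (hK : ∀ z ≠ 0, ∀ r > 0, K (r • z) = r ^ (-((Module.finrank ℝ E : ℝ) + 2 * s)) * K z)
    (p : E) (θ : Metric.sphere (0 : E) 1) {r : ℝ} (hr : 0 < r) :
    r ^ (Module.finrank ℝ E - 1) * (G |inner ℝ p (r • θ.1)| * K (r • θ.1)) =
      K θ * (G (|inner ℝ p θ.1| * r) * r ^ (-1 - 2 * s)) := by
  have hpow : r ^ (-1 - 2 * s) =
      r ^ (Module.finrank ℝ E - 1) * r ^ (-((Module.finrank ℝ E : ℝ) + 2 * s)) := by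
    rw [← Real.rpow_natCast, ← Real.rpow_add hr, Nat.cast_sub Module.finrank_pos]
    congr 1; push_cast; ring
  rw [hK _ (ne_zero_of_mem_unit_sphere θ) r hr, inner_smul_right, abs_mul, abs_of_pos hr, hpow,
    mul_comm r]
  ring

variable [MeasurableSpace E] {μ : Measure E}

/-- The moment `∫ |⟨p, θ⟩|^{2s} dθ` over the unit sphere: the angular factor that appears when the
fractional Laplacian is applied to a function of `⟨p, z⟩`. -/
def sphereMoment (μ : Measure E) (s : ℝ) (p : E) : ℝ := ∫ θ, |inner ℝ p θ.1| ^ (2 * s) ∂μ.toSphere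

lemma sphereMoment_nonneg (μ : Measure E) (s : ℝ) (p : E) : 0 ≤ sphereMoment μ s p :=
  integral_nonneg fun θ => by positivity

lemma sphereMoment_smul {c : ℝ} (hc : 0 ≤ c) (p : E) :
    sphereMoment μ s (c • p) = c ^ (2 * s) * sphereMoment μ s p := by
  rw [sphereMoment, sphereMoment, ← integral_const_mul]
  congr 1 with θ
  rw [real_inner_smul_left, abs_mul, abs_of_nonneg hc, Real.mul_rpow hc (abs_nonneg _)]

variable [BorelSpace E] [FiniteDimensional ℝ E] [μ.IsAddHaarMeasure]

lemma integrable_mul_abs_inner_rpow_toSphere (hs : 0 ≤ s)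
    {a : Metric.sphere (0 : E) 1 → ℝ} (ha : Measurable a) (haΓ : ∀ θ, |a θ| ≤ Γ) (p : E) :
    Integrable (fun θ => a θ * |inner ℝ p θ.1| ^ (2 * s)) μ.toSphere := by
  refine (integrable_const (Γ * ‖p‖ ^ (2 * s))).mono'
    (by fun_prop : Measurable _).aestronglyMeasurable (.of_forall fun θ => ?_)
  have := (abs_nonneg _).trans (haΓ θ)
  rw [norm_mul, Real.norm_of_nonneg (by positivity : 0 ≤ |inner ℝ p θ.1| ^ (2 * s)),
    Real.norm_eq_abs]
  gcongr
  exacts [haΓ θ, abs_inner_sphere_le p θ]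

lemma exists_le_sphereMoment (μ : Measure E) [μ.IsAddHaarMeasure] (hs : 0 < s) :
    ∃ c : ℝ, 0 < c ∧ ∀ p : E, c * ‖p‖ ^ (2 * s) ≤ sphereMoment μ s p := by
  set b : ℝ := Measure.toSphereBallBound (Module.finrank ℝ E) 1 * μ.real (Metric.ball 0 1)
  have hb : 0 < b := mul_pos (NNReal.coe_pos.2 (Measure.toSphereBallBound_pos _ _))
    (ENNReal.toReal_pos (Metric.measure_ball_pos _ _ one_pos).ne' measure_ball_lt_top.ne)
  refine ⟨(1 / 2) ^ (2 * s) * b, by positivity, fun p => ?_⟩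
  rcases eq_or_ne p 0 with rfl | hp
  · rw [norm_zero, Real.zero_rpow (by positivity), mul_zero]
    exact sphereMoment_nonneg μ s 0
  have hp0 : 0 < ‖p‖ := norm_pos_iff.2 hp
  set e : Metric.sphere (0 : E) 1 := ⟨‖p‖⁻¹ • p, by simp [norm_smul, hp0.ne']⟩
  have hint : Integrable (fun θ : Metric.sphere (0 : E) 1 => |inner ℝ p θ.1| ^ (2 * s))
      μ.toSphere := by
    simpa using integrable_mul_abs_inner_rpow_toSphere (μ := μ) hs.le
      (measurable_const (a := (1 : ℝ))) (fun _ => abs_one.le) p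
  calc (1 / 2) ^ (2 * s) * b * ‖p‖ ^ (2 * s) = (1 / 2 * ‖p‖) ^ (2 * s) * b := by
        rw [Real.mul_rpow (by norm_num) hp0.le]; ring
    _ ≤ (1 / 2 * ‖p‖) ^ (2 * s) * μ.toSphere.real (Metric.ball e 1) := by
        gcongr
        exact Measure.toSphereBallBound_mul_measureReal_unitBall_le_toSphere_ball _ one_pos e
    _ = ∫ θ in Metric.ball e 1, (1 / 2 * ‖p‖) ^ (2 * s) ∂μ.toSphere := by
        rw [setIntegral_const, smul_eq_mul, mul_comm]
    _ ≤ ∫ θ in Metric.ball e 1, |inner ℝ p θ.1| ^ (2 * s) ∂μ.toSphere := by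
        refine setIntegral_mono_on (integrable_const _).integrableOn hint.integrableOn
          measurableSet_ball fun θ hθ => ?_
        gcongr
        rw [Metric.mem_ball, Subtype.dist_eq, dist_eq_norm] at hθ
        exact half_norm_le_abs_inner hp (by simp) hθ.le
    _ ≤ sphereMoment μ s p := setIntegral_le_integral hint (.of_forall fun θ => by positivity)

variable [Nontrivial E]

lemma integrable_comp_abs_inner_mul (hs : 0 < s) (hKm : Measurable K)
    (hK : ∀ z ≠ 0, ∀ r > 0, K (r • z) = r ^ (-((Module.finrank ℝ E : ℝ) + 2 * s)) * K z)
    (hKΓ : ∀ θ : Metric.sphere (0 : E) 1, |K θ| ≤ Γ) (hGm : Measurable G) (hG0 : G 0 = 0)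
    (hG : IntegrableOn (fun r => G r * r ^ (-1 - 2 * s)) (Ioi 0)) (p : E) :
    Integrable (fun z => G |inner ℝ p z| * K z) μ := by
  rw [integrable_iff_polar (by fun_prop : Measurable _).stronglyMeasurable]
  constructor
  · refine .of_forall fun θ => ?_
    refine IntegrableOn.congr_fun ((integrableOn_comp_mul_mul_rpow hG0 hG
      (abs_nonneg (inner ℝ p θ.1))).const_mul (K θ)) (fun r hr => ?_) measurableSet_Ioi
    exact (pow_mul_comp_inner_smul_mul hK p θ hr).symm
  · have hrad (θ : Metric.sphere (0 : E) 1) :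
        ∫ r in Ioi (0 : ℝ), r ^ (Module.finrank ℝ E - 1) *
          ‖G |inner ℝ p (r • θ.1)| * K (r • θ.1)‖ =
        |K θ| * |inner ℝ p θ.1| ^ (2 * s) * ∫ r in Ioi (0 : ℝ), |G r| * r ^ (-1 - 2 * s) := by
      rw [mul_assoc, ← integral_comp_mul_mul_rpow (G := fun r => |G r|) hs (by simp [hG0])
        (abs_nonneg _), ← integral_const_mul]
      refine setIntegral_congr_fun measurableSet_Ioi fun r hr => ?_
      have hr : 0 < r := hr
      have h := congrArg abs (pow_mul_comp_inner_smul_mul (G := G) hK p θ hr)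
      rwa [abs_mul, abs_of_pos (by positivity : 0 < r ^ (Module.finrank ℝ E - 1)), abs_mul (K θ),
        abs_mul (G _) (r ^ _), abs_of_pos (by positivity : 0 < r ^ (-1 - 2 * s))] at h
    simp only [hrad]
    exact (integrable_mul_abs_inner_rpow_toSphere hs.le (by fun_prop) (by simpa using hKΓ)
      p).mul_const _

lemma integral_comp_abs_inner_mul (hs : 0 < s) (hKm : Measurable K)
    (hK : ∀ z ≠ 0, ∀ r > 0, K (r • z) = r ^ (-((Module.finrank ℝ E : ℝ) + 2 * s)) * K z)
    (hKΓ : ∀ θ : Metric.sphere (0 : E) 1, |K θ| ≤ Γ) (hGm : Measurable G) (hG0 : G 0 = 0)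
    (hG : IntegrableOn (fun r => G r * r ^ (-1 - 2 * s)) (Ioi 0)) (p : E) :
    ∫ z, G |inner ℝ p z| * K z ∂μ =
      (∫ θ, K θ * |inner ℝ p θ.1| ^ (2 * s) ∂μ.toSphere) *
        ∫ r in Ioi (0 : ℝ), G r * r ^ (-1 - 2 * s) := by
  rw [integral_eq_polar (integrable_comp_abs_inner_mul hs hKm hK hKΓ hGm hG0 hG p),
    ← integral_mul_const]
  congr 1 with θ
  rw [mul_assoc, ← integral_comp_mul_mul_rpow hs hG0 (abs_nonneg _), ← integral_const_mul]
  exact setIntegral_congr_fun measurableSet_Ioi fun r hr => pow_mul_comp_inner_smul_mul hK p θ hr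

end HomogeneousKernel

section NormRpow

variable {E : Type*} [NormedAddCommGroup E] [NormedSpace ℝ E] [FiniteDimensional ℝ E] {q a : ℝ}

lemma pow_finrank_sub_one_smul_rpow [Nontrivial E] {r : ℝ} (hr : 0 < r) :
    r ^ (Module.finrank ℝ E - 1) • r ^ q = r ^ ((Module.finrank ℝ E : ℝ) - 1 + q) := by
  rw [Real.rpow_add hr, smul_eq_mul, ← Real.rpow_natCast, Nat.cast_sub Module.finrank_pos,
    Nat.cast_one]

variable [MeasurableSpace E] [BorelSpace E] (μ : Measure E) [μ.IsAddHaarMeasure]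

lemma setIntegral_ball_norm_rpow (q : ℝ) (ha : 0 < a) :
    ∫ z in Metric.ball (0 : E) a, ‖z‖ ^ q ∂μ =
      (∫ z in Metric.ball (0 : E) 1, ‖z‖ ^ q ∂μ) * a ^ ((Module.finrank ℝ E : ℝ) + q) := by
  have h := Measure.setIntegral_comp_smul_of_pos μ (fun z => ‖z‖ ^ q) (Metric.ball 0 1) ha
  simp only [norm_smul, Real.norm_of_nonneg ha.le, Real.mul_rpow ha.le (norm_nonneg _),
    integral_const_mul, smul_unitBall ha.ne', smul_eq_mul] at h
  rw [inv_mul_eq_div, eq_div_iff (by positivity)] at h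
  rw [← h, Real.rpow_add ha, Real.rpow_natCast]
  ring

variable [Nontrivial E]

lemma integrableOn_ball_norm_rpow (hq : -(Module.finrank ℝ E : ℝ) < q) (a : ℝ) :
    IntegrableOn (fun z : E => ‖z‖ ^ q) (Metric.ball 0 a) μ := by
  rw [integrableOn_fun_norm_addHaar μ (f := fun r => r ^ q)]
  rcases le_or_gt a 0 with ha | ha
  · simp [Ioo_eq_empty (not_lt.2 ha)]
  have h := intervalIntegral.intervalIntegrable_rpow' (a := 0) (b := a)
    (r := (Module.finrank ℝ E : ℝ) - 1 + q) (by linarith)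
  rw [intervalIntegrable_iff_integrableOn_Ioo_of_le ha.le] at h
  exact h.congr_fun (fun r hr => (pow_finrank_sub_one_smul_rpow hr.1).symm) measurableSet_Ioo

end NormRpow

section LayerCake

lemma ofReal_rpow_neg_eq_lintegral_Ioi {q r : ℝ} (hq : 0 < q) (hr : 0 < r) :
    ENNReal.ofReal (r ^ (-q)) = ∫⁻ R in Ioi r, ENNReal.ofReal (q * R ^ (-q - 1)) := by
  have hi := (integrableOn_Ioi_rpow_of_lt (a := -q - 1) (by linarith) hr).const_mul q
  rw [← ofReal_integral_eq_lintegral_ofReal hi, integral_const_mul,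
    integral_Ioi_rpow_of_lt (by linarith) hr, sub_add_cancel]
  · congr 1
    field_simp
  · filter_upwards [ae_restrict_mem measurableSet_Ioi] with R hR
    have : 0 < R := hr.trans hR
    positivity

variable {E : Type*} [NormedAddCommGroup E] [MeasurableSpace E] [BorelSpace E] (μ : Measure E)
  [SFinite μ] {F : E → ℝ≥0∞} {a p q : ℝ}

lemma lintegral_compl_ball_mul_norm_rpow_eq (hF : Measurable F) (ha : 0 < a) (hq : 0 < q) :
    ∫⁻ z in (Metric.ball 0 a)ᶜ, F z * ENNReal.ofReal (‖z‖ ^ (-q)) ∂μ =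
      ∫⁻ R in Ioi a, (∫⁻ z in Metric.ball 0 R ∩ (Metric.ball 0 a)ᶜ, F z ∂μ) *
        ENNReal.ofReal (q * R ^ (-q - 1)) := by
  set g : ℝ → ℝ≥0∞ := fun R => ENNReal.ofReal (q * R ^ (-q - 1))
  have hgm : Measurable g := by fun_prop
  have hswap (z : E) (R : ℝ) :
      (Ioi ‖z‖).indicator g R = (Metric.ball 0 R).indicator (fun _ => g R) z := by
    simp [indicator]
  have hm : Measurable (Function.uncurry fun z R => F z * (Ioi ‖z‖).indicator g R) :=
    (hF.comp measurable_fst).mul <| Measurable.indicator (f := fun x : E × ℝ => g x.2)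
      (by fun_prop) (measurableSet_lt (f := fun x : E × ℝ => ‖x.1‖) (by fun_prop) measurable_snd)
  calc _
    _ = ∫⁻ z in (Metric.ball 0 a)ᶜ, ∫⁻ R in Ioi a, F z * (Ioi ‖z‖).indicator g R ∂volume ∂μ := by
        refine setLIntegral_congr_fun measurableSet_ball.compl fun z hz => ?_
        have haz : a ≤ ‖z‖ := by simpa using hz
        rw [lintegral_const_mul _ (hgm.indicator measurableSet_Ioi),
          lintegral_indicator measurableSet_Ioi, Measure.restrict_restrict measurableSet_Ioi,
          Ioi_inter_Ioi, max_eq_left haz, ofReal_rpow_neg_eq_lintegral_Ioi hq (ha.trans_le haz)]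
    _ = ∫⁻ R in Ioi a, ∫⁻ z in (Metric.ball 0 a)ᶜ, F z * (Ioi ‖z‖).indicator g R ∂μ :=
        lintegral_lintegral_swap hm.aemeasurable
    _ = _ := by
        refine lintegral_congr fun R => ?_
        simp only [hswap, ← indicator_mul_right]
        rw [lintegral_indicator measurableSet_ball, Measure.restrict_restrict measurableSet_ball,
          lintegral_mul_const _ hF]

lemma lintegral_compl_ball_mul_norm_rpow_le (hF : Measurable F) (ha : 0 < a) (hq : 0 < q)
    (hpq : p < q) {C : ℝ≥0∞}
    (h : ∀ R, a < R → ∫⁻ z in Metric.ball 0 R, F z ∂μ ≤ C * ENNReal.ofReal (R ^ p)) :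
    ∫⁻ z in (Metric.ball 0 a)ᶜ, F z * ENNReal.ofReal (‖z‖ ^ (-q)) ∂μ ≤
      C * ENNReal.ofReal (q / (q - p) * a ^ (p - q)) := by
  have hpq' : 0 < q - p := sub_pos.2 hpq
  rw [lintegral_compl_ball_mul_norm_rpow_eq μ hF ha hq]
  calc _ ≤ ∫⁻ R in Ioi a, C * ENNReal.ofReal (q / (q - p)) *
        ENNReal.ofReal ((q - p) * R ^ (-(q - p) - 1)) := by
        refine setLIntegral_mono' measurableSet_Ioi fun R hR => ?_
        have hR0 : 0 < R := ha.trans hR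
        have hpow : R ^ (-(q - p) - 1) = R ^ p * R ^ (-q - 1) := by
          rw [← Real.rpow_add hR0]; congr 1; ring
        calc _ ≤ C * ENNReal.ofReal (R ^ p) * ENNReal.ofReal (q * R ^ (-q - 1)) := by
              gcongr
              exact (lintegral_mono_set inter_subset_left).trans (h R hR)
          _ = _ := by
              rw [mul_assoc, mul_assoc, ← ENNReal.ofReal_mul (by positivity),
                ← ENNReal.ofReal_mul (by positivity), hpow]
              congr 2
              field_simp
    _ = _ := by
        rw [lintegral_const_mul _ (by fun_prop), ← ofReal_rpow_neg_eq_lintegral_Ioi hpq' ha,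
          mul_assoc, ← ENNReal.ofReal_mul (by positivity), neg_sub]

end LayerCake

section DirectionalDerivative

variable {E : Type*} [NormedAddCommGroup E] [NormedSpace ℝ E] {h : E → ℝ} {x e : E}

lemma tendsto_slope_fderiv_apply (hd : DifferentiableAt ℝ h x) (hx : h x = 0) (e : E) :
    Tendsto (fun t : ℝ => t⁻¹ * h (x + t • e)) (𝓝[>] 0) (𝓝 (fderiv ℝ h x e)) := by
  simpa [hx] using (hd.hasFDerivAt.hasLineDerivAt e).tendsto_slope_zero_right

lemma fderiv_apply_nonneg_of_eventually (hd : DifferentiableAt ℝ h x) (hx : h x = 0)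
    (hev : ∀ᶠ t : ℝ in 𝓝[>] 0, 0 ≤ h (x + t • e)) : 0 ≤ fderiv ℝ h x e := by
  refine ge_of_tendsto (tendsto_slope_fderiv_apply hd hx e) ?_
  filter_upwards [hev, self_mem_nhdsWithin] with t ht ht0
  exact mul_nonneg (inv_nonneg.2 (le_of_lt ht0)) ht

lemma eventually_pos_of_fderiv_apply_pos (hd : DifferentiableAt ℝ h x) (hx : h x = 0)
    (he : 0 < fderiv ℝ h x e) : ∀ᶠ t : ℝ in 𝓝[>] 0, 0 < h (x + t • e) := by
  filter_upwards [(tendsto_slope_fderiv_apply hd hx e).eventually (lt_mem_nhds he),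
    self_mem_nhdsWithin] with t ht ht0
  exact (pos_iff_pos_of_mul_pos ht).1 (inv_pos.2 ht0)

lemma exists_apply_pos_of_ne_zero {φ : E →L[ℝ] ℝ} (hφ : φ ≠ 0) : ∃ e, 0 < φ e := by
  obtain ⟨e, he⟩ := DFunLike.ne_iff.1 hφ
  rcases lt_or_gt_of_ne he with h | h
  · exact ⟨-e, by simpa using h⟩
  · exact ⟨e, h⟩

lemma fderiv_ne_zero_of_le {ρ g : E → ℝ} (hρ : DifferentiableAt ℝ ρ x)
    (hg : DifferentiableAt ℝ g x) (hρx : ρ x = 0) (hgx : g x = 0) (hg' : fderiv ℝ g x ≠ 0)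
    (hle : ∀ y, 0 < g y → g y ≤ ρ y) : fderiv ℝ ρ x ≠ 0 := by
  obtain ⟨e, he⟩ := exists_apply_pos_of_ne_zero hg'
  have hnonneg := fderiv_apply_nonneg_of_eventually (h := fun y => ρ y - g y) (e := e)
    (hρ.fun_sub hg) (by simp [hρx, hgx])
    ((eventually_pos_of_fderiv_apply_pos hg hgx he).mono fun t ht => sub_nonneg.2 (hle _ ht))
  rw [fderiv_fun_sub hρ hg, sub_apply, sub_nonneg] at hnonneg
  intro h0
  rw [h0, zero_apply] at hnonneg
  exact he.not_ge hnonneg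

end DirectionalDerivative

section DefiningFunction

lemma eq_zero_of_mem_frontier {X : Type*} [TopologicalSpace X] {Ω : Set X} (hΩ : IsOpen Ω)
    {ψ : X → ℝ} {x : X} (hx : x ∈ frontier Ω) (hc : ContinuousAt ψ x)
    (hmem : ∀ᶠ y in 𝓝 x, y ∈ Ω ↔ 0 < ψ y) : ψ x = 0 := by
  have hxΩ : x ∉ Ω := (hΩ.frontier_eq ▸ hx).2
  have : (𝓝[Ω] x).NeBot := mem_closure_iff_nhdsWithin_neBot.1 (frontier_subset_closure hx)
  refine le_antisymm (not_lt.1 fun h => hxΩ (hmem.self_of_nhds.2 h)) ?_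
  refine ge_of_tendsto (hc.continuousWithinAt (s := Ω)).tendsto ?_
  filter_upwards [self_mem_nhdsWithin, nhdsWithin_le_nhds hmem] with z hz hzmem
  exact (hzmem.1 hz).le

variable {E : Type*} [NormedAddCommGroup E] [NormedSpace ℝ E]

/-- `g` is a `C²` function with compact support which has the sign prescribed by `Ω` (in the weak
sense) everywhere and has nonzero gradient on the part of `∂Ω` in `V`. -/
structure IsLocalDefiningFunction (Ω V : Set E) (g : E → ℝ) : Prop where
  contDiff : ContDiff ℝ 2 g
  hasCompactSupport : HasCompactSupport g
  nonneg : ∀ y ∈ Ω, 0 ≤ g y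
  nonpos : ∀ y ∉ Ω, g y ≤ 0
  fderiv_ne_zero : ∀ y ∈ frontier Ω ∩ V, fderiv ℝ g y ≠ 0

/-- `ρ` is a global `C²` defining function of the open set `Ω`: it is positive exactly in `Ω` and
its gradient does not vanish on `∂Ω`. Compact support is included, so `Ω` is bounded. -/
structure IsDefiningFunction (Ω : Set E) (ρ : E → ℝ) : Prop where
  contDiff : ContDiff ℝ 2 ρ
  hasCompactSupport : HasCompactSupport ρ
  mem_iff : ∀ x, x ∈ Ω ↔ 0 < ρ x
  fderiv_ne_zero : ∀ x ∈ frontier Ω, fderiv ℝ ρ x ≠ 0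

variable {Ω V : Set E}

lemma IsLocalDefiningFunction.eq_zero {g : E → ℝ} (hg : IsLocalDefiningFunction Ω V g)
    (hΩ : IsOpen Ω) {x : E} (hx : x ∈ frontier Ω) : g x = 0 := by
  refine le_antisymm (hg.nonpos x (hΩ.frontier_eq ▸ hx).2) ?_
  exact closure_minimal hg.nonneg (isClosed_le continuous_const hg.contDiff.continuous)
    (frontier_subset_closure hx)

lemma isDefiningFunction_add_sum {ι : Type*} {f : E → ℝ} {g : ι → E → ℝ} {V : ι → Set E}
    {t : Finset ι} (hf : ContDiff ℝ 2 f) (hfc : HasCompactSupport f) (hf0 : ∀ y, 0 ≤ f y)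
    (hfΩ : Function.support f = Ω) (hg : ∀ i ∈ t, IsLocalDefiningFunction Ω (V i) (g i))
    (hV : frontier Ω ⊆ ⋃ i ∈ t, V i) :
    IsDefiningFunction Ω fun y => f y + ∑ i ∈ t, g i y := by
  have hΩ : IsOpen Ω := hfΩ ▸ hf.continuous.isOpen_support
  have hC2 : ContDiff ℝ 2 fun y => f y + ∑ i ∈ t, g i y :=
    hf.add (ContDiff.sum fun i hi => (hg i hi).contDiff)
  have hf_off (y : E) (hy : y ∉ Ω) : f y = 0 := by simpa [← hfΩ] using hy
  refine ⟨hC2, hfc.add ?_, fun y => ⟨fun hy => ?_, fun hy => ?_⟩, fun y hy => ?_⟩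
  · refine HasCompactSupport.of_support_subset_isCompact
      (t.isCompact_biUnion fun i hi => (hg i hi).hasCompactSupport) fun y hy => ?_
    obtain ⟨i, hi, hiy⟩ := Finset.exists_ne_zero_of_sum_ne_zero hy
    exact mem_biUnion hi (subset_tsupport _ hiy)
  · exact add_pos_of_pos_of_nonneg ((hf0 y).lt_of_ne' (by rwa [← hfΩ] at hy))
      (Finset.sum_nonneg fun i hi => (hg i hi).nonneg y hy)
  · by_contra hn
    rw [hf_off y hn, zero_add] at hy
    exact hy.not_ge (Finset.sum_nonpos fun i hi => (hg i hi).nonpos y hn)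
  · obtain ⟨j, hj, hyV⟩ := mem_iUnion₂.1 (hV hy)
    refine fderiv_ne_zero_of_le (hC2.differentiable two_ne_zero y)
      ((hg j hj).contDiff.differentiable two_ne_zero y) ?_ ((hg j hj).eq_zero hΩ hy)
      ((hg j hj).fderiv_ne_zero y ⟨hy, hyV⟩) fun z hz => ?_
    · rw [hf_off y (hΩ.frontier_eq ▸ hy).2, zero_add]
      exact Finset.sum_eq_zero fun i hi => (hg i hi).eq_zero hΩ hy
    · have hzΩ : z ∈ Ω := by_contra fun hn => hz.not_ge ((hg j hj).nonpos z hn)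
      exact le_add_of_nonneg_of_le (hf0 z)
        (Finset.single_le_sum (f := fun i => g i z) (fun i hi => (hg i hi).nonneg z hzΩ) hj)

variable [FiniteDimensional ℝ E]

lemma contDiff_contDiffBump_mul {x : E} (χ : ContDiffBump x) {U : Set E} {ψ : E → ℝ}
    (hU : IsOpen U) (hχU : tsupport χ ⊆ U) (hψ : ContDiffOn ℝ 2 ψ U) :
    ContDiff ℝ 2 fun y => χ y * ψ y := by
  rw [contDiff_iff_contDiffAt]
  intro y
  by_cases hy : y ∈ U
  · exact χ.contDiffAt.mul (hψ.contDiffAt (hU.mem_nhds hy))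
  · refine (contDiffAt_const (c := (0 : ℝ))).congr_of_eventuallyEq ?_
    filter_upwards [(isClosed_tsupport χ).isOpen_compl.mem_nhds fun h => hy (hχU h)] with z hz
    rw [image_eq_zero_of_notMem_tsupport hz, zero_mul]

lemma isLocalDefiningFunction_contDiffBump_mul (hΩ : IsOpen Ω) {x : E} (χ : ContDiffBump x)
    {U : Set E} {ψ : E → ℝ} (hU : IsOpen U) (hχU : tsupport χ ⊆ U) (hψ : ContDiffOn ℝ 2 ψ U)
    (hψ' : ∀ y ∈ U, fderiv ℝ ψ y ≠ 0) (hψΩ : ∀ y ∈ U, (y ∈ Ω ↔ 0 < ψ y)) :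
    IsLocalDefiningFunction Ω (Metric.ball x χ.rOut) fun y => χ y * ψ y where
  contDiff := contDiff_contDiffBump_mul χ hU hχU hψ
  hasCompactSupport := χ.hasCompactSupport.mul_right
  nonneg y hy := by
    by_cases hyU : y ∈ tsupport χ
    · exact mul_nonneg χ.nonneg ((hψΩ y (hχU hyU)).1 hy).le
    · simp [image_eq_zero_of_notMem_tsupport hyU]
  nonpos y hy := by
    by_cases hyU : y ∈ tsupport χ
    · exact mul_nonpos_of_nonneg_of_nonpos χ.nonneg
        (not_lt.1 fun h => hy ((hψΩ y (hχU hyU)).2 h))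
    · simp [image_eq_zero_of_notMem_tsupport hyU]
  fderiv_ne_zero y hy := by
    have hyU : y ∈ U := hχU (χ.tsupport_eq ▸ Metric.ball_subset_closedBall hy.2)
    have hdψ := (hψ.contDiffAt (hU.mem_nhds hyU)).differentiableAt two_ne_zero
    have hψy : ψ y = 0 := eq_zero_of_mem_frontier hΩ hy.1 hdψ.continuousAt
      (mem_of_superset (hU.mem_nhds hyU) hψΩ)
    rw [fderiv_fun_mul ((χ.contDiffAt (n := 1)).differentiableAt one_ne_zero) hdψ, hψy, zero_smul,
      add_zero]
    exact smul_ne_zero (χ.pos_of_mem_ball hy.2).ne' (hψ' y hyU)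

lemma HasC2Boundary.exists_isLocalDefiningFunction {N : ℕ} {Ω : Set (𝔼 N)}
    (hb : HasC2Boundary Ω) (hΩ : IsOpen Ω) {x : 𝔼 N} (hx : x ∈ frontier Ω) :
    ∃ V ∈ 𝓝 x, ∃ g, IsLocalDefiningFunction Ω V g := by
  obtain ⟨U, ψ, hU, hxU, hψ, hψ', hψΩ⟩ := hb x hx
  obtain ⟨r, hr, hrU⟩ := Metric.nhds_basis_closedBall.mem_iff.1 (hU.mem_nhds hxU)
  let χ : ContDiffBump x := ⟨r / 2, r, by positivity, by linarith⟩
  exact ⟨Metric.ball x r, Metric.ball_mem_nhds x hr, _,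
    isLocalDefiningFunction_contDiffBump_mul hΩ χ hU (χ.tsupport_eq ▸ hrU) hψ hψ' hψΩ⟩

lemma HasC2Boundary.exists_isDefiningFunction {N : ℕ} {Ω : Set (𝔼 N)} (hb : HasC2Boundary Ω)
    (hΩ : IsOpen Ω) (hbd : Bornology.IsBounded Ω) : ∃ ρ, IsDefiningFunction Ω ρ := by
  have hcl : IsCompact (closure Ω) := hbd.isCompact_closure
  obtain ⟨f, hfs, hf, hf0⟩ := hΩ.exists_contDiff_support_eq (n := 2)
  choose! V hV g hg using fun x hx => hb.exists_isLocalDefiningFunction hΩ (x := x) hx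
  obtain ⟨t, htf, ht⟩ :=
    (hcl.of_isClosed_subset isClosed_frontier frontier_subset_closure).elim_nhds_subcover V hV
  exact ⟨_, isDefiningFunction_add_sum (mod_cast hf)
    (.of_support_subset_isCompact hcl (hfs ▸ subset_closure)) (fun y => (hf0 (mem_range_self y)).1)
    hfs (fun x hx => hg x (htf x hx)) ht⟩

end DefiningFunction

section QuantitativeBounds

/-- On `B`, the function `ρ` increases at rate at least `c` in the direction `e`. -/
def IncreasesAlong {E : Type*} [AddCommGroup E] [Module ℝ E] (ρ : E → ℝ) (e : E) (c : ℝ)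
    (B : Set E) : Prop :=
  ∀ y ∈ B, ∀ t : ℝ, 0 ≤ t → y + t • e ∈ B → ρ y + c * t ≤ ρ (y + t • e)

variable {E : Type*} [NormedAddCommGroup E]

lemma increasesAlong_of_norm_fderiv_sub_le [NormedSpace ℝ E] {ρ : E → ℝ} {e : E} {c : ℝ}
    {B : Set E} {φ : E →L[ℝ] ℝ} (hB : Convex ℝ B) (hd : ∀ z ∈ B, DifferentiableAt ℝ ρ z)
    (hφ : ∀ z ∈ B, ‖fderiv ℝ ρ z - φ‖ ≤ c) (he : ‖e‖ = 1) (hc : 2 * c ≤ φ e) :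
    IncreasesAlong ρ e c B := by
  intro y hy t ht hyt
  have h := hB.norm_image_sub_le_of_norm_fderiv_le' hd hφ hy hyt
  rw [add_sub_cancel_left, norm_smul, he, mul_one, Real.norm_of_nonneg ht, map_smul, smul_eq_mul,
    Real.norm_eq_abs] at h
  nlinarith [(abs_le.1 h).1]

variable {Ω : Set E} {ρ : E → ℝ}

namespace IsDefiningFunction

section NormedSpace

variable [NormedSpace ℝ E] (h : IsDefiningFunction Ω ρ)
include h

lemma continuous : Continuous ρ := h.contDiff.continuous

lemma differentiable : Differentiable ℝ ρ := h.contDiff.differentiable two_ne_zero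

lemma eq_setOf_pos : Ω = {x | 0 < ρ x} := Set.ext h.mem_iff

lemma isOpen : IsOpen Ω := h.eq_setOf_pos ▸ isOpen_lt continuous_const h.continuous

lemma isCompact_closure : IsCompact (closure Ω) :=
  h.hasCompactSupport.of_isClosed_subset isClosed_closure
    (closure_mono fun x hx => ((h.mem_iff x).1 hx).ne')

lemma isBounded : Bornology.IsBounded Ω := h.isCompact_closure.isBounded.subset subset_closure

lemma eq_zero {x : E} (hx : x ∈ frontier Ω) : ρ x = 0 :=
  eq_zero_of_mem_frontier h.isOpen hx h.continuous.continuousAt (.of_forall h.mem_iff)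

lemma exists_forall_le : ∃ H : ℝ, 0 < H ∧ ∀ x, ρ x ≤ H := by
  obtain ⟨H, hH⟩ := h.hasCompactSupport.exists_bound_of_continuous h.continuous
  exact ⟨max H 1, by positivity, fun x =>
    (le_abs_self _).trans ((hH x).trans (le_max_left _ _))⟩

lemma exists_abs_sub_le : ∃ L : ℝ, 0 < L ∧ ∀ x y, |ρ x - ρ y| ≤ L * ‖x - y‖ := by
  obtain ⟨L, hL⟩ := h.contDiff.lipschitzWith_of_hasCompactSupport h.hasCompactSupport two_ne_zero
  refine ⟨max L 1, by positivity, fun x y => ?_⟩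
  rw [← Real.norm_eq_abs]
  exact (hL.norm_sub_le x y).trans (by gcongr; exact le_max_left _ _)

lemma exists_norm_fderiv_sub_le :
    ∃ C : ℝ, 0 < C ∧ ∀ x y, ‖fderiv ℝ ρ x - fderiv ℝ ρ y‖ ≤ C * ‖x - y‖ := by
  have hC1 : ContDiff ℝ 1 (fderiv ℝ ρ) := h.contDiff.fderiv_right (by norm_num)
  obtain ⟨C, hC⟩ :=
    hC1.lipschitzWith_of_hasCompactSupport (h.hasCompactSupport.fderiv ℝ) one_ne_zero
  exact ⟨max C 1, by positivity, fun x y =>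
    (hC.norm_sub_le x y).trans (by gcongr; exact le_max_left _ _)⟩

lemma exists_le_norm_fderiv :
    ∃ c : ℝ, 0 < c ∧ ∃ d : ℝ, 0 < d ∧ ∀ x ∈ closure Ω, ρ x < d → c ≤ ‖fderiv ℝ ρ x‖ := by
  have hcont : Continuous fun x => ‖fderiv ℝ ρ x‖ :=
    (h.contDiff.continuous_fderiv two_ne_zero).norm
  obtain ⟨m, hm, hmf⟩ : ∃ m : ℝ, 0 < m ∧ ∀ x ∈ frontier Ω, m ≤ ‖fderiv ℝ ρ x‖ :=
    (h.isCompact_closure.of_isClosed_subset isClosed_frontier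
      frontier_subset_closure).exists_forall_le' hcont.continuousOn
      fun x hx => norm_pos_iff.2 (h.fderiv_ne_zero x hx)
  obtain ⟨d, hd, hdρ⟩ : ∃ d : ℝ, 0 < d ∧
      ∀ x ∈ closure Ω \ {x | m / 2 < ‖fderiv ℝ ρ x‖}, d ≤ ρ x := by
    refine (h.isCompact_closure.diff (isOpen_lt continuous_const hcont)).exists_forall_le'
      h.continuous.continuousOn fun x hx => (h.mem_iff x).1 ?_
    by_contra hn
    exact hx.2 ((half_lt_self hm).trans_le (hmf x (h.isOpen.frontier_eq ▸ ⟨hx.1, hn⟩)))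
  exact ⟨m / 2, half_pos hm, d, hd, fun x hx hxd =>
    le_of_lt (by_contra fun hn => hxd.not_ge (hdρ x ⟨hx, hn⟩))⟩

end NormedSpace

end IsDefiningFunction

variable [InnerProductSpace ℝ E] [CompleteSpace E]

lemma inner_gradient_eq_fderiv (ρ : E → ℝ) (x v : E) :
    inner ℝ (gradient ρ x) v = fderiv ℝ ρ x v := by
  rw [gradient, InnerProductSpace.toDual_symm_apply]

lemma norm_gradient_eq_norm_fderiv (ρ : E → ℝ) (x : E) : ‖gradient ρ x‖ = ‖fderiv ℝ ρ x‖ := by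
  rw [gradient, LinearIsometryEquiv.norm_map]

lemma exists_fderiv_apply_eq_norm (ρ : E → ℝ) {x : E} (hx : fderiv ℝ ρ x ≠ 0) :
    ∃ e : E, ‖e‖ = 1 ∧ fderiv ℝ ρ x e = ‖fderiv ℝ ρ x‖ := by
  have hp : ‖gradient ρ x‖ ≠ 0 := by simpa [norm_gradient_eq_norm_fderiv] using hx
  refine ⟨‖gradient ρ x‖⁻¹ • gradient ρ x, by simp [norm_smul, hp], ?_⟩
  rw [← inner_gradient_eq_fderiv, inner_smul_right, real_inner_self_eq_norm_mul_norm,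
    inv_mul_cancel_left₀ hp, norm_gradient_eq_norm_fderiv]

namespace IsDefiningFunction

lemma exists_abs_sub_inner_gradient_le (h : IsDefiningFunction Ω ρ) :
    ∃ C : ℝ, 0 < C ∧ ∀ x z, |ρ (x + z) - (ρ x + inner ℝ (gradient ρ x) z)| ≤ C * ‖z‖ ^ 2 := by
  obtain ⟨C, hC0, hC⟩ := h.exists_norm_fderiv_sub_le
  refine ⟨C, hC0, fun x z => ?_⟩
  have hT := norm_sub_sub_fderiv_le convex_univ hC0.le (fun y _ => h.differentiable y)
    (mem_univ x) (mem_univ (x + z)) fun y _ => hC y x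
  rwa [add_sub_cancel_left, sub_sub, ← inner_gradient_eq_fderiv, Real.norm_eq_abs] at hT

lemma exists_increasesAlong (h : IsDefiningFunction Ω ρ) :
    ∃ c : ℝ, 0 < c ∧ ∃ d : ℝ, 0 < d ∧ ∃ r : ℝ, 0 < r ∧ ∀ x ∈ closure Ω, ρ x < d →
      ∃ e : E, ‖e‖ = 1 ∧ IncreasesAlong ρ e c (Metric.ball x r) := by
  obtain ⟨C, hC0, hC⟩ := h.exists_norm_fderiv_sub_le
  obtain ⟨m, hm, d, hd, hmd⟩ := h.exists_le_norm_fderiv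
  refine ⟨m / 2, half_pos hm, d, hd, m / 2 / C, by positivity, fun x hx hxd => ?_⟩
  have hmx := hmd x hx hxd
  obtain ⟨e, he, hφe⟩ := exists_fderiv_apply_eq_norm ρ (norm_pos_iff.1 (hm.trans_le hmx))
  refine ⟨e, he, increasesAlong_of_norm_fderiv_sub_le (convex_ball x _)
    (fun z _ => h.differentiable z) (fun z hz => (hC z x).trans ?_) he (by linarith)⟩
  have hzx : ‖z - x‖ < m / 2 / C := mem_ball_iff_norm.1 hz
  rw [lt_div_iff₀ hC0] at hzx
  linarith

end IsDefiningFunction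

end QuantitativeBounds

section ExtendedPower

/-- The power `t ↦ t ^ σ` on `[0, ∞)` extended by zero to negative reals. In contrast with
`posRpow σ`, for `σ < 0` it takes the value `∞` at `t = 0`, so that its integrability along a
function shows that the zero set of the function is null. -/
def extPosRpow (σ t : ℝ) : ℝ≥0∞ := if 0 ≤ t then ENNReal.ofReal t ^ σ else 0

variable {σ c R : ℝ}

@[fun_prop]
lemma measurable_extPosRpow (σ : ℝ) : Measurable (extPosRpow σ) :=
  Measurable.ite measurableSet_Ici (by fun_prop) measurable_const

lemma extPosRpow_of_nonneg {t : ℝ} (ht : 0 ≤ t) : extPosRpow σ t = ENNReal.ofReal t ^ σ :=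
  if_pos ht

lemma ofReal_posRpow_le_extPosRpow (σ t : ℝ) :
    ENNReal.ofReal (posRpow σ t) ≤ extPosRpow σ t := by
  rcases le_or_gt t 0 with h | h
  · simp [posRpow_of_nonpos h]
  · rw [posRpow_of_pos h, extPosRpow_of_nonneg h.le, ENNReal.ofReal_rpow_of_pos h]

lemma rpow_le_rpow_of_nonpos {x y : ℝ≥0∞} (h : x ≤ y) (hσ : σ ≤ 0) : y ^ σ ≤ x ^ σ := by
  obtain ⟨β, rfl⟩ : ∃ β, σ = -β := ⟨-σ, (neg_neg σ).symm⟩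
  rw [ENNReal.rpow_neg, ENNReal.rpow_neg]
  exact ENNReal.inv_le_inv.2 (ENNReal.rpow_le_rpow h (neg_nonpos.1 hσ))

lemma lintegral_Icc_ofReal_mul_sub_rpow {a b : ℝ} (hσ : -1 < σ) (hc : 0 < c) (hab : a ≤ b) :
    ∫⁻ t in Icc a b, ENNReal.ofReal (c * (t - a)) ^ σ =
      ENNReal.ofReal (c ^ σ / (1 + σ) * (b - a) ^ (1 + σ)) := by
  rw [← Measure.restrict_congr_set Ioc_ae_eq_Icc]
  have hi : IntegrableOn (fun t : ℝ => c ^ σ * (t - a) ^ σ) (Ioc a b) := by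
    have := (intervalIntegral.intervalIntegrable_rpow' (a := 0) (b := b - a) hσ).comp_sub_right a
    rw [zero_add, sub_add_cancel, intervalIntegrable_iff_integrableOn_Ioc_of_le hab] at this
    exact this.const_mul _
  calc _ = ∫⁻ t in Ioc a b, ENNReal.ofReal (c ^ σ * (t - a) ^ σ) := by
        refine setLIntegral_congr_fun measurableSet_Ioc fun t ht => ?_
        have : 0 < t - a := sub_pos.2 ht.1
        rw [ENNReal.ofReal_rpow_of_pos (by positivity), Real.mul_rpow hc.le this.le]
    _ = ENNReal.ofReal (∫ t in Ioc a b, c ^ σ * (t - a) ^ σ) := by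
        rw [ofReal_integral_eq_lintegral_ofReal hi]
        filter_upwards [ae_restrict_mem measurableSet_Ioc] with t ht
        have : 0 < t - a := sub_pos.2 ht.1
        positivity
    _ = _ := by
        rw [integral_const_mul, ← intervalIntegral.integral_of_le hab,
          intervalIntegral.integral_comp_sub_right (fun t => t ^ σ) a, sub_self,
          integral_rpow (Or.inl hσ), Real.zero_rpow (by linarith), sub_zero, add_comm σ,
          div_mul_eq_mul_div, mul_div_assoc]

/-- If `f ≥ 0` increases at rate at least `c` on `S`, then `f t ≥ c (t - inf S)` there. -/
lemma lintegral_indicator_ofReal_rpow_le {f : ℝ → ℝ} {S : Set ℝ} (hσ : -1 < σ) (hσ0 : σ ≤ 0)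
    (hc : 0 < c) (hS : S ⊆ Icc 0 R) (hf : ∀ t ∈ S, 0 ≤ f t)
    (hinc : ∀ t' ∈ S, ∀ t ∈ S, t' ≤ t → f t' + c * (t - t') ≤ f t) :
    ∫⁻ t, S.indicator (fun t => ENNReal.ofReal (f t) ^ σ) t ≤
      ENNReal.ofReal (c ^ σ / (1 + σ) * R ^ (1 + σ)) := by
  rcases S.eq_empty_or_nonempty with rfl | hne
  · simp
  have hbdd : BddBelow S := ⟨0, fun t ht => (hS ht).1⟩
  have h0 : 0 ≤ sInf S := le_csInf hne fun t ht => (hS ht).1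
  have hR : sInf S ≤ R := hne.elim fun t ht => (csInf_le hbdd ht).trans (hS ht).2
  have hle (t : ℝ) (ht : t ∈ S) : c * (t - sInf S) ≤ f t := by
    rw [← le_div_iff₀' hc, sub_le_comm]
    refine le_csInf hne fun t' ht' => ?_
    rw [sub_le_comm, le_div_iff₀' hc]
    rcases le_total t' t with htt | htt
    · linarith [hinc t' ht' t ht htt, hf t' ht']
    · exact (mul_nonpos_of_nonneg_of_nonpos hc.le (sub_nonpos.2 htt)).trans (hf t ht)
  calc _ ≤ ∫⁻ t, (Icc (sInf S) R).indicator
        (fun t => ENNReal.ofReal (c * (t - sInf S)) ^ σ) t := by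
        refine lintegral_mono fun t => indicator_le (fun t ht => ?_) t
        rw [indicator_of_mem (show t ∈ Icc (sInf S) R from ⟨csInf_le hbdd ht, (hS ht).2⟩)]
        exact rpow_le_rpow_of_nonpos (ENNReal.ofReal_le_ofReal (hle t ht)) hσ0
    _ = ENNReal.ofReal (c ^ σ / (1 + σ) * (R - sInf S) ^ (1 + σ)) := by
        rw [lintegral_indicator measurableSet_Icc, lintegral_Icc_ofReal_mul_sub_rpow hσ hc hR]
    _ ≤ _ := by
        have : 0 < 1 + σ := by linarith
        gcongr
        exact sub_le_self R h0

variable {E : Type*} [NormedAddCommGroup E] [NormedSpace ℝ E] {ρ : E → ℝ} {x e : E}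

lemma lintegral_line_extPosRpow_le (hσ : -1 < σ) (hσ0 : σ ≤ 0) (hc : 0 < c)
    (hinc : IncreasesAlong ρ e c (Metric.ball x R)) (y : E) :
    ∫⁻ t in Icc 0 R, (Metric.ball x R).indicator (fun z => extPosRpow σ (ρ z)) (y + t • e) ≤
      ENNReal.ofReal (c ^ σ / (1 + σ) * R ^ (1 + σ)) := by
  set S := {t : ℝ | t ∈ Icc 0 R ∧ y + t • e ∈ Metric.ball x R ∧ 0 ≤ ρ (y + t • e)}
  rw [← lintegral_indicator measurableSet_Icc]
  refine le_of_eq_of_le (lintegral_congr fun t => ?_) (lintegral_indicator_ofReal_rpow_le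
    (S := S) (f := fun t => ρ (y + t • e)) hσ hσ0 hc (fun t ht => ht.1) (fun t ht => ht.2.2)
    fun t' ht' t ht htt => ?_)
  · simp only [indicator, extPosRpow, S, mem_ofPred_eq]
    split_ifs <;> tauto
  · have hadd : y + t' • e + (t - t') • e = y + t • e := by
      rw [add_assoc, ← add_smul, add_sub_cancel]
    have h := hinc _ ht'.2.1 (t - t') (sub_nonneg.2 htt) (hadd ▸ ht.2.1)
    rwa [hadd] at h

lemma add_smul_notMem_ball (he : ‖e‖ = 1) {y : E} (hy : y ∉ Metric.ball x (2 * R)) {t : ℝ}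
    (ht : t ∈ Icc 0 R) : y + t • e ∉ Metric.ball x R := by
  rw [Metric.mem_ball, not_lt] at hy ⊢
  have htri := dist_triangle y (y + t • e) x
  rw [dist_self_add_right, norm_smul, he, mul_one, Real.norm_of_nonneg ht.1] at htri
  linarith [ht.2]

variable [FiniteDimensional ℝ E] [MeasurableSpace E] [BorelSpace E] (μ : Measure E)
  [μ.IsAddHaarMeasure]

/-- Averaging over the translates of the ball along `e` reduces the bound to lines. -/
lemma ofReal_mul_lintegral_ball_extPosRpow_le (hρ : Measurable ρ) (he : ‖e‖ = 1) (hσ : -1 < σ)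
    (hσ0 : σ ≤ 0) (hc : 0 < c) (hinc : IncreasesAlong ρ e c (Metric.ball x R)) :
    ENNReal.ofReal R * ∫⁻ y in Metric.ball x R, extPosRpow σ (ρ y) ∂μ ≤
      ENNReal.ofReal (c ^ σ / (1 + σ) * R ^ (1 + σ)) * μ (Metric.ball x (2 * R)) := by
  set h : E → ℝ≥0∞ := (Metric.ball x R).indicator fun z => extPosRpow σ (ρ z)
  have hm : Measurable h :=
    (by fun_prop : Measurable fun z => extPosRpow σ (ρ z)).indicator measurableSet_ball
  calc _ = ∫⁻ t in Icc (0 : ℝ) R, ∫⁻ y, h (y + t • e) ∂μ := by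
        simp only [lintegral_add_right_eq_self h]
        rw [setLIntegral_const, Real.volume_Icc, sub_zero, mul_comm,
          lintegral_indicator measurableSet_ball]
    _ = ∫⁻ y, (∫⁻ t in Icc (0 : ℝ) R, h (y + t • e)) ∂μ :=
        lintegral_lintegral_swap (by fun_prop)
    _ ≤ ∫⁻ y, (Metric.ball x (2 * R)).indicator
          (fun _ => ENNReal.ofReal (c ^ σ / (1 + σ) * R ^ (1 + σ))) y ∂μ := by
        refine lintegral_mono fun y => ?_
        by_cases hy : y ∈ Metric.ball x (2 * R)
        · rw [indicator_of_mem hy]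
          exact lintegral_line_extPosRpow_le hσ hσ0 hc hinc y
        · refine ((setLIntegral_congr_fun measurableSet_Icc fun t ht => ?_).trans
            lintegral_zero).trans_le zero_le
          exact indicator_of_notMem (add_smul_notMem_ball he hy ht) _
    _ = _ := by rw [lintegral_indicator measurableSet_ball, setLIntegral_const]

lemma lintegral_ball_extPosRpow_le (hρ : Measurable ρ) (he : ‖e‖ = 1) (hσ : -1 < σ) (hσ0 : σ ≤ 0)
    (hc : 0 < c) (hR : 0 < R) (hinc : IncreasesAlong ρ e c (Metric.ball x R)) :
    ∫⁻ y in Metric.ball x R, extPosRpow σ (ρ y) ∂μ ≤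
      μ (Metric.ball 0 1) * ENNReal.ofReal (c ^ σ / (1 + σ) * 2 ^ Module.finrank ℝ E) *
        ENNReal.ofReal (R ^ ((Module.finrank ℝ E : ℝ) + σ)) := by
  have hσ1 : 0 < 1 + σ := by linarith
  have hpow : R ^ (1 + σ) * R ^ Module.finrank ℝ E =
      R * R ^ ((Module.finrank ℝ E : ℝ) + σ) := by
    nth_rw 3 [← Real.rpow_one R]
    rw [← Real.rpow_natCast, ← Real.rpow_add hR, ← Real.rpow_add hR]
    congr 1; ring
  rw [← ENNReal.mul_le_mul_iff_right (ENNReal.ofReal_pos.2 hR).ne' ENNReal.ofReal_ne_top]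
  refine (ofReal_mul_lintegral_ball_extPosRpow_le μ hρ he hσ hσ0 hc hinc).trans (le_of_eq ?_)
  rw [Measure.addHaar_ball_of_pos μ x (by positivity : 0 < 2 * R), ← mul_assoc,
    ← ENNReal.ofReal_mul (by positivity), mul_assoc (μ _), ← ENNReal.ofReal_mul (by positivity),
    mul_left_comm, ← ENNReal.ofReal_mul hR.le, mul_comm (ENNReal.ofReal _), mul_pow]
  congr 2
  linear_combination c ^ σ / (1 + σ) * 2 ^ Module.finrank ℝ E * hpow

end ExtendedPower

namespace IsDefiningFunction

variable {E : Type*} [NormedAddCommGroup E] [InnerProductSpace ℝ E] [FiniteDimensional ℝ E]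
  [MeasurableSpace E] [BorelSpace E] {Ω : Set E} {ρ : E → ℝ} {σ : ℝ}

lemma exists_lintegral_ball_lt_top (h : IsDefiningFunction Ω ρ) (μ : Measure E)
    [μ.IsAddHaarMeasure] (hσ : -1 < σ) (hσ0 : σ ≤ 0) :
    ∃ r : ℝ, 0 < r ∧ ∀ x ∈ frontier Ω, ∫⁻ y in Metric.ball x r, extPosRpow σ (ρ y) ∂μ < ⊤ := by
  obtain ⟨c, hc, d, hd, r, hr, hinc⟩ := h.exists_increasesAlong
  refine ⟨r, hr, fun x hx => ?_⟩
  obtain ⟨e, he, hxe⟩ := hinc x (frontier_subset_closure hx) ((h.eq_zero hx).trans_lt hd)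
  exact (lintegral_ball_extPosRpow_le μ h.continuous.measurable he hσ hσ0 hc hr hxe).trans_lt
    (ENNReal.mul_lt_top (ENNReal.mul_lt_top measure_ball_lt_top ENNReal.ofReal_lt_top)
      ENNReal.ofReal_lt_top)

lemma measure_frontier (h : IsDefiningFunction Ω ρ) (μ : Measure E) [μ.IsAddHaarMeasure] :
    μ (frontier Ω) = 0 := by
  obtain ⟨r, hr, hlt⟩ :=
    h.exists_lintegral_ball_lt_top μ (σ := -1 / 2) (by norm_num) (by norm_num)
  refine measure_null_of_locally_null _ fun x hx => ⟨Metric.ball x r ∩ frontier Ω,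
    inter_mem (mem_nhdsWithin_of_mem_nhds (Metric.ball_mem_nhds _ hr)) self_mem_nhdsWithin, ?_⟩
  have hfin := ae_lt_top
    ((measurable_extPosRpow _).comp h.continuous.measurable) (hlt x hx).ne
  rw [ae_restrict_iff' measurableSet_ball, ae_iff] at hfin
  refine measure_mono_null (fun y hy => ?_) hfin
  have htop : extPosRpow (-1 / 2) (ρ y) = ⊤ := by
    norm_num [extPosRpow, h.eq_zero hy.2]
  exact fun hlt => (hlt hy.1).ne htop

lemma exists_mem_nhds_lintegral_posRpow_lt_top (h : IsDefiningFunction Ω ρ) (μ : Measure E)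
    [μ.IsAddHaarMeasure] (hσ : -1 < σ) (hσ0 : σ ≤ 0) {x : E} (hx : x ∈ closure Ω) :
    ∃ s ∈ 𝓝 x, ∫⁻ y in s, ENNReal.ofReal (posRpow σ (ρ y)) ∂μ < ⊤ := by
  by_cases hxΩ : x ∈ Ω
  · have hx0 := (h.mem_iff x).1 hxΩ
    obtain ⟨r, hr, hrs⟩ := Metric.mem_nhds_iff.1
      (h.continuous.continuousAt.eventually (lt_mem_nhds (half_lt_self hx0)))
    refine ⟨Metric.ball x r, Metric.ball_mem_nhds _ hr, ?_⟩
    calc _ ≤ ∫⁻ y in Metric.ball x r, ENNReal.ofReal ((ρ x / 2) ^ σ) ∂μ := by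
          refine setLIntegral_mono' measurableSet_ball fun y hy => ENNReal.ofReal_le_ofReal ?_
          have hy : ρ x / 2 < ρ y := hrs hy
          rw [posRpow_of_pos ((half_pos hx0).trans hy)]
          exact Real.rpow_le_rpow_of_nonpos (half_pos hx0) hy.le hσ0
      _ < ⊤ := by
          rw [setLIntegral_const]
          exact ENNReal.mul_lt_top ENNReal.ofReal_lt_top measure_ball_lt_top
  · obtain ⟨r, hr, hlt⟩ := h.exists_lintegral_ball_lt_top μ hσ hσ0
    exact ⟨Metric.ball x r, Metric.ball_mem_nhds _ hr,
      (lintegral_mono fun y => ofReal_posRpow_le_extPosRpow σ (ρ y)).trans_lt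
        (hlt x (h.isOpen.frontier_eq ▸ ⟨hx, hxΩ⟩))⟩

lemma lintegral_posRpow_lt_top (h : IsDefiningFunction Ω ρ) (μ : Measure E) [μ.IsAddHaarMeasure]
    (hσ : -1 < σ) (hσ0 : σ ≤ 0) : ∫⁻ y, ENNReal.ofReal (posRpow σ (ρ y)) ∂μ < ⊤ := by
  have hsupp : ∫⁻ y in closure Ω, ENNReal.ofReal (posRpow σ (ρ y)) ∂μ =
      ∫⁻ y, ENNReal.ofReal (posRpow σ (ρ y)) ∂μ := by
    refine setLIntegral_eq_of_support_subset fun y hy => subset_closure ((h.mem_iff y).2 ?_)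
    exact not_le.1 fun hle => hy (by simp [posRpow_of_nonpos hle])
  rw [← hsupp]
  refine h.isCompact_closure.induction_on
    (p := fun s => ∫⁻ y in s, ENNReal.ofReal (posRpow σ (ρ y)) ∂μ < ⊤) (by simp)
    (fun s t hst ht => (lintegral_mono_set hst).trans_lt ht)
    (fun s t hs ht => (lintegral_union_le _ _ _).trans_lt (ENNReal.add_lt_top.2 ⟨hs, ht⟩))
    fun x hx => ?_
  obtain ⟨s, hs, hlt⟩ := h.exists_mem_nhds_lintegral_posRpow_lt_top μ hσ hσ0 hx
  exact ⟨s, mem_nhdsWithin_of_mem_nhds hs, hlt⟩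

lemma integrable_posRpow (h : IsDefiningFunction Ω ρ) (μ : Measure E) [μ.IsAddHaarMeasure]
    (hσ : -1 < σ) (hσ0 : σ ≤ 0) : Integrable (fun y => posRpow σ (ρ y)) μ := by
  refine ⟨((measurable_posRpow σ).comp h.continuous.measurable).aestronglyMeasurable, ?_⟩
  rw [hasFiniteIntegral_iff_ofReal (.of_forall fun y => posRpow_nonneg _ _)]
  exact h.lintegral_posRpow_lt_top μ hσ hσ0

end IsDefiningFunction

section Growth

lemma setLIntegral_ball_comp_add_left {E : Type*} [NormedAddCommGroup E] [MeasurableSpace E]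
    [BorelSpace E] (μ : Measure E) [μ.IsAddLeftInvariant] (f : E → ℝ≥0∞) (x : E) (R : ℝ) :
    ∫⁻ z in Metric.ball 0 R, f (x + z) ∂μ = ∫⁻ y in Metric.ball x R, f y ∂μ := by
  have h := (measurePreserving_add_left μ x).setLIntegral_comp_preimage_emb
    (measurableEmbedding_addLeft x) f (Metric.ball x R)
  rwa [preimage_add_ball, sub_self] at h

lemma le_mul_ofReal_rpow_of_le (T : ℝ≥0∞) {m R p : ℝ} (hm : 0 < m) (hmR : m ≤ R) (hp : 0 ≤ p) :
    T ≤ T * ENNReal.ofReal (m ^ (-p)) * ENNReal.ofReal (R ^ p) := by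
  rw [mul_assoc, ← ENNReal.ofReal_mul (by positivity)]
  refine le_mul_of_one_le_right zero_le ?_
  rw [ENNReal.one_le_ofReal, Real.rpow_neg hm.le, inv_mul_eq_div, one_le_div (by positivity)]
  exact Real.rpow_le_rpow hm.le hmR hp

variable {E : Type*} [NormedAddCommGroup E] [InnerProductSpace ℝ E] [FiniteDimensional ℝ E]
  [Nontrivial E] {Ω : Set E} {ρ : E → ℝ} {σ κ q : ℝ}

lemma finrank_add_nonneg (hσ : -1 < σ) : 0 ≤ (Module.finrank ℝ E : ℝ) + σ := by
  have : (1 : ℝ) ≤ Module.finrank ℝ E := mod_cast (Module.finrank_pos (R := ℝ) (M := E))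
  linarith

variable [MeasurableSpace E] [BorelSpace E]

lemma IsDefiningFunction.exists_lintegral_ball_posRpow_le (h : IsDefiningFunction Ω ρ)
    (μ : Measure E) [μ.IsAddHaarMeasure] (hσ : -1 < σ) (hσ0 : σ ≤ 0) (hκ : 0 < κ) :
    ∃ B : ℝ≥0∞, B ≠ ⊤ ∧ ∀ x ∈ Ω, ∀ R, κ * ρ x < R →
      ∫⁻ z in Metric.ball 0 R, ENNReal.ofReal (posRpow σ (ρ (x + z))) ∂μ ≤
        B * ENNReal.ofReal (R ^ ((Module.finrank ℝ E : ℝ) + σ)) := by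
  obtain ⟨c, hc, d, hd, r, hr, hinc⟩ := h.exists_increasesAlong
  set T := ∫⁻ y, ENNReal.ofReal (posRpow σ (ρ y)) ∂μ
  set A := μ (Metric.ball 0 1) * ENNReal.ofReal (c ^ σ / (1 + σ) * 2 ^ Module.finrank ℝ E)
  set p := (Module.finrank ℝ E : ℝ) + σ
  have hm : 0 < min r (κ * d) := by positivity
  refine ⟨A + T * ENNReal.ofReal (min r (κ * d) ^ (-p)), ENNReal.add_ne_top.2
    ⟨ENNReal.mul_ne_top measure_ball_lt_top.ne ENNReal.ofReal_ne_top,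
      ENNReal.mul_ne_top (h.lintegral_posRpow_lt_top μ hσ hσ0).ne ENNReal.ofReal_ne_top⟩,
    fun x hx R hR => ?_⟩
  rw [setLIntegral_ball_comp_add_left μ fun y => ENNReal.ofReal (posRpow σ (ρ y))]
  by_cases hsmall : ρ x < d ∧ R ≤ r
  · obtain ⟨e, he, hxe⟩ := hinc x (subset_closure hx) hsmall.1
    have hR0 : 0 < R := (mul_pos hκ ((h.mem_iff x).1 hx)).trans hR
    have hsub := Metric.ball_subset_ball (x := x) hsmall.2
    calc _ ≤ ∫⁻ y in Metric.ball x R, extPosRpow σ (ρ y) ∂μ :=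
          lintegral_mono fun y => ofReal_posRpow_le_extPosRpow σ (ρ y)
      _ ≤ A * ENNReal.ofReal (R ^ p) :=
          lintegral_ball_extPosRpow_le μ h.continuous.measurable he hσ hσ0 hc hR0
            fun y hy t ht hyt => hxe y (hsub hy) t ht (hsub hyt)
      _ ≤ _ := by gcongr; exact le_self_add
  · have hmR : min r (κ * d) ≤ R := by
      rw [not_and_or, not_lt, not_le] at hsmall
      rcases hsmall with hdx | hrR
      · exact (min_le_right _ _).trans ((mul_le_mul_of_nonneg_left hdx hκ.le).trans hR.le)
      · exact (min_le_left _ _).trans hrR.le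
    calc _ ≤ T := setLIntegral_le_lintegral _ _
      _ ≤ _ := le_mul_ofReal_rpow_of_le T hm hmR (finrank_add_nonneg hσ)
      _ ≤ _ := by gcongr; exact le_add_self

lemma IsDefiningFunction.exists_lintegral_compl_ball_posRpow_le (h : IsDefiningFunction Ω ρ)
    (μ : Measure E) [μ.IsAddHaarMeasure] (hσ : -1 < σ) (hσ0 : σ ≤ 0) (hκ : 0 < κ)
    (hq : (Module.finrank ℝ E : ℝ) + σ < q) :
    ∃ B : ℝ, 0 ≤ B ∧ ∀ x ∈ Ω,
      ∫⁻ z in (Metric.ball 0 (κ * ρ x))ᶜ,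
        ENNReal.ofReal (posRpow σ (ρ (x + z))) * ENNReal.ofReal (‖z‖ ^ (-q)) ∂μ ≤
        ENNReal.ofReal (B * ρ x ^ ((Module.finrank ℝ E : ℝ) + σ - q)) := by
  obtain ⟨B, hB, hgrowth⟩ := h.exists_lintegral_ball_posRpow_le μ hσ hσ0 hκ
  set p := (Module.finrank ℝ E : ℝ) + σ
  have hp : 0 ≤ p := finrank_add_nonneg hσ
  have hq0 : 0 < q := hp.trans_lt hq
  have : 0 < q - p := sub_pos.2 hq
  refine ⟨B.toReal * (q / (q - p) * κ ^ (p - q)), by positivity, fun x hx => ?_⟩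
  have hx0 := (h.mem_iff x).1 hx
  have hρ := h.continuous.measurable
  refine (lintegral_compl_ball_mul_norm_rpow_le μ (by fun_prop) (mul_pos hκ hx0) hq0 hq
    (hgrowth x hx)).trans_eq ?_
  rw [Real.mul_rpow hκ.le hx0.le, ← mul_assoc, mul_assoc B.toReal, ENNReal.ofReal_mul
    (p := B.toReal) ENNReal.toReal_nonneg, ENNReal.ofReal_toReal hB]

end Growth

lemma exists_eq_norm_smul_sphere {E : Type*} [NormedAddCommGroup E] [NormedSpace ℝ E] {z : E}
    (hz : z ≠ 0) : ∃ θ : Metric.sphere (0 : E) 1, z = ‖z‖ • θ.1 := by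
  have hz0 : ‖z‖ ≠ 0 := norm_ne_zero_iff.2 hz
  exact ⟨⟨‖z‖⁻¹ • z, by simp [norm_smul, hz0]⟩,
    by rw [smul_smul, mul_inv_cancel₀ hz0, one_smul]⟩

lemma setIntegral_add_comp_neg {E : Type*} [NormedAddCommGroup E] [MeasurableSpace E]
    [BorelSpace E] {μ : Measure E} [μ.IsNegInvariant] {A : Set E} (hA : -A = A) {g : E → ℝ}
    (hg : IntegrableOn g A μ) :
    IntegrableOn (fun z => g z + g (-z)) A μ ∧
      ∫ z in A, (g z + g (-z)) ∂μ = 2 * ∫ z in A, g z ∂μ := by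
  have hmp : MeasurePreserving Neg.neg (μ.restrict A) (μ.restrict A) := by
    have h := (Measure.measurePreserving_neg μ).restrict_preimage_emb
      (MeasurableEquiv.neg E).measurableEmbedding A
    rwa [neg_preimage, hA] at h
  have hi : IntegrableOn (fun z => g (-z)) A μ :=
    (hmp.integrable_comp_emb (MeasurableEquiv.neg E).measurableEmbedding).2 hg
  refine ⟨hg.add hi, ?_⟩
  rw [integral_add hg hi,
    hmp.integral_comp (MeasurableEquiv.neg E).measurableEmbedding, two_mul]

section Weight

variable {N : ℕ} {s : ℝ} {u : 𝔼 N → ℝ}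

lemma memL1Weight_of_integrable (hs : 0 ≤ s) (hu : Integrable u) : MemL1Weight s u := by
  refine ⟨hu.locallyIntegrable, hu.norm.mono' (hu.aestronglyMeasurable.norm.mul
    (by fun_prop : Measurable _).aestronglyMeasurable) (.of_forall fun y => ?_)⟩
  rw [norm_mul, Real.norm_of_nonneg (abs_nonneg _), Real.norm_of_nonneg (by positivity)]
  refine mul_le_of_le_one_right (abs_nonneg _) (div_le_one_of_le₀ ?_ (by positivity))
  exact Real.one_le_rpow (by linarith [norm_nonneg y]) (by positivity)

lemma MemL1Weight.sub_const (hs : 0 < s) (hu : MemL1Weight s u) (c : ℝ) :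
    MemL1Weight s fun y => u y - c := by
  have hw : Integrable fun y : 𝔼 N => |c| * (1 / (1 + ‖y‖) ^ ((N : ℝ) + 2 * s)) := by
    refine ((integrable_one_add_norm (r := (N : ℝ) + 2 * s)
      (by rw [finrank_euclideanSpace_fin]; linarith)).const_mul |c|).congr (.of_forall fun y => ?_)
    simp only [Real.rpow_neg (by positivity : 0 ≤ 1 + ‖y‖), one_div]
  have hm := hu.1.sub (locallyIntegrable_const c)
  refine ⟨hm, (hu.2.add hw).mono' (hm.aestronglyMeasurable.norm.mul
    (by fun_prop : Measurable _).aestronglyMeasurable) (.of_forall fun y => ?_)⟩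
  rw [norm_mul, Real.norm_of_nonneg (abs_nonneg _), Real.norm_of_nonneg (by positivity),
    Pi.add_apply, ← add_mul]
  gcongr
  exact abs_sub _ _

end Weight

namespace IsStableKernel

variable {N : ℕ} {s γ Γ : ℝ} {K : 𝔼 N → ℝ}

lemma apply_neg (hK : IsStableKernel s γ Γ K) (z : 𝔼 N) : K (-z) = K z := by
  rcases eq_or_ne z 0 with rfl | hz
  · rw [neg_zero]
  · exact hK.even z hz

lemma apply_smul (hK : IsStableKernel s γ Γ K) {z : 𝔼 N} (hz : z ≠ 0) {r : ℝ} (hr : 0 < r) :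
    K (r • z) = r ^ (-((N : ℝ) + 2 * s)) * K z := by
  obtain ⟨a, -, -, haK⟩ := hK.stable
  obtain ⟨θ, hθ⟩ := exists_eq_norm_smul_sphere hz
  have hz0 : 0 < ‖z‖ := norm_pos_iff.2 hz
  generalize ‖z‖ = t at hθ hz0
  rw [hθ, smul_smul, haK θ _ (mul_pos hr hz0), haK θ t hz0, Real.mul_rpow hr.le hz0.le,
    Real.rpow_neg hr.le]
  field_simp

lemma mem_Icc_sphere (hK : IsStableKernel s γ Γ K) (θ : Metric.sphere (0 : 𝔼 N) 1) :
    K θ ∈ Icc γ Γ := by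
  obtain ⟨a, -, hab, haK⟩ := hK.stable
  have h := haK θ 1 one_pos
  rw [one_smul, Real.one_rpow, div_one] at h
  exact h ▸ hab θ

lemma nonneg (hK : IsStableKernel s γ Γ K) (hγ : 0 ≤ γ) {z : 𝔼 N} (hz : z ≠ 0) : 0 ≤ K z := by
  obtain ⟨θ, hθ⟩ := exists_eq_norm_smul_sphere hz
  rw [hθ, hK.apply_smul (ne_zero_of_mem_unit_sphere θ) (norm_pos_iff.2 hz)]
  exact mul_nonneg (by positivity) (hγ.trans (hK.mem_Icc_sphere θ).1)

lemma le (hK : IsStableKernel s γ Γ K) {z : 𝔼 N} (hz : z ≠ 0) :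
    K z ≤ Γ * ‖z‖ ^ (-((N : ℝ) + 2 * s)) := by
  obtain ⟨θ, hθ⟩ := exists_eq_norm_smul_sphere hz
  nth_rw 1 [hθ]
  rw [hK.apply_smul (ne_zero_of_mem_unit_sphere θ) (norm_pos_iff.2 hz), mul_comm]
  gcongr
  exact (hK.mem_Icc_sphere θ).2

lemma ge (hK : IsStableKernel s γ Γ K) {z : 𝔼 N} (hz : z ≠ 0) :
    γ * ‖z‖ ^ (-((N : ℝ) + 2 * s)) ≤ K z := by
  obtain ⟨θ, hθ⟩ := exists_eq_norm_smul_sphere hz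
  nth_rw 2 [hθ]
  rw [hK.apply_smul (ne_zero_of_mem_unit_sphere θ) (norm_pos_iff.2 hz), mul_comm]
  gcongr
  exact (hK.mem_Icc_sphere θ).1

lemma measurable (hK : IsStableKernel s γ Γ K) : Measurable K := by
  obtain ⟨a, ha, -, haK⟩ := hK.stable
  refine measurable_of_measurable_on_compl_singleton 0 ?_
  set e := homeomorphUnitSphereProd (𝔼 N)
  have he : Measurable e := e.measurable
  have hpolar : (({0}ᶜ : Set (𝔼 N)).domRestrict K) =
      fun x => a (e x).1 / ((e x).2 : ℝ) ^ ((N : ℝ) + 2 * s) := by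
    funext x
    rw [← haK _ _ (e x).2.2]
    exact congrArg (fun y => K y.1) (e.symm_apply_apply x).symm
  exact hpolar ▸ (by fun_prop :
    Measurable fun x => a (e x).1 / ((e x).2 : ℝ) ^ ((N : ℝ) + 2 * s))

variable [Nontrivial (𝔼 N)]

lemma upper_nonneg (hK : IsStableKernel s γ Γ K) (hγ : 0 ≤ γ) : 0 ≤ Γ := by
  obtain ⟨z, hz⟩ := exists_ne (0 : 𝔼 N)
  obtain ⟨θ, -⟩ := exists_eq_norm_smul_sphere hz
  exact hγ.trans ((hK.mem_Icc_sphere θ).1.trans (hK.mem_Icc_sphere θ).2)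

lemma integrableOn_secondDiff_mul_ball (hK : IsStableKernel s γ Γ K) (hγ : 0 ≤ γ) (hs1 : s < 1)
    {v : 𝔼 N → ℝ} {x : 𝔼 N} {C r : ℝ}
    (hm : AEStronglyMeasurable (secondDiff v x) (volume.restrict (Metric.ball 0 r)))
    (hv : ∀ z, ‖z‖ < r → |secondDiff v x z| ≤ C * ‖z‖ ^ 2) :
    IntegrableOn (fun z => secondDiff v x z * K z) (Metric.ball 0 r) := by
  refine ((integrableOn_ball_norm_rpow volume (q := 2 - ((N : ℝ) + 2 * s))
    (by rw [finrank_euclideanSpace_fin]; linarith) r).const_mul (C * Γ)).mono'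
    (hm.mul hK.measurable.aestronglyMeasurable) ?_
  filter_upwards [ae_restrict_mem measurableSet_ball, ae_restrict_of_ae (Measure.ae_ne volume 0)]
    with z hz hz0
  have hn : 0 < ‖z‖ := norm_pos_iff.2 hz0
  have hvz := hv z (mem_ball_zero_iff.1 hz)
  rw [norm_mul, Real.norm_of_nonneg (hK.nonneg hγ hz0), Real.norm_eq_abs]
  calc _ ≤ (C * ‖z‖ ^ 2) * (Γ * ‖z‖ ^ (-((N : ℝ) + 2 * s))) :=
        mul_le_mul hvz (hK.le hz0) (hK.nonneg hγ hz0) ((abs_nonneg _).trans hvz)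
    _ = _ := by
        rw [sub_eq_add_neg, Real.rpow_add hn, Real.rpow_two]
        ring

end IsStableKernel

section Truncated

variable {N : ℕ} {s γ Γ δ : ℝ} {K : 𝔼 N → ℝ}

lemma one_add_norm_le_mul_norm_sub {E : Type*} [NormedAddCommGroup E] {x y : E} (hδ : 0 < δ)
    (h : δ ≤ ‖x - y‖) : 1 + ‖y‖ ≤ ((1 + ‖x‖) / δ + 1) * ‖x - y‖ := by
  have htri : ‖y‖ ≤ ‖x‖ + ‖x - y‖ := norm_le_norm_add_norm_sub x y
  have hscale : 1 + ‖x‖ ≤ (1 + ‖x‖) / δ * ‖x - y‖ := by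
    rw [div_mul_eq_mul_div, le_div_iff₀ hδ]
    gcongr
  linarith

lemma norm_sub_rpow_le_weight {x y : 𝔼 N} (hs : 0 ≤ s) (hδ : 0 < δ) (h : δ ≤ ‖x - y‖) :
    ‖x - y‖ ^ (-((N : ℝ) + 2 * s)) ≤
      ((1 + ‖x‖) / δ + 1) ^ ((N : ℝ) + 2 * s) * (1 / (1 + ‖y‖) ^ ((N : ℝ) + 2 * s)) := by
  have hn : 0 < ‖x - y‖ := hδ.trans_le h
  rw [Real.rpow_neg hn.le, mul_one_div, inv_eq_one_div,
    div_le_div_iff₀ (by positivity) (by positivity), one_mul,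
    ← Real.mul_rpow (by positivity) hn.le]
  exact Real.rpow_le_rpow (by positivity) (one_add_norm_le_mul_norm_sub hδ h) (by positivity)

variable [Nontrivial (𝔼 N)]

lemma IsStableKernel.integrableOn_mul_comp_sub (hK : IsStableKernel s γ Γ K) (hγ : 0 ≤ γ)
    (hs : 0 ≤ s) {u : 𝔼 N → ℝ} (hu : MemL1Weight s u) (x : 𝔼 N) (hδ : 0 < δ) :
    IntegrableOn (fun y => u y * K (x - y)) (Metric.ball x δ)ᶜ := by
  set p := (N : ℝ) + 2 * s
  have hKm : Measurable fun y => K (x - y) := hK.measurable.comp (by fun_prop)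
  refine (hu.2.const_mul (Γ * ((1 + ‖x‖) / δ + 1) ^ p)).integrableOn.mono'
    (hu.1.aestronglyMeasurable.restrict.mul hKm.aestronglyMeasurable) ?_
  filter_upwards [ae_restrict_mem measurableSet_ball.compl] with y hy
  have hy : δ ≤ ‖x - y‖ := by
    rwa [mem_compl_iff, Metric.mem_ball', dist_eq_norm, not_lt] at hy
  have hz : x - y ≠ 0 := norm_pos_iff.1 (hδ.trans_le hy)
  have hΓ := hK.upper_nonneg hγ
  rw [norm_mul, Real.norm_of_nonneg (hK.nonneg hγ hz), Real.norm_eq_abs]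
  calc _ ≤ |u y| * (Γ * (((1 + ‖x‖) / δ + 1) ^ p * (1 / (1 + ‖y‖) ^ p))) := by
        gcongr
        exact (hK.le hz).trans (by gcongr; exact norm_sub_rpow_le_weight hs hδ hy)
    _ = _ := by ring

lemma IsStableKernel.integrableOn_sub_mul_comp_sub (hK : IsStableKernel s γ Γ K) (hγ : 0 ≤ γ)
    (hs : 0 < s) {u : 𝔼 N → ℝ} (hu : MemL1Weight s u) (x : 𝔼 N) (hδ : 0 < δ) :
    IntegrableOn (fun y => (u y - u x) * K (x - y)) (Metric.ball x δ)ᶜ :=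
  hK.integrableOn_mul_comp_sub hγ hs.le (hu.sub_const hs (u x)) x hδ

lemma IsStableKernel.setIntegral_sub_mul_comp_sub (hK : IsStableKernel s γ Γ K) (hγ : 0 ≤ γ)
    (hs : 0 < s) {φ : 𝔼 N → ℝ} (hφ : MemL1Weight s φ) (x : 𝔼 N) {A : Set (𝔼 N)} (hA : -A = A)
    (hδ : 0 < δ) (hAδ : A ⊆ (Metric.ball 0 δ)ᶜ) :
    IntegrableOn (fun z => secondDiff φ x z * K z) A ∧
      ∫ y in (· - x) ⁻¹' A, (φ y - φ x) * K (x - y) = 1 / 2 * ∫ z in A, secondDiff φ x z * K z := by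
  have hmp := measurePreserving_sub_right (volume : Measure (𝔼 N)) x
  have hemb := measurableEmbedding_subRight x
  set g : 𝔼 N → ℝ := fun z => (φ (x + z) - φ x) * K z
  have hgy (y : 𝔼 N) : g (y - x) = (φ y - φ x) * K (x - y) := by
    rw [← hK.apply_neg (x - y), neg_sub, ← add_sub_cancel x y]
    simp [g]
  have hsub : (· - x) ⁻¹' A ⊆ (Metric.ball x δ)ᶜ := fun y hy => by
    simpa [dist_eq_norm] using hAδ hy
  have hgA : IntegrableOn g A := by
    rw [← hmp.integrableOn_comp_preimage hemb]
    exact ((hK.integrableOn_sub_mul_comp_sub hγ hs hφ x hδ).mono_set hsub).congr_fun_ae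
      (.of_forall fun y => (hgy y).symm)
  have hsymm (z : 𝔼 N) : g z + g (-z) = secondDiff φ x z * K z := by
    simp only [g, secondDiff, hK.apply_neg, ← sub_eq_add_neg]
    ring
  obtain ⟨hi, he⟩ := setIntegral_add_comp_neg hA hgA
  simp only [hsymm] at hi he
  refine ⟨hi, ?_⟩
  simp only [← hgy]
  rw [hmp.setIntegral_preimage_emb hemb, he]
  ring

lemma IsStableKernel.integrable_secondDiff_mul (hK : IsStableKernel s γ Γ K) (hγ : 0 ≤ γ)
    (hs : 0 < s) (hs1 : s < 1) {v : 𝔼 N → ℝ} (hv : Integrable v) {x : 𝔼 N}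
    (hvx : ContDiffAt ℝ 2 v x) : Integrable fun z => secondDiff v x z * K z := by
  obtain ⟨C, -, r, hr, hCr⟩ := exists_abs_secondDiff_le hvx
  have hm : AEStronglyMeasurable (secondDiff v x) volume :=
    ((hv.comp_add_left x).aestronglyMeasurable.add
      (hv.comp_sub_left x).aestronglyMeasurable).sub aestronglyMeasurable_const
  have hfar := (hK.setIntegral_sub_mul_comp_sub hγ hs (memL1Weight_of_integrable hs.le hv) x
    (A := (Metric.ball 0 r)ᶜ) (by ext; simp) hr Subset.rfl).1
  rw [← integrableOn_univ, ← union_compl_self (Metric.ball (0 : 𝔼 N) r)]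
  exact (hK.integrableOn_secondDiff_mul_ball hγ hs1 hm.restrict hCr).union hfar

end Truncated

section PrincipalValue

variable {N : ℕ} [Nontrivial (𝔼 N)] {s γ Γ δ : ℝ} {K : 𝔼 N → ℝ}

lemma IsStableKernel.pvOp_ball (hK : IsStableKernel s γ Γ K) (hγ : 0 ≤ γ) (hs : 0 < s)
    (hs1 : s < 1) {φ : 𝔼 N → ℝ} (hφ : Integrable φ) {x : 𝔼 N} (hφx : ContDiffAt ℝ 2 φ x)
    (δ : ℝ) :
    pvOp K (Metric.ball x δ) φ x = 1 / 2 * ∫ z in Metric.ball 0 δ, secondDiff φ x z * K z := by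
  have hcov : AECover (volume.restrict (Metric.ball (0 : 𝔼 N) δ)) (𝓝[>] (0 : ℝ))
      fun ε => (Metric.ball (0 : 𝔼 N) ε)ᶜ := by
    refine ⟨ae_restrict_of_ae ?_, fun ε => measurableSet_ball.compl⟩
    filter_upwards [Measure.ae_ne volume (0 : 𝔼 N)] with z hz
    filter_upwards [Ioo_mem_nhdsGT (norm_pos_iff.2 hz)] with ε hε
    simpa using hε.2.le
  have hlim := (hcov.integral_tendsto_of_countably_generated
    (hK.integrable_secondDiff_mul hγ hs hs1 hφ hφx).integrableOn).const_mul (1 / 2)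
  refine Tendsto.limUnder_eq (hlim.congr' ?_)
  filter_upwards [self_mem_nhdsWithin] with ε hε
  have hset : Metric.ball x δ \ Metric.ball x ε =
      (· - x) ⁻¹' ((Metric.ball (0 : 𝔼 N) ε)ᶜ ∩ Metric.ball 0 δ) := by
    ext y
    simp [dist_eq_norm, and_comm]
  rw [hset, (hK.setIntegral_sub_mul_comp_sub hγ hs (memL1Weight_of_integrable hs.le hφ) x
    (by ext; simp) hε inter_subset_left).2, Measure.restrict_restrict measurableSet_ball.compl]

lemma pvOp_compl_ball {N : ℕ} (K v : 𝔼 N → ℝ) (x : 𝔼 N) (hδ : 0 < δ) :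
    pvOp K (Metric.ball x δ)ᶜ v x = ∫ y in (Metric.ball x δ)ᶜ, (v y - v x) * K (x - y) := by
  refine Tendsto.limUnder_eq (tendsto_const_nhds.congr' ?_)
  filter_upwards [Ioo_mem_nhdsGT hδ] with ε hε
  rw [sdiff_eq_left.2 (disjoint_compl_left.mono_right (Metric.ball_subset_ball hε.2.le))]

/-- A function `u` lying below `φ`, up to the common value at `x`, may be replaced by `φ` in the
part of the operator away from `x`. -/
lemma IsStableKernel.pvOp_add_pvOp_le (hK : IsStableKernel s γ Γ K) (hγ : 0 ≤ γ) (hs : 0 < s)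
    (hs1 : s < 1) {u φ : 𝔼 N → ℝ} (hu : MemL1Weight s u) (hφ : Integrable φ) {x : 𝔼 N}
    (hφx : ContDiffAt ℝ 2 φ x) (hδ : 0 < δ) (hle : ∀ᵐ y, u y - u x ≤ φ y - φ x) :
    pvOp K (Metric.ball x δ) φ x + pvOp K (Metric.ball x δ)ᶜ u x ≤
      1 / 2 * ∫ z, secondDiff φ x z * K z := by
  have hφ1 := memL1Weight_of_integrable hs.le hφ
  have hset : (· - x) ⁻¹' (Metric.ball (0 : 𝔼 N) δ)ᶜ = (Metric.ball x δ)ᶜ := by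
    ext y
    simp [dist_eq_norm]
  have hfar := (hK.setIntegral_sub_mul_comp_sub hγ hs hφ1 x (A := (Metric.ball 0 δ)ᶜ)
    (by ext; simp) hδ Subset.rfl).2
  rw [hset] at hfar
  have hmono : ∫ y in (Metric.ball x δ)ᶜ, (u y - u x) * K (x - y) ≤
      ∫ y in (Metric.ball x δ)ᶜ, (φ y - φ x) * K (x - y) := by
    refine setIntegral_mono_on_ae (hK.integrableOn_sub_mul_comp_sub hγ hs hu x hδ)
      (hK.integrableOn_sub_mul_comp_sub hγ hs hφ1 x hδ) measurableSet_ball.compl ?_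
    filter_upwards [hle] with y hy hyB
    refine mul_le_mul_of_nonneg_right hy (hK.nonneg hγ (sub_ne_zero.2 ?_))
    rintro rfl
    exact hyB (Metric.mem_ball_self hδ)
  rw [hK.pvOp_ball hγ hs hs1 hφ hφx, pvOp_compl_ball K u x hδ, ← integral_add_compl
    measurableSet_ball (hK.integrable_secondDiff_mul hγ hs hs1 hφ hφx), mul_add, ← hfar]
  gcongr

end PrincipalValue

section Power

variable {σ s d t l Q : ℝ}

lemma one_sub_le_rpow_sub_one {x : ℝ} (hx : 1 ≤ x) (hσ : -1 ≤ σ) : 1 - x ≤ x ^ σ - 1 := by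
  have : 0 < x := one_pos.trans_le hx
  have hinv : 2 - x ≤ x ^ (-1 : ℝ) := by
    rw [Real.rpow_neg_one, ← sub_nonneg]
    have : x⁻¹ - (2 - x) = (x - 1) ^ 2 * x⁻¹ := by field_simp; ring
    rw [this]
    positivity
  linarith [Real.rpow_le_rpow_of_exponent_le hx hσ]

lemma rpow_le_rpow_add (ht : 0 < t) (htl : t ≤ l) (hσ : -1 ≤ σ) :
    t ^ σ ≤ l ^ σ + t ^ (σ - 1) * (l - t) := by
  have hx : 0 ≤ l / t := div_nonneg (ht.le.trans htl) ht.le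
  have h := mul_le_mul_of_nonneg_left (one_sub_le_rpow_sub_one ((one_le_div ht).2 htl) hσ)
    (Real.rpow_nonneg ht.le σ)
  have hl : l ^ σ = t ^ σ * (l / t) ^ σ := by
    rw [← Real.mul_rpow ht.le hx, mul_div_cancel₀ l ht.ne']
  have hd : t ^ (σ - 1) * (l - t) = -(t ^ σ * (1 - l / t)) := by
    rw [Real.rpow_sub_one ht.ne']
    field_simp
    ring
  rw [hl, hd]
  linarith

lemma posRpow_le_posRpow_add (hσ : -1 ≤ σ) (hσ0 : σ ≤ 0) (h : |t - l| ≤ Q) :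
    posRpow σ t ≤ posRpow σ l + 2 * (posRpow (σ - 1) t * min t Q) := by
  have hQ : 0 ≤ Q := (abs_nonneg _).trans h
  rcases le_or_gt t 0 with ht | ht
  · rw [posRpow_of_nonpos ht, posRpow_of_nonpos ht, zero_mul, mul_zero, add_zero]
    exact posRpow_nonneg _ _
  have : 0 < t ^ (σ - 1) := by positivity
  rw [posRpow_of_pos ht, posRpow_of_pos ht]
  rcases le_or_gt t (2 * Q) with htQ | htQ
  · have hmin : t ^ (σ - 1) * (t / 2) ≤ t ^ (σ - 1) * min t Q := by
      gcongr
      exact le_min (by linarith) (by linarith)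
    have htσ : t ^ σ = t ^ (σ - 1) * t := by
      rw [← Real.rpow_add_one ht.ne', sub_add_cancel]
    linarith [posRpow_nonneg σ l]
  · rw [min_eq_right (by linarith)]
    have hl := abs_le.1 h
    have hl0 : 0 < l := by linarith
    have hpQ : 0 ≤ t ^ (σ - 1) * Q := by positivity
    rw [posRpow_of_pos hl0]
    rcases le_or_gt l t with hlt | hlt
    · linarith [Real.rpow_le_rpow_of_nonpos hl0 hlt hσ0]
    · have hlQ : t ^ (σ - 1) * (l - t) ≤ t ^ (σ - 1) * Q := by
        gcongr
        linarith
      linarith [rpow_le_rpow_add ht hlt.le hσ]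

lemma posRpow_mul (hd : 0 < d) : posRpow σ (d * t) = d ^ σ * posRpow σ t := by
  rcases le_or_gt t 0 with ht | ht
  · rw [posRpow_of_nonpos ht, posRpow_of_nonpos (mul_nonpos_of_nonneg_of_nonpos hd.le ht), mul_zero]
  · rw [posRpow_of_pos ht, posRpow_of_pos (by positivity), Real.mul_rpow hd.le ht.le]

lemma secondDiff_abs (f : ℝ → ℝ) (x t : ℝ) : secondDiff f x |t| = secondDiff f x t := by
  rcases abs_choice t with h | h <;> rw [h]
  rw [secondDiff, secondDiff, sub_neg_eq_add, ← sub_eq_add_neg, add_comm (f (x - t))]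

lemma secondDiff_posRpow_eq (hd : 0 < d) (t : ℝ) :
    secondDiff (posRpow σ) d t = d ^ σ * secondDiff (posRpow σ) 1 |d⁻¹ * t| := by
  have ht : t = d * (d⁻¹ * t) := (mul_inv_cancel_left₀ hd.ne' t).symm
  nth_rw 1 [secondDiff_abs, ht, ← mul_one d]
  rw [secondDiff, ← mul_add, ← mul_sub, posRpow_mul hd, posRpow_mul hd, posRpow_mul hd, secondDiff]
  ring

end Power

namespace IsStableKernel

variable {N : ℕ} {s γ Γ σ d : ℝ} {K : 𝔼 N → ℝ}

lemma apply_smul_finrank (hK : IsStableKernel s γ Γ K) :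
    ∀ z ≠ 0, ∀ r > 0, K (r • z) = r ^ (-((Module.finrank ℝ (𝔼 N) : ℝ) + 2 * s)) * K z := by
  rw [finrank_euclideanSpace_fin]
  exact fun z hz r hr => hK.apply_smul hz hr

lemma abs_le_sphere (hK : IsStableKernel s γ Γ K) (hγ : 0 ≤ γ) (θ : Metric.sphere (0 : 𝔼 N) 1) :
    |K θ| ≤ Γ := by
  obtain ⟨hl, hu⟩ := hK.mem_Icc_sphere θ
  rwa [abs_of_nonneg (hγ.trans hl)]

lemma mul_sphereMoment_le (hK : IsStableKernel s γ Γ K) (hγ : 0 ≤ γ) (hs : 0 ≤ s) (p : 𝔼 N) :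
    γ * sphereMoment volume s p ≤
      ∫ θ, K θ.1 * |inner ℝ p θ.1| ^ (2 * s) ∂(volume : Measure (𝔼 N)).toSphere := by
  rw [sphereMoment, ← integral_const_mul]
  exact integral_mono
    (integrable_mul_abs_inner_rpow_toSphere hs measurable_const (fun _ => le_rfl) p)
    (integrable_mul_abs_inner_rpow_toSphere hs (hK.measurable.comp measurable_subtype_coe)
      (hK.abs_le_sphere hγ) p)
    fun θ => mul_le_mul_of_nonneg_right (hK.mem_Icc_sphere θ).1 (by positivity)

variable [Nontrivial (𝔼 N)]

lemma integrable_secondDiff_posRpow_inner (hK : IsStableKernel s γ Γ K) (hγ : 0 ≤ γ) (hs : 0 < s)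
    (hs1 : s < 1) (hσ : -1 < σ) (hσ0 : σ ≤ 0) (hd : 0 < d) (p : 𝔼 N) :
    Integrable fun z => secondDiff (posRpow σ) d (inner ℝ p z) * K z := by
  simp only [secondDiff_posRpow_eq hd, ← real_inner_smul_left, mul_assoc]
  exact (integrable_comp_abs_inner_mul hs hK.measurable hK.apply_smul_finrank
    (hK.abs_le_sphere hγ) (measurable_secondDiff_posRpow σ 1) (by simp [secondDiff, two_mul])
    (integrableOn_secondDiff_posRpow_mul hs hs1 hσ hσ0) _).const_mul _

lemma integral_secondDiff_posRpow_inner_le (hK : IsStableKernel s γ Γ K) (hγ : 0 ≤ γ) (hs : 0 < s)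
    (hs1 : s < 1) (hσ : -1 < σ) (hσ0 : σ ≤ 0) (hJ : rpowConst s σ ≤ 0) (hd : 0 < d) (p : 𝔼 N) :
    ∫ z, secondDiff (posRpow σ) d (inner ℝ p z) * K z ≤
      γ * rpowConst s σ * sphereMoment volume s p * d ^ (σ - 2 * s) := by
  simp only [secondDiff_posRpow_eq hd, ← real_inner_smul_left, mul_assoc, integral_const_mul]
  rw [integral_comp_abs_inner_mul hs hK.measurable hK.apply_smul_finrank
    (hK.abs_le_sphere hγ) (measurable_secondDiff_posRpow σ 1) (by simp [secondDiff, two_mul])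
    (integrableOn_secondDiff_posRpow_mul hs hs1 hσ hσ0)]
  calc _ ≤ d ^ σ * (γ * sphereMoment volume s (d⁻¹ • p) * rpowConst s σ) :=
        mul_le_mul_of_nonneg_left
          (mul_le_mul_of_nonpos_right (hK.mul_sphereMoment_le hγ hs.le _) hJ) (by positivity)
    _ = _ := by
        rw [sphereMoment_smul (by positivity), Real.inv_rpow hd.le, ← Real.rpow_neg hd.le,
          sub_eq_add_neg, Real.rpow_add hd]
        ring

end IsStableKernel

section LinError

variable {E : Type*} [NormedAddCommGroup E] {C L H s σ α : ℝ} {ρ : E → ℝ} {x z : E}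

/-- A bound for the error made in `posRpow σ ∘ ρ` at `x + z` when `ρ` is replaced by its affine
Taylor polynomial at `x`, with `C * ‖z‖ ^ 2` bounding the Taylor remainder. -/
def linError (C σ : ℝ) (ρ : E → ℝ) (x z : E) : ℝ :=
  2 * (posRpow (σ - 1) (ρ (x + z)) * min (ρ (x + z)) (C * ‖z‖ ^ 2))

lemma linError_nonneg (hC : 0 ≤ C) (σ : ℝ) (ρ : E → ℝ) (x z : E) : 0 ≤ linError C σ ρ x z := by
  unfold linError
  rcases le_or_gt (ρ (x + z)) 0 with h | h
  · simp [posRpow_of_nonpos h]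
  · have := posRpow_nonneg (σ - 1) (ρ (x + z))
    positivity

lemma measurable_linError [MeasurableSpace E] [BorelSpace E] (hρ : Measurable ρ) (C σ : ℝ)
    (x : E) : Measurable (linError C σ ρ x) := by
  unfold linError; fun_prop

lemma linError_le_of_norm_lt (hC : 0 ≤ C) (hL : 0 < L) (hLip : ∀ x y, |ρ x - ρ y| ≤ L * ‖x - y‖)
    (hσ : σ ≤ 1) (hx : 0 < ρ x) (hz : ‖z‖ < 1 / (2 * L) * ρ x) :
    linError C σ ρ x z ≤ 2 * (1 / 2 * ρ x) ^ (σ - 1) * C * ‖z‖ ^ 2 := by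
  have hLz : L * ‖z‖ ≤ 1 / 2 * ρ x := by
    calc L * ‖z‖ ≤ L * (1 / (2 * L) * ρ x) := by gcongr
      _ = 1 / 2 * ρ x := by field_simp
  have hdiff := hLip (x + z) x
  rw [add_sub_cancel_left] at hdiff
  have hhalf : 1 / 2 * ρ x ≤ ρ (x + z) := by linarith [(abs_le.1 hdiff).1]
  have hpos : 0 < ρ (x + z) := by linarith
  rw [linError, posRpow_of_pos hpos, mul_assoc, mul_assoc]
  gcongr ?_ * (?_ * ?_)
  · exact Real.rpow_le_rpow_of_nonpos (by positivity) hhalf (by linarith)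
  · exact min_le_right _ _

lemma linError_le_mul_norm_rpow (hC : 0 ≤ C) (hα0 : 0 ≤ α) (hα1 : α ≤ 1) (x z : E) :
    linError C σ ρ x z ≤ 2 * C ^ α * (posRpow (σ - α) (ρ (x + z)) * ‖z‖ ^ (2 * α)) := by
  rcases le_or_gt (ρ (x + z)) 0 with h | h
  · simp [linError, posRpow_of_nonpos h]
  set t := ρ (x + z)
  set Q := C * ‖z‖ ^ 2 with hQ
  have hQ0 : 0 ≤ Q := by positivity
  have hm : 0 ≤ min t Q := le_min h.le hQ0
  have hmin : min t Q ≤ t ^ (1 - α) * Q ^ α := by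
    calc min t Q = min t Q ^ (1 - α) * min t Q ^ α := by
          rw [← Real.rpow_add_of_nonneg hm (by linarith) hα0, sub_add_cancel, Real.rpow_one]
      _ ≤ _ := by
          gcongr
          · exact min_le_left _ _
          · exact min_le_right _ _
  have hQα : Q ^ α = C ^ α * ‖z‖ ^ (2 * α) := by
    rw [hQ, Real.mul_rpow hC (by positivity), Real.rpow_mul (norm_nonneg z), Real.rpow_two]
  have ht : t ^ (σ - 1) * t ^ (1 - α) = t ^ (σ - α) := by
    rw [← Real.rpow_add h, sub_add_sub_cancel]
  rw [linError, posRpow_of_pos h, posRpow_of_pos h, ← ht]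
  calc _ ≤ 2 * (t ^ (σ - 1) * (t ^ (1 - α) * Q ^ α)) := by gcongr
    _ = _ := by rw [hQα]; ring

variable [InnerProductSpace ℝ E] [FiniteDimensional ℝ E]

lemma secondDiff_posRpow_comp_le
    (hC : ∀ z, |ρ (x + z) - (ρ x + inner ℝ (gradient ρ x) z)| ≤ C * ‖z‖ ^ 2) (hσ : -1 ≤ σ)
    (hσ0 : σ ≤ 0) (z : E) :
    secondDiff (fun y => posRpow σ (ρ y)) x z ≤
      secondDiff (posRpow σ) (ρ x) (inner ℝ (gradient ρ x) z) +
        (linError C σ ρ x z + linError C σ ρ x (-z)) := by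
  have h₁ := posRpow_le_posRpow_add hσ hσ0 (hC z)
  have h₂ := posRpow_le_posRpow_add hσ hσ0 (hC (-z))
  rw [inner_neg_right, ← sub_eq_add_neg, ← sub_eq_add_neg] at h₂
  simp only [secondDiff, linError]
  rw [← sub_eq_add_neg]
  linarith

variable [MeasurableSpace E] [BorelSpace E] [Nontrivial E] (μ : Measure E) [μ.IsAddHaarMeasure]

lemma exists_lintegral_ball_linError_le (hC : 0 ≤ C) (hL : 0 < L)
    (hLip : ∀ x y, |ρ x - ρ y| ≤ L * ‖x - y‖) (hs1 : s < 1) (hσ : σ ≤ 1) :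
    ∃ B : ℝ, 0 ≤ B ∧ ∀ x, 0 < ρ x → ∫⁻ z in Metric.ball 0 (1 / (2 * L) * ρ x),
      ENNReal.ofReal (linError C σ ρ x z * ‖z‖ ^ (-((Module.finrank ℝ E : ℝ) + 2 * s))) ∂μ ≤
        ENNReal.ofReal (B * ρ x ^ (σ + 1 - 2 * s)) := by
  set κ := 1 / (2 * L)
  have hκ : 0 < κ := by positivity
  set n := (Module.finrank ℝ E : ℝ)
  set A := ∫ z in Metric.ball (0 : E) 1, ‖z‖ ^ (2 - (n + 2 * s)) ∂μ
  have : 0 ≤ A := integral_nonneg fun z => by positivity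
  refine ⟨2 * (1 / 2) ^ (σ - 1) * C * A * κ ^ (2 - 2 * s), by positivity, fun x hx => ?_⟩
  set b := 2 * (1 / 2 * ρ x) ^ (σ - 1) * C with hb
  have hint := (integrableOn_ball_norm_rpow μ (q := 2 - (n + 2 * s)) (by linarith)
    (κ * ρ x)).const_mul b
  calc _ ≤ ∫⁻ z in Metric.ball 0 (κ * ρ x), ENNReal.ofReal (b * ‖z‖ ^ (2 - (n + 2 * s))) ∂μ := by
        refine setLIntegral_mono_ae' measurableSet_ball ?_
        filter_upwards [Measure.ae_ne μ 0] with z hz0 hz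
        rw [sub_eq_add_neg, Real.rpow_add (norm_pos_iff.2 hz0), Real.rpow_two, ← mul_assoc]
        gcongr
        exact linError_le_of_norm_lt hC hL hLip hσ hx (mem_ball_zero_iff.1 hz)
    _ = ENNReal.ofReal (b * (A * (κ * ρ x) ^ (2 - 2 * s))) := by
        rw [← ofReal_integral_eq_lintegral_ofReal hint (.of_forall fun z => by positivity),
          integral_const_mul, setIntegral_ball_norm_rpow μ _ (by positivity)]
        congr 4
        ring
    _ = _ := by
        have hexp : ρ x ^ (σ + 1 - 2 * s) = ρ x ^ (σ - 1) * ρ x ^ (2 - 2 * s) := by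
          rw [← Real.rpow_add hx]
          ring_nf
        rw [hexp, hb, Real.mul_rpow hκ.le hx.le, Real.mul_rpow (by norm_num) hx.le]
        ring_nf

lemma IsDefiningFunction.exists_lintegral_compl_ball_linError_le {Ω : Set E}
    (h : IsDefiningFunction Ω ρ) {κ : ℝ} (hκ : 0 < κ) (hC : 0 ≤ C) (hσ0 : σ ≤ 0) (hα0 : 0 ≤ α)
    (hα : α < 1 + σ) (hασ : α + σ < 2 * s) :
    ∃ B : ℝ, 0 ≤ B ∧ ∀ x ∈ Ω, ∫⁻ z in (Metric.ball 0 (κ * ρ x))ᶜ,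
      ENNReal.ofReal (linError C σ ρ x z * ‖z‖ ^ (-((Module.finrank ℝ E : ℝ) + 2 * s))) ∂μ ≤
        ENNReal.ofReal (B * ρ x ^ (σ + α - 2 * s)) := by
  set n := (Module.finrank ℝ E : ℝ)
  obtain ⟨B, hB, hBx⟩ := h.exists_lintegral_compl_ball_posRpow_le μ (σ := σ - α)
    (q := n + 2 * s - 2 * α) (by linarith) (by linarith) hκ (by linarith)
  refine ⟨2 * C ^ α * B, by positivity, fun x hx => ?_⟩
  have hκx : 0 < κ * ρ x := mul_pos hκ ((h.mem_iff x).1 hx)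
  calc _ ≤ ∫⁻ z in (Metric.ball 0 (κ * ρ x))ᶜ, ENNReal.ofReal (2 * C ^ α) *
          (ENNReal.ofReal (posRpow (σ - α) (ρ (x + z))) *
            ENNReal.ofReal (‖z‖ ^ (-(n + 2 * s - 2 * α)))) ∂μ := by
        refine setLIntegral_mono' measurableSet_ball.compl fun z hz => ?_
        have hz0 : 0 < ‖z‖ := hκx.trans_le (by simpa using hz)
        rw [← ENNReal.ofReal_mul (posRpow_nonneg _ _), ← ENNReal.ofReal_mul (by positivity),
          show -(n + 2 * s - 2 * α) = 2 * α + -(n + 2 * s) by ring, Real.rpow_add hz0,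
          ← mul_assoc (posRpow _ _), ← mul_assoc (2 * C ^ α)]
        gcongr
        exact linError_le_mul_norm_rpow hC hα0 (by linarith) x z
    _ ≤ ENNReal.ofReal (2 * C ^ α) *
          ENNReal.ofReal (B * ρ x ^ (n + (σ - α) - (n + 2 * s - 2 * α))) := by
        rw [lintegral_const_mul' _ _ ENNReal.ofReal_ne_top]
        gcongr
        exact hBx x hx
    _ = _ := by
        rw [← ENNReal.ofReal_mul (by positivity), ← mul_assoc]
        ring_nf

lemma IsDefiningFunction.exists_lintegral_linError_le {Ω : Set E} (h : IsDefiningFunction Ω ρ)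
    (hC : 0 ≤ C) (hs1 : s < 1) (hσ0 : σ ≤ 0) (hα0 : 0 ≤ α) (hα : α < 1 + σ)
    (hασ : α + σ < 2 * s) :
    ∃ B : ℝ, 0 ≤ B ∧ ∀ x ∈ Ω,
      ∫⁻ z, ENNReal.ofReal
        (linError C σ ρ x z * ‖z‖ ^ (-((Module.finrank ℝ E : ℝ) + 2 * s))) ∂μ ≤
        ENNReal.ofReal (B * ρ x ^ (σ + α - 2 * s)) := by
  obtain ⟨L, hL, hLip⟩ := h.exists_abs_sub_le
  obtain ⟨H, hH, hρH⟩ := h.exists_forall_le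
  obtain ⟨B₁, hB₁, hnear⟩ := exists_lintegral_ball_linError_le (s := s) (σ := σ) μ hC hL hLip hs1
    (by linarith)
  obtain ⟨B₂, hB₂, hfar⟩ := h.exists_lintegral_compl_ball_linError_le (s := s) μ
    (κ := 1 / (2 * L)) (by positivity) hC hσ0 hα0 hα hασ
  refine ⟨B₁ * H ^ (1 - α) + B₂, by positivity, fun x hx => ?_⟩
  have hρx := (h.mem_iff x).1 hx
  have hexp : ρ x ^ (σ + 1 - 2 * s) ≤ H ^ (1 - α) * ρ x ^ (σ + α - 2 * s) := by
    rw [show σ + 1 - 2 * s = (1 - α) + (σ + α - 2 * s) by ring, Real.rpow_add hρx]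
    gcongr
    · linarith
    · exact hρH x
  rw [← lintegral_add_compl _ (measurableSet_ball (x := (0 : E)) (ε := 1 / (2 * L) * ρ x)),
    add_mul, ENNReal.ofReal_add (by positivity) (by positivity)]
  refine add_le_add ((hnear x hρx).trans ?_) (hfar x hx)
  rw [mul_assoc]
  gcongr

lemma integrable_and_integral_le_of_lintegral_ofReal_le {X : Type*} [MeasurableSpace X]
    {ν : Measure X} {f : X → ℝ} {b : ℝ} (hf : Measurable f) (hf0 : ∀ y, 0 ≤ f y) (hb : 0 ≤ b)
    (h : ∫⁻ y, ENNReal.ofReal (f y) ∂ν ≤ ENNReal.ofReal b) : Integrable f ν ∧ ∫ y, f y ∂ν ≤ b := by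
  refine ⟨⟨hf.aestronglyMeasurable, ?_⟩, ?_⟩
  · rw [hasFiniteIntegral_iff_ofReal (.of_forall hf0)]
    exact h.trans_lt ENNReal.ofReal_lt_top
  · rw [integral_eq_lintegral_of_nonneg_ae (.of_forall hf0) hf.aestronglyMeasurable]
    exact ENNReal.toReal_le_of_le_ofReal hb h

lemma IsDefiningFunction.exists_integral_linError_add_le {Ω : Set E} (h : IsDefiningFunction Ω ρ)
    (hC : 0 ≤ C) (hs1 : s < 1) (hσ0 : σ ≤ 0) (hα0 : 0 ≤ α) (hα : α < 1 + σ)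
    (hασ : α + σ < 2 * s) :
    ∃ B : ℝ, 0 ≤ B ∧ ∀ x ∈ Ω,
      Integrable (fun z => (linError C σ ρ x z + linError C σ ρ x (-z)) *
        ‖z‖ ^ (-((Module.finrank ℝ E : ℝ) + 2 * s))) μ ∧
      ∫ z, (linError C σ ρ x z + linError C σ ρ x (-z)) *
        ‖z‖ ^ (-((Module.finrank ℝ E : ℝ) + 2 * s)) ∂μ ≤ B * ρ x ^ (σ + α - 2 * s) := by
  obtain ⟨B, hB, hBx⟩ := h.exists_lintegral_linError_le μ hC hs1 hσ0 hα0 hα hασ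
  refine ⟨2 * B, by positivity, fun x hx => ?_⟩
  have hρx := (h.mem_iff x).1 hx
  have hm := measurable_linError h.continuous.measurable C σ x
  obtain ⟨hi, hle⟩ := integrable_and_integral_le_of_lintegral_ofReal_le (by fun_prop)
    (fun z => mul_nonneg (linError_nonneg hC σ ρ x z) (by positivity)) (by positivity) (hBx x hx)
  have hi' := hi.comp_neg
  have hle' := (integral_neg_eq_self (fun z => linError C σ ρ x z *
    ‖z‖ ^ (-((Module.finrank ℝ E : ℝ) + 2 * s))) μ).trans_le hle
  simp only [norm_neg] at hi' hle'
  simp only [add_mul]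
  refine ⟨hi.add hi', ?_⟩
  rw [integral_add hi hi']
  linarith

end LinError

namespace IsDefiningFunction

lemma contDiffAt_posRpow {E : Type*} [NormedAddCommGroup E] [NormedSpace ℝ E] {Ω : Set E}
    {ρ : E → ℝ} (h : IsDefiningFunction Ω ρ) (σ : ℝ) {x : E} (hx : x ∈ Ω) :
    ContDiffAt ℝ 2 (fun y => posRpow σ (ρ y)) x :=
  (FracHarm.contDiffAt_posRpow σ ((h.mem_iff x).1 hx)).comp x h.contDiff.contDiffAt

variable {N : ℕ} [Nontrivial (𝔼 N)] {Ω : Set (𝔼 N)} {ρ : 𝔼 N → ℝ} {s γ Γ σ α : ℝ}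

lemma exists_integral_secondDiff_posRpow_le (h : IsDefiningFunction Ω ρ) (hγ : 0 ≤ γ) (hs : 0 < s)
    (hs1 : s < 1) (hσ0 : σ ≤ 0) (hα0 : 0 ≤ α) (hα : α < 1 + σ) (hασ : α + σ < 2 * s)
    (hJ : rpowConst s σ ≤ 0) :
    ∃ B : ℝ, 0 ≤ B ∧ ∀ K : 𝔼 N → ℝ, IsStableKernel s γ Γ K → ∀ x ∈ Ω,
      ∫ z, secondDiff (fun y => posRpow σ (ρ y)) x z * K z ≤
        γ * rpowConst s σ * sphereMoment volume s (gradient ρ x) * ρ x ^ (σ - 2 * s) +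
          B * ρ x ^ (σ + α - 2 * s) := by
  have hσ : -1 < σ := by linarith
  obtain ⟨C, hC, htaylor⟩ := h.exists_abs_sub_inner_gradient_le
  obtain ⟨B, hB0, hB⟩ := h.exists_integral_linError_add_le volume hC.le hs1 hσ0 hα0 hα hασ
  rw [finrank_euclideanSpace_fin] at hB
  refine ⟨|Γ| * B, by positivity, fun K hK x hx => ?_⟩
  rw [abs_of_nonneg (hK.upper_nonneg hγ)]
  have hρx := (h.mem_iff x).1 hx
  obtain ⟨hi, hle⟩ := hB x hx
  have hip := hK.integrable_secondDiff_posRpow_inner hγ hs hs1 hσ hσ0 hρx (gradient ρ x)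
  calc _ ≤ ∫ z, (secondDiff (posRpow σ) (ρ x) (inner ℝ (gradient ρ x) z) * K z +
          Γ * ((linError C σ ρ x z + linError C σ ρ x (-z)) * ‖z‖ ^ (-((N : ℝ) + 2 * s)))) := by
        refine integral_mono_ae (hK.integrable_secondDiff_mul hγ hs hs1
          (h.integrable_posRpow volume hσ hσ0) (h.contDiffAt_posRpow σ hx))
          (hip.add (hi.const_mul Γ)) ?_
        filter_upwards [Measure.ae_ne volume 0] with z hz
        have hEK := mul_le_mul_of_nonneg_left (hK.le hz)
          (add_nonneg (linError_nonneg hC.le σ ρ x z) (linError_nonneg hC.le σ ρ x (-z)))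
        have hmono := mul_le_mul_of_nonneg_right
          (secondDiff_posRpow_comp_le (htaylor x) hσ.le hσ0 z) (hK.nonneg hγ hz)
        rw [add_mul] at hmono
        linarith
    _ ≤ _ := by
        rw [integral_add hip (hi.const_mul Γ), integral_const_mul, mul_assoc Γ]
        gcongr
        · exact hK.integral_secondDiff_posRpow_inner_le hγ hs hs1 hσ hσ0 hJ hρx _
        · exact hK.upper_nonneg hγ

end IsDefiningFunction

section Indicator

variable {E : Type*} [NormedAddCommGroup E] {Ω : Set E} {x z : E} {R : ℝ}

lemma contDiffAt_indicator_one [NormedSpace ℝ E] (hΩ : IsOpen Ω) (hx : x ∈ Ω) :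
    ContDiffAt ℝ 2 (Ω.indicator fun _ => (1 : ℝ)) x := by
  refine (contDiffAt_const (c := (1 : ℝ))).congr_of_eventuallyEq ?_
  filter_upwards [hΩ.mem_nhds hx] with y hy
  exact indicator_of_mem hy _

lemma secondDiff_indicator_one_nonpos (hx : x ∈ Ω) (z : E) :
    secondDiff (Ω.indicator fun _ => (1 : ℝ)) x z ≤ 0 := by
  have hle : ∀ y, Ω.indicator (fun _ => (1 : ℝ)) y ≤ 1 := fun y =>
    indicator_le_self' (fun _ _ => zero_le_one) y
  rw [secondDiff, indicator_of_mem hx]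
  linarith [hle (x + z), hle (x - z)]

lemma secondDiff_indicator_one_eq (hΩ : Ω ⊆ Metric.ball 0 R) (hx : x ∈ Ω) (hz : 2 * R ≤ ‖z‖) :
    secondDiff (Ω.indicator fun _ => (1 : ℝ)) x z = -2 := by
  have hnorm : ∀ y ∈ Ω, ‖y‖ < R := fun y hy => mem_ball_zero_iff.1 (hΩ hy)
  have hplus : x + z ∉ Ω := fun h => by
    have := norm_sub_le (x + z) x
    rw [add_sub_cancel_left] at this
    linarith [hnorm _ h, hnorm x hx]
  have hminus : x - z ∉ Ω := fun h => by
    have := norm_sub_le x (x - z)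
    rw [sub_sub_cancel] at this
    linarith [hnorm _ h, hnorm x hx]
  rw [secondDiff, indicator_of_mem hx, indicator_of_notMem hplus, indicator_of_notMem hminus]
  norm_num

lemma integrable_indicator_one [MeasurableSpace E] [BorelSpace E] [ProperSpace E] (μ : Measure E)
    [IsFiniteMeasureOnCompacts μ] (hΩ : IsOpen Ω) (hb : Bornology.IsBounded Ω) :
    Integrable (Ω.indicator fun _ => (1 : ℝ)) μ := by
  rw [integrable_indicator_iff hΩ.measurableSet]
  exact integrableOn_const hb.measure_lt_top.ne

/-- The open annulus of radii `2 * R` and `3 * R`. For `x` in a subset of the ball of radius `R`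
about the origin, both `x + z` and `x - z` leave that set when `z` lies in the annulus. -/
def escapeAnnulus (E : Type*) [NormedAddCommGroup E] (R : ℝ) : Set E :=
  Metric.ball 0 (3 * R) \ Metric.closedBall 0 (2 * R)

lemma mem_escapeAnnulus : z ∈ escapeAnnulus E R ↔ ‖z‖ < 3 * R ∧ 2 * R < ‖z‖ := by
  simp [escapeAnnulus]

lemma isOpen_escapeAnnulus : IsOpen (escapeAnnulus E R) :=
  Metric.isOpen_ball.sdiff Metric.isClosed_closedBall

lemma isBounded_escapeAnnulus : Bornology.IsBounded (escapeAnnulus E R) :=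
  Metric.isBounded_ball.subset sdiff_subset

lemma nonempty_escapeAnnulus [NormedSpace ℝ E] [Nontrivial E] (hR : 0 < R) :
    (escapeAnnulus E R).Nonempty := by
  obtain ⟨e, he⟩ := exists_norm_eq E (c := 5 / 2 * R) (by positivity)
  exact ⟨e, mem_escapeAnnulus.2 ⟨by linarith, by linarith⟩⟩

end Indicator

section IndicatorIntegral

variable {N : ℕ} [Nontrivial (𝔼 N)] {s γ Γ : ℝ} {Ω : Set (𝔼 N)}

lemma exists_integral_secondDiff_indicator_le (hs : 0 < s) (hs1 : s < 1) (hγ : 0 < γ) (Γ : ℝ)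
    (hΩ : IsOpen Ω) (hb : Bornology.IsBounded Ω) :
    ∃ c : ℝ, 0 < c ∧ ∀ K : 𝔼 N → ℝ, IsStableKernel s γ Γ K → ∀ x ∈ Ω,
      ∫ z, secondDiff (Ω.indicator fun _ => (1 : ℝ)) x z * K z ≤ -c := by
  obtain ⟨R, hR, hΩR⟩ := hb.subset_ball_lt 0 0
  set A := escapeAnnulus (𝔼 N) R
  have hA : volume A ≠ ⊤ := isBounded_escapeAnnulus.measure_lt_top.ne
  have : 0 < volume.real A := ENNReal.toReal_pos
    (isOpen_escapeAnnulus.measure_pos _ (nonempty_escapeAnnulus hR)).ne' hA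
  set k := γ * (3 * R) ^ (-((N : ℝ) + 2 * s))
  refine ⟨2 * k * volume.real A, by positivity, fun K hK x hx => ?_⟩
  have hkK : ∀ z ∈ A, k ≤ K z := fun z hz => by
    obtain ⟨hz3, hz2⟩ := mem_escapeAnnulus.1 hz
    have hz0 : 0 < ‖z‖ := by linarith
    refine le_trans ?_ (hK.ge (norm_pos_iff.1 hz0))
    gcongr ?_ * ?_
    exact Real.rpow_le_rpow_of_nonpos hz0 hz3.le (by linarith [(N.cast_nonneg : (0 : ℝ) ≤ N)])
  calc _ ≤ ∫ z, A.indicator (fun _ => -(2 * k)) z := by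
        refine integral_mono_ae (hK.integrable_secondDiff_mul hγ.le hs hs1
          (integrable_indicator_one volume hΩ hb) (contDiffAt_indicator_one hΩ hx))
          ((integrable_indicator_iff isOpen_escapeAnnulus.measurableSet).2
            (integrableOn_const hA)) ?_
        filter_upwards [Measure.ae_ne volume 0] with z hz
        by_cases hzA : z ∈ A
        · rw [indicator_of_mem hzA,
            secondDiff_indicator_one_eq hΩR hx (mem_escapeAnnulus.1 hzA).2.le]
          linarith [hkK z hzA]
        · rw [indicator_of_notMem hzA]
          exact mul_nonpos_of_nonpos_of_nonneg (secondDiff_indicator_one_nonpos hx z)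
            (hK.nonneg hγ.le hz)
    _ = _ := by
        rw [integral_indicator isOpen_escapeAnnulus.measurableSet, setIntegral_const, smul_eq_mul]
        ring

lemma IsStableKernel.integral_secondDiff_add {K : 𝔼 N → ℝ} (hK : IsStableKernel s γ Γ K)
    (hγ : 0 ≤ γ) (hs : 0 < s) (hs1 : s < 1) {v w : 𝔼 N → ℝ} {x : 𝔼 N} (hv : Integrable v)
    (hw : Integrable w) (hvx : ContDiffAt ℝ 2 v x) (hwx : ContDiffAt ℝ 2 w x) :
    ∫ z, secondDiff (fun y => v y + w y) x z * K z =
      (∫ z, secondDiff v x z * K z) + ∫ z, secondDiff w x z * K z := by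
  simp only [secondDiff_add, add_mul]
  exact integral_add (hK.integrable_secondDiff_mul hγ hs hs1 hv hvx)
    (hK.integrable_secondDiff_mul hγ hs hs1 hw hwx)

end IndicatorIntegral

section Profile

/-- The function `ρ ^ (s - 1) + ρ ^ (s - 1 + η)`, extended by zero. The first power is annihilated
to leading order by the operators near the boundary; the correction makes the result negative. -/
def boundaryProfile {E : Type*} (s η : ℝ) (ρ : E → ℝ) (y : E) : ℝ :=
  posRpow (s - 1) (ρ y) + posRpow (s - 1 + η) (ρ y)

lemma rpow_le_boundaryProfile {E : Type*} {s η : ℝ} {ρ : E → ℝ} {y : E} (hy : 0 < ρ y) :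
    ρ y ^ (s - 1) ≤ boundaryProfile s η ρ y := by
  rw [boundaryProfile, posRpow_of_pos hy]
  exact le_add_of_nonneg_right (posRpow_nonneg _ _)

lemma exists_mul_rpow_add_rpow_lt {a b m : ℝ} (B : ℝ) (ha : 0 < a) (hb : 0 < b) (hm : 0 < m) :
    ∃ d : ℝ, 0 < d ∧ ∀ t, 0 < t → t < d → B * (t ^ a + t ^ b) < m := by
  have hcont : ContinuousAt (fun t : ℝ => B * (t ^ a + t ^ b)) 0 :=
    continuousAt_const.mul ((Real.continuousAt_rpow_const 0 a (.inr ha.le)).add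
      (Real.continuousAt_rpow_const 0 b (.inr hb.le)))
  have hlt : B * ((0 : ℝ) ^ a + 0 ^ b) < m := by
    simpa [Real.zero_rpow ha.ne', Real.zero_rpow hb.ne'] using hm
  obtain ⟨d, hd, hball⟩ := Metric.eventually_nhds_iff.1 (hcont.eventually (gt_mem_nhds hlt))
  exact ⟨d, hd, fun t ht htd => hball (by rwa [Real.dist_0_eq_abs, abs_of_pos ht])⟩

namespace IsDefiningFunction

section General

variable {E : Type*} [NormedAddCommGroup E] [InnerProductSpace ℝ E] {Ω : Set E} {ρ : E → ℝ}
  {s η : ℝ}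

lemma contDiffAt_boundaryProfile (h : IsDefiningFunction Ω ρ) (s η : ℝ) {x : E} (hx : x ∈ Ω) :
    ContDiffAt ℝ 2 (boundaryProfile s η ρ) x :=
  (h.contDiffAt_posRpow _ hx).add (h.contDiffAt_posRpow _ hx)

variable [FiniteDimensional ℝ E] [MeasurableSpace E] [BorelSpace E] (μ : Measure E)
  [μ.IsAddHaarMeasure]

lemma integrable_boundaryProfile (h : IsDefiningFunction Ω ρ) (hs : 0 < s) (hη : 0 ≤ η)
    (hηs : η ≤ 1 - s) : Integrable (boundaryProfile s η ρ) μ :=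
  (h.integrable_posRpow μ (by linarith) (by linarith)).add
    (h.integrable_posRpow μ (by linarith) (by linarith))

lemma exists_le_sphereMoment_gradient (h : IsDefiningFunction Ω ρ) (hs : 0 < s) :
    ∃ m : ℝ, 0 < m ∧ ∃ d : ℝ, 0 < d ∧ ∀ x ∈ Ω, ρ x < d →
      m ≤ sphereMoment μ s (gradient ρ x) := by
  obtain ⟨c, hc, hmoment⟩ := exists_le_sphereMoment μ hs
  obtain ⟨c₀, hc₀, d, hd, hgrad⟩ := h.exists_le_norm_fderiv
  refine ⟨c * c₀ ^ (2 * s), by positivity, d, hd, fun x hx hxd => ?_⟩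
  refine le_trans ?_ (hmoment (gradient ρ x))
  rw [norm_gradient_eq_norm_fderiv]
  gcongr
  exact hgrad x (subset_closure hx) hxd

end General

variable {N : ℕ} [Nontrivial (𝔼 N)] {Ω : Set (𝔼 N)} {ρ : 𝔼 N → ℝ} {s γ η α : ℝ}

lemma exists_integral_secondDiff_boundaryProfile_le (h : IsDefiningFunction Ω ρ) (hs : 0 < s)
    (hs1 : s < 1) (hγ : 0 ≤ γ) (Γ : ℝ) (hη : 0 < η) (hηα : η < α) (hαs : α < s)
    (hαs1 : α < 1 - s) :
    ∃ B : ℝ, 0 ≤ B ∧ ∀ K : 𝔼 N → ℝ, IsStableKernel s γ Γ K → ∀ x ∈ Ω,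
      ∫ z, secondDiff (boundaryProfile s η ρ) x z * K z ≤
        (γ * rpowConst s (s - 1 + η) * sphereMoment volume s (gradient ρ x) +
          B * (ρ x ^ (α - η) + ρ x ^ α)) * ρ x ^ (s - 1 + η - 2 * s) := by
  have hJ := rpowConst_sub_one_nonpos hs hs1
  obtain ⟨B₁, hB₁, hI₁⟩ := h.exists_integral_secondDiff_posRpow_le (Γ := Γ) (α := α) hγ hs hs1
    (by linarith) (by linarith) (by linarith) (by linarith) hJ
  obtain ⟨B₂, hB₂, hI₂⟩ := h.exists_integral_secondDiff_posRpow_le (Γ := Γ) (α := α)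
    (σ := s - 1 + η) hγ hs hs1 (by linarith) (by linarith) (by linarith) (by linarith)
    (rpowConst_neg hs hs1 hη (by linarith) (by linarith)).le
  refine ⟨B₁ + B₂, by positivity, fun K hK x hx => ?_⟩
  have hρ := (h.mem_iff x).1 hx
  have hmain : γ * rpowConst s (s - 1) * sphereMoment volume s (gradient ρ x) *
      ρ x ^ (s - 1 - 2 * s) ≤ 0 :=
    mul_nonpos_of_nonpos_of_nonneg (mul_nonpos_of_nonpos_of_nonneg
      (mul_nonpos_of_nonneg_of_nonpos hγ hJ) (sphereMoment_nonneg _ _ _)) (by positivity)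
  have hexp₁ : ρ x ^ (s - 1 + α - 2 * s) = ρ x ^ (α - η) * ρ x ^ (s - 1 + η - 2 * s) := by
    rw [← Real.rpow_add hρ]
    ring_nf
  have hexp₂ : ρ x ^ (s - 1 + η + α - 2 * s) = ρ x ^ α * ρ x ^ (s - 1 + η - 2 * s) := by
    rw [← Real.rpow_add hρ]
    ring_nf
  have hI₁x := hI₁ K hK x hx
  have hI₂x := hI₂ K hK x hx
  rw [hexp₁] at hI₁x
  rw [hexp₂] at hI₂x
  have hB₁₂ : 0 ≤ B₁ * ρ x ^ α + B₂ * ρ x ^ (α - η) := by positivity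
  have := mul_nonneg hB₁₂ (by positivity : 0 ≤ ρ x ^ (s - 1 + η - 2 * s))
  unfold boundaryProfile
  rw [hK.integral_secondDiff_add hγ hs hs1 (h.integrable_posRpow volume (by linarith)
    (by linarith)) (h.integrable_posRpow volume (by linarith) (by linarith))
    (h.contDiffAt_posRpow _ hx) (h.contDiffAt_posRpow _ hx)]
  linarith

lemma exists_integral_secondDiff_boundaryProfile_nonpos (h : IsDefiningFunction Ω ρ) (hs : 0 < s)
    (hs1 : s < 1) (hγ : 0 < γ) (Γ : ℝ) (hη : 0 < η) (hηs : η < s) (hηs1 : η < 1 - s) :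
    ∃ d : ℝ, 0 < d ∧ ∀ K : 𝔼 N → ℝ, IsStableKernel s γ Γ K → ∀ x ∈ Ω, ρ x < d →
      ∫ z, secondDiff (boundaryProfile s η ρ) x z * K z ≤ 0 := by
  obtain ⟨α, hηα, hα⟩ := exists_between (lt_min hηs hηs1)
  obtain ⟨hαs, hαs1⟩ := lt_min_iff.1 hα
  have hJ := neg_pos.2 (rpowConst_neg hs hs1 hη hηs hηs1)
  obtain ⟨B, -, hB⟩ := h.exists_integral_secondDiff_boundaryProfile_le hs hs1 hγ.le Γ hη hηα hαs
    hαs1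
  obtain ⟨m, hm, d₁, hd₁, hmoment⟩ := h.exists_le_sphereMoment_gradient volume hs
  obtain ⟨d₂, hd₂, hsmall⟩ := exists_mul_rpow_add_rpow_lt B (sub_pos.2 hηα) (hη.trans hηα)
    (by positivity : 0 < γ * -rpowConst s (s - 1 + η) * m)
  refine ⟨min d₁ d₂, lt_min hd₁ hd₂, fun K hK x hx hxd => (hB K hK x hx).trans ?_⟩
  have hρ := (h.mem_iff x).1 hx
  obtain ⟨hxd₁, hxd₂⟩ := lt_min_iff.1 hxd
  refine mul_nonpos_of_nonpos_of_nonneg ?_ (by positivity)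
  have hmain := mul_le_mul_of_nonneg_left (hmoment x hx hxd₁)
    (by positivity : 0 ≤ γ * -rpowConst s (s - 1 + η))
  linarith [hsmall (ρ x) hρ hxd₂]

lemma exists_integral_secondDiff_boundaryProfile_le_const (h : IsDefiningFunction Ω ρ) (hs : 0 < s)
    (hs1 : s < 1) (hγ : 0 < γ) (Γ : ℝ) (hη : 0 < η) (hηs : η < s) (hηs1 : η < 1 - s) :
    ∃ P : ℝ, 0 ≤ P ∧ ∀ K : 𝔼 N → ℝ, IsStableKernel s γ Γ K → ∀ x ∈ Ω,
      ∫ z, secondDiff (boundaryProfile s η ρ) x z * K z ≤ P := by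
  obtain ⟨α, hηα, hα⟩ := exists_between (lt_min hηs hηs1)
  obtain ⟨hαs, hαs1⟩ := lt_min_iff.1 hα
  have hJ := rpowConst_neg hs hs1 hη hηs hηs1
  obtain ⟨B, hB0, hB⟩ := h.exists_integral_secondDiff_boundaryProfile_le hs hs1 hγ.le Γ hη hηα hαs
    hαs1
  obtain ⟨d, hd, hnear⟩ := h.exists_integral_secondDiff_boundaryProfile_nonpos hs hs1 hγ Γ hη hηs
    hηs1
  obtain ⟨H, hH, hρH⟩ := h.exists_forall_le
  refine ⟨B * (H ^ (α - η) + H ^ α) * d ^ (s - 1 + η - 2 * s), by positivity,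
    fun K hK x hx => ?_⟩
  rcases lt_or_ge (ρ x) d with hxd | hxd
  · exact (hnear K hK x hx hxd).trans (by positivity)
  have hρ := (h.mem_iff x).1 hx
  have hmain : γ * rpowConst s (s - 1 + η) * sphereMoment volume s (gradient ρ x) ≤ 0 :=
    mul_nonpos_of_nonpos_of_nonneg (mul_nonpos_of_nonneg_of_nonpos hγ.le hJ.le)
      (sphereMoment_nonneg _ _ _)
  calc _ ≤ _ := hB K hK x hx
    _ ≤ B * (ρ x ^ (α - η) + ρ x ^ α) * ρ x ^ (s - 1 + η - 2 * s) := by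
        gcongr
        linarith
    _ ≤ _ := by
        gcongr B * (?_ + ?_) * ?_
        · exact Real.rpow_le_rpow hρ.le (hρH x) (by linarith)
        · exact Real.rpow_le_rpow hρ.le (hρH x) (by linarith)
        · exact Real.rpow_le_rpow_of_nonpos hd hxd (by linarith)

end IsDefiningFunction

end Profile

section Barrier

/-- `w` is a strict supersolution in `Ω` for all kernels of the class, vanishing outside `Ω` and
blowing up at the boundary at least like the power `s - 1` of the distance. -/
structure IsBarrier {N : ℕ} (s γ Γ : ℝ) (Ω : Set (𝔼 N)) (w : 𝔼 N → ℝ) : Prop where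
  integrable : Integrable w
  contDiffAt : ∀ x ∈ Ω, ContDiffAt ℝ 2 w x
  pos : ∀ x ∈ Ω, 0 < w x
  eq_zero : ∀ x ∉ Ω, w x = 0
  exists_le : ∃ c : ℝ, 0 < c ∧ ∀ x ∈ Ω, c * bdist Ω x ^ (s - 1) ≤ w x
  integral_le : ∀ K : 𝔼 N → ℝ, IsStableKernel s γ Γ K → ∀ x ∈ Ω,
    ∫ z, secondDiff w x z * K z ≤ -1

namespace IsDefiningFunction

variable {N : ℕ} {Ω : Set (𝔼 N)} {ρ : 𝔼 N → ℝ} {s γ η : ℝ}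

lemma exists_mul_bdist_rpow_le [Nontrivial (𝔼 N)] (h : IsDefiningFunction Ω ρ) {σ : ℝ}
    (hσ : σ ≤ 0) : ∃ c : ℝ, 0 < c ∧ ∀ x ∈ Ω, c * bdist Ω x ^ σ ≤ ρ x ^ σ := by
  obtain ⟨L, hL, hLip⟩ := h.exists_abs_sub_le
  refine ⟨L ^ σ, by positivity, fun x hx => ?_⟩
  have hρ := (h.mem_iff x).1 hx
  have hne : (frontier Ω).Nonempty := nonempty_frontier_iff.2 ⟨⟨x, hx⟩, fun hΩ =>
    NormedSpace.unbounded_univ ℝ (𝔼 N) (hΩ ▸ h.isBounded)⟩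
  have hle : ρ x / L ≤ bdist Ω x := by
    refine (Metric.le_infDist hne).2 fun y hy => ?_
    have := hLip x y
    rwa [h.eq_zero hy, sub_zero, abs_of_pos hρ, ← dist_eq_norm, ← div_le_iff₀' hL] at this
  rw [← Real.mul_rpow hL.le ((div_nonneg hρ.le hL.le).trans hle)]
  exact Real.rpow_le_rpow_of_nonpos hρ ((div_le_iff₀' hL).1 hle) hσ

variable [Nontrivial (𝔼 N)]

lemma exists_integral_secondDiff_add_indicator_le (h : IsDefiningFunction Ω ρ) (hs : 0 < s)
    (hs1 : s < 1) (hγ : 0 < γ) (Γ : ℝ) (hη : 0 < η) (hηs : η < s) (hηs1 : η < 1 - s) :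
    ∃ M : ℝ, 0 ≤ M ∧ ∀ K : 𝔼 N → ℝ, IsStableKernel s γ Γ K → ∀ x ∈ Ω,
      ∫ z, secondDiff (fun y => boundaryProfile s η ρ y + M * Ω.indicator (fun _ => (1 : ℝ)) y) x z
        * K z ≤ -1 := by
  obtain ⟨P, hP, hprofile⟩ := h.exists_integral_secondDiff_boundaryProfile_le_const hs hs1 hγ Γ hη
    hηs hηs1
  obtain ⟨c, hc, hindicator⟩ := exists_integral_secondDiff_indicator_le hs hs1 hγ Γ h.isOpen
    h.isBounded
  refine ⟨(P + 1) / c, by positivity, fun K hK x hx => ?_⟩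
  rw [hK.integral_secondDiff_add hγ.le hs hs1 (h.integrable_boundaryProfile volume hs hη.le hηs1.le)
    ((integrable_indicator_one volume h.isOpen h.isBounded).const_mul _)
    (h.contDiffAt_boundaryProfile s η hx)
    (contDiffAt_const.mul (contDiffAt_indicator_one h.isOpen hx))]
  simp only [secondDiff_const_mul, mul_assoc, integral_const_mul]
  have hle := mul_le_mul_of_nonneg_left (hindicator K hK x hx) (by positivity : 0 ≤ (P + 1) / c)
  rw [mul_neg, div_mul_cancel₀ _ hc.ne'] at hle
  linarith [hprofile K hK x hx]

lemma exists_isBarrier (h : IsDefiningFunction Ω ρ) (hs : 0 < s) (hs1 : s < 1) (hγ : 0 < γ)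
    (Γ : ℝ) : ∃ w, IsBarrier s γ Γ Ω w := by
  obtain ⟨η, hη, hηmin⟩ := exists_between (lt_min hs (sub_pos.2 hs1))
  obtain ⟨hηs, hηs1⟩ := lt_min_iff.1 hηmin
  obtain ⟨c, hc, hdist⟩ := h.exists_mul_bdist_rpow_le (σ := s - 1) (by linarith)
  obtain ⟨M, hM, hintegral⟩ := h.exists_integral_secondDiff_add_indicator_le hs hs1 hγ Γ hη hηs hηs1
  set w := fun y => boundaryProfile s η ρ y + M * Ω.indicator (fun _ => (1 : ℝ)) y
  have hw : ∀ x ∈ Ω, ρ x ^ (s - 1) ≤ w x := fun x hx => by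
    simp only [w]
    rw [indicator_of_mem hx, mul_one]
    exact (rpow_le_boundaryProfile ((h.mem_iff x).1 hx)).trans (le_add_of_nonneg_right hM)
  exact ⟨w,
    { integrable := (h.integrable_boundaryProfile volume hs hη.le hηs1.le).add
        ((integrable_indicator_one volume h.isOpen h.isBounded).const_mul M)
      contDiffAt := fun x hx => (h.contDiffAt_boundaryProfile s η hx).add
        (contDiffAt_const.mul (contDiffAt_indicator_one h.isOpen hx))
      pos := fun x hx => (Real.rpow_pos_of_pos ((h.mem_iff x).1 hx) _).trans_le (hw x hx)
      eq_zero := fun x hx => by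
        have hρ : ρ x ≤ 0 := not_lt.1 fun hpos => hx ((h.mem_iff x).2 hpos)
        simp [w, boundaryProfile, posRpow_of_nonpos hρ, hx]
      exists_le := ⟨c, hc, fun x hx => (hdist x hx).trans (hw x hx)⟩
      integral_le := hintegral }⟩

end IsDefiningFunction

end Barrier

lemma exists_isMaxOn_of_eventually_neg {X : Type*} [TopologicalSpace X] {Ω : Set X} {g : X → ℝ}
    (hΩ : IsOpen Ω) (hc : IsCompact (closure Ω)) (hg : UpperSemicontinuousOn g Ω)
    (hneg : ∀ x ∈ frontier Ω, ∀ᶠ z in 𝓝[Ω] x, g z < 0) {x₁ : X} (hx₁ : x₁ ∈ Ω) (hpos : 0 < g x₁) :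
    ∃ x₀ ∈ Ω, 0 < g x₀ ∧ IsMaxOn g Ω x₀ := by
  set p := Ω.indicator fun x => max (g x) 0
  have hp : ∀ x ∈ Ω, p x = max (g x) 0 := fun x hx => indicator_of_mem hx _
  have hp0 : ∀ x ∉ Ω, p x = 0 := fun x hx => indicator_of_notMem hx _
  have husc : UpperSemicontinuousOn p (closure Ω) := by
    intro x hx y hy
    by_cases hxΩ : x ∈ Ω
    · rw [hp x hxΩ, max_lt_iff] at hy
      have h := hg x hxΩ y hy.1
      rw [hΩ.nhdsWithin_eq hxΩ] at h
      filter_upwards [nhdsWithin_le_nhds h, nhdsWithin_le_nhds (hΩ.mem_nhds hxΩ)] with z hz hzΩ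
      rw [hp z hzΩ]
      exact max_lt hz hy.2
    · rw [hp0 x hxΩ] at hy
      filter_upwards [nhdsWithin_le_nhds
        (eventually_nhdsWithin_iff.1 (hneg x (hΩ.frontier_eq ▸ ⟨hx, hxΩ⟩)))] with z hz
      by_cases hzΩ : z ∈ Ω
      · rw [hp z hzΩ]
        exact max_lt ((hz hzΩ).trans hy) hy
      · rwa [hp0 z hzΩ]
  obtain ⟨x₀, -, hmax⟩ := husc.exists_isMaxOn ⟨x₁, subset_closure hx₁⟩ hc
  have hle : ∀ x ∈ Ω, g x ≤ p x₀ := fun x hx =>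
    (le_max_left _ _).trans ((hp x hx).symm.trans_le (hmax (subset_closure hx)))
  have hp₀ : 0 < p x₀ := hpos.trans_le (hle x₁ hx₁)
  have hx₀ : x₀ ∈ Ω := by_contra fun h => hp₀.ne' (hp0 x₀ h)
  rw [hp x₀ hx₀] at hp₀ hle
  have hg₀ : 0 < g x₀ := (lt_max_iff.1 hp₀).resolve_right (lt_irrefl 0)
  rw [max_eq_left hg₀.le] at hle
  exact ⟨x₀, hx₀, hg₀, hle⟩

lemma isaacsDelta_le {N : ℕ} {I J : Type*} [Nonempty I] {K : I → J → 𝔼 N → ℝ} {δ c : ℝ}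
    {u φ : 𝔼 N → ℝ} {x : 𝔼 N}
    (h : ∀ i j, pvOp (K i j) (Metric.ball x δ) φ x + pvOp (K i j) (Metric.ball x δ)ᶜ u x ≤ c) :
    isaacsDelta K δ u φ x ≤ (c : EReal) :=
  (iInf_le _ (Classical.arbitrary I)).trans (iSup_le fun j => EReal.coe_le_coe_iff.2 (h _ j))

namespace IsBarrier

variable {N : ℕ} {s γ Γ ε : ℝ} {Ω : Set (𝔼 N)} {u w : 𝔼 N → ℝ} {x₀ x₁ : 𝔼 N}

lemma eventually_lt (hw : IsBarrier s γ Γ Ω w) (hΩ : IsOpen Ω) (hε : 0 < ε) {x : 𝔼 N}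
    (hx : x ∈ frontier Ω)
    (hlim : limsup (fun z => ((bdist Ω z ^ (1 - s) * u z : ℝ) : EReal)) (𝓝[Ω] x) ≤ 0) :
    ∀ᶠ z in 𝓝[Ω] x, u z < ε * w z := by
  obtain ⟨c, hc, hcw⟩ := hw.exists_le
  have hεc : (0 : EReal) < ((ε * c : ℝ) : EReal) := by
    exact_mod_cast (by positivity : 0 < ε * c)
  filter_upwards [eventually_lt_of_limsup_lt (hlim.trans_lt hεc), self_mem_nhdsWithin] with z hz hzΩ
  have hd : 0 < bdist Ω z := (isClosed_frontier.notMem_iff_infDist_pos ⟨x, hx⟩).1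
    fun hzf => (hΩ.frontier_eq ▸ hzf).2 hzΩ
  have hd' : 0 < bdist Ω z ^ (1 - s) := by positivity
  refine lt_of_mul_lt_mul_left ?_ hd'.le
  calc bdist Ω z ^ (1 - s) * u z < ε * c := by exact_mod_cast hz
    _ = bdist Ω z ^ (1 - s) * (ε * (c * bdist Ω z ^ (s - 1))) := by
        rw [← neg_sub 1 s, Real.rpow_neg hd.le]
        field_simp
    _ ≤ bdist Ω z ^ (1 - s) * (ε * w z) := by
        gcongr
        exact hcw z hzΩ

lemma exists_isMaxOn (hw : IsBarrier s γ Γ Ω w) (hΩ : IsOpen Ω) (hb : Bornology.IsBounded Ω)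
    (hu : UpperSemicontinuousOn u Ω)
    (hlim : ∀ x ∈ frontier Ω,
      limsup (fun z => ((bdist Ω z ^ (1 - s) * u z : ℝ) : EReal)) (𝓝[Ω] x) ≤ 0)
    (hx₁ : x₁ ∈ Ω) (hpos : 0 < u x₁) :
    ∃ ε : ℝ, 0 < ε ∧ ∃ x₀ ∈ Ω, 0 < u x₀ - ε * w x₀ ∧ IsMaxOn (fun y => u y - ε * w y) Ω x₀ := by
  have hw₁ := hw.pos x₁ hx₁
  have hε : 0 < u x₁ / (2 * w x₁) := by positivity
  refine ⟨_, hε,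
    exists_isMaxOn_of_eventually_neg hΩ hb.isCompact_closure ?_ (fun x hx => ?_) hx₁ ?_⟩
  · simp only [sub_eq_add_neg]
    exact hu.add (ContinuousOn.upperSemicontinuousOn fun x hx =>
      (continuousAt_const.mul (hw.contDiffAt x hx).continuousAt).neg.continuousWithinAt)
  · simpa only [sub_neg] using hw.eventually_lt hΩ hε hx (hlim x hx)
  · have : u x₁ / (2 * w x₁) * w x₁ = u x₁ / 2 := by field_simp
    linarith

lemma ae_sub_le (hw : IsBarrier s γ Γ Ω w) (hΩ : IsOpen Ω) (hnull : volume (frontier Ω) = 0)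
    (hext : ∀ x ∉ closure Ω, u x ≤ 0) (hpos : 0 ≤ u x₀ - ε * w x₀)
    (hmax : IsMaxOn (fun y => u y - ε * w y) Ω x₀) :
    ∀ᵐ y, u y - u x₀ ≤ ε * w y - ε * w x₀ := by
  filter_upwards [measure_eq_zero_iff_ae_notMem.1 hnull] with y hy
  by_cases hyΩ : y ∈ Ω
  · have : u y - ε * w y ≤ u x₀ - ε * w x₀ := hmax hyΩ
    linarith
  · have huy := hext y fun hyc => hy (hΩ.frontier_eq ▸ ⟨hyc, hyΩ⟩)
    rw [hw.eq_zero y hyΩ]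
    linarith

lemma isaacsDelta_le [Nontrivial (𝔼 N)] (hw : IsBarrier s γ Γ Ω w) {I J : Type*} [Nonempty I]
    {K : I → J → 𝔼 N → ℝ} (hK : ∀ i j, IsStableKernel s γ Γ (K i j)) (hγ : 0 ≤ γ) (hs : 0 < s)
    (hs1 : s < 1) (hu : MemL1Weight s u) {δ : ℝ} (hδ : 0 < δ) (hε : 0 ≤ ε) (hx₀ : x₀ ∈ Ω)
    (hle : ∀ᵐ y, u y - u x₀ ≤ ε * w y - ε * w x₀) :
    isaacsDelta K δ u (fun y => ε * w y) x₀ ≤ ((-(ε / 2) : ℝ) : EReal) := by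
  refine FracHarm.isaacsDelta_le fun i j => ?_
  refine ((hK i j).pvOp_add_pvOp_le hγ hs hs1 hu (hw.integrable.const_mul ε)
    (contDiffAt_const.mul (hw.contDiffAt x₀ hx₀)) hδ hle).trans ?_
  simp only [secondDiff_const_mul, mul_assoc]
  rw [integral_const_mul]
  linarith [mul_le_mul_of_nonneg_left (hw.integral_le (K i j) (hK i j) x₀ hx₀) hε]

end IsBarrier

end FracHarm

end

theorem proposition3p2_general {N : ℕ} (hN : 1 ≤ N) {s γ Γ : ℝ} (hs0 : 0 < s) (hs1 : s < 1)
    (hγ : 0 < γ) {I J : Type*} [Nonempty I] {K : I → J → EuclideanSpace ℝ (Fin N) → ℝ}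
    (hK : ∀ i j, FracHarm.IsStableKernel s γ Γ (K i j))
    {Ω : Set (EuclideanSpace ℝ (Fin N))} (hΩ : IsOpen Ω) (hb : Bornology.IsBounded Ω)
    (hΩ2 : FracHarm.HasC2Boundary Ω) {u : EuclideanSpace ℝ (Fin N) → ℝ}
    (hu : FracHarm.MemL1Weight s u) (husc : UpperSemicontinuousOn u Ω)
    (hvisc : ∀ x₀ ∈ Ω, ∀ δ : ℝ, 0 < δ → Metric.ball x₀ δ ⊆ Ω →
      ∀ φ : EuclideanSpace ℝ (Fin N) → ℝ, ContDiffOn ℝ 2 φ (Metric.ball x₀ δ) →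
        IntegrableOn φ (Metric.ball x₀ δ) →
        IsMaxOn (fun y => u y - φ y) (Metric.ball x₀ δ) x₀ →
        0 ≤ FracHarm.isaacsDelta K δ u φ x₀)
    (hext : ∀ x ∉ closure Ω, u x ≤ 0)
    (hlim : ∀ x ∈ frontier Ω,
      limsup (fun z => ((FracHarm.bdist Ω z ^ (1 - s) * u z : ℝ) : EReal)) (𝓝[Ω] x) ≤ 0) :
    ∀ x ∈ Ω, u x ≤ 0 := by
  have : Nonempty (Fin N) := ⟨⟨0, hN⟩⟩
  obtain ⟨ρ, hρ⟩ := hΩ2.exists_isDefiningFunction hΩ hb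
  obtain ⟨w, hw⟩ := hρ.exists_isBarrier hs0 hs1 hγ Γ
  intro x₁ hx₁
  by_contra! hpos
  obtain ⟨ε, hε, x₀, hx₀, hpos₀, hmax⟩ := hw.exists_isMaxOn hΩ hb husc hlim hx₁ hpos
  obtain ⟨δ, hδ, hball⟩ := Metric.isOpen_iff.1 hΩ x₀ hx₀
  have hle := hw.isaacsDelta_le hK hγ.le hs0 hs1 hu hδ hε.le hx₀
    (hw.ae_sub_le hΩ (hρ.measure_frontier volume) hext hpos₀.le hmax)
  have hge := hvisc x₀ hx₀ δ hδ hball (fun y => ε * w y)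
    (fun y hy => (contDiffAt_const.mul (hw.contDiffAt y (hball hy))).contDiffWithinAt)
    (hw.integrable.const_mul ε).integrableOn (hmax.on_subset hball)
  have : 0 ≤ -(ε / 2) := EReal.coe_nonneg.1 (hge.trans hle)
  linarith

theorem proposition3p2 (N : ℕ) (hN : 1 ≤ N) (s γ Γ : ℝ) (hs0 : 0 < s) (hs1 : s < 1)
    (hγ : 0 < γ) (hγΓ : γ ≤ Γ) (I J : Type*) [Nonempty I] [Nonempty J]
    (K : I → J → EuclideanSpace ℝ (Fin N) → ℝ)
    (hK : ∀ i j, FracHarm.IsStableKernel s γ Γ (K i j))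
    (Ω : Set (EuclideanSpace ℝ (Fin N))) (hΩ : FracHarm.IsBoundedC2Domain Ω)
    (u : EuclideanSpace ℝ (Fin N) → ℝ)
    (hu : FracHarm.IsDirichletSubsolution s K Ω (fun _ => 0) (fun _ => 0) (fun _ => 0) u) :
    ∀ x ∈ Ω, u x ≤ 0 :=
  proposition3p2_general hN hs0 hs1 hγ hK hΩ.isOpen hΩ.isBounded hΩ.boundary
    hu.subsolution.memL1Weight hu.subsolution.usc hu.subsolution.viscosity hu.exterior hu.boundary
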